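/- **Frames and pea pods.** Let $a\neq b$ be points of $\mathbb R^3$. A pea pod frame $\Sigma$ with longitudinal beam $ab$ consists of a plane $H\ni a,b$, a line (the axis) $L\subset H$ perpendicular to $ab$, and two circles in $H$ through $a$ and $b$ with centres on $L$. One circle is called principal, with centre $c_\Sigma$ and radius $r_\Sigma$; the other is called secondary. Let $m$ be the midpoint of $ab$. The frame is of one of three types: * *elliptic*: $m$ does not lie strictly between the two centres, and the principal centre is strictly closer to $m$ than the secondary one; * *hyperbolic*: $m$ lies strictly between the two centres, and the principal circle is strictly smaller than the secondary one; * *parabolic*: the second circle is replaced by the line $ab$, and $c_\Sigma\notin ab$. The *peas* of $\Sigma$ are the disks in $H$ (of radius $\ge 0$) that lie inside the principal circle, are tangent to it, and, respectively, * lie outside the secondary circle and are tangent to it (elliptic); * lie inside the secondary circle and are tangent to it (hyperbolic); * are tangent to the line $ab$ and lie on the side of it opposite to $c_\Sigma$ (parabolic). Let $E(\Sigma)$ be the set of centres of peas, and for $x\in E(\Sigma)$ let $R_\Sigma(x)=r_\Sigma-|x-c_\Sigma|$ be the radius of the pea at $x$. The centres of the peas lie on a conic in $H$, the *pea string*: an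 ellipse or a hyperbola whose foci are the two centres, or a parabola with focus $c_\Sigma$. The *bulb* is the pea whose centre lies on $L$. **Convex confocal pairs.** Two pea pods are *confocal* if they have the same axis and orthogonal planes, and the foci of each pea string lie on the other pea string. They are *convex confocal* if, in addition, the principal centre of one of them is the centre of the bulb of the other. **Wedge-pod surfaces and boundary curves.** For $x\in E(\Sigma)$ and $y\neq x$ put $$\varphi_\Sigma(x,y)=x+R_\Sigma(x)\,\frac{x-y}{|x-y|}.$$ The wedge-pod surface of $\Sigma$ relative to $\Sigma'$ is $\{\varphi_\Sigma(x,y): x\in E(\Sigma),\ y\in E(\Sigma')\}$. **The surface $\Im$.** Let $abcd$ be a regular tetrahedron of side $2$. For each of the three pairs of opposite edges choose a pair of convex confocal pea pods having these edges as longitudinal beams, and let $(AB),(CD),(AC),(BD),(AD),(BC)$ be the six resulting wedge-pod surfaces, each taken relative to the pea pod on the opposite edge. For a vertex $v$ and an edge $e\not\ni v$ with pea pod $\Sigma_e$, let $\Gamma_{v,e}=\{\varphi_{\Sigma_e}(x,v): x\in E(\Sigma_e)\}$, and let $\Gamma_v$ be the union of the three curves $\Gamma_{v,e}$ over the edges $e\not\ni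 v$. Let $(V)$ be the cap of the sphere $\mathbb S(v,2)$ bounded by $\Gamma_v$ and contained in the boundary of the Reuleaux tetrahedron $T$ (the intersection of the four closed balls of radius $2$ centred at $a,b,c,d$); that is, $\Gamma_v$ together with the component of $\mathbb S(v,2)\setminus\Gamma_v$ contained in $\partial T$. Let $\Im$ be the union of the six wedge-pod surfaces and the four caps. **Theorem.** $\Im$ is the boundary of a convex body $K$ (compact, convex, with non-empty interior) of constant width $2$. The surface $\Im$ is smooth except at the four vertices: at every point of $\Im\setminus\{a,b,c,d\}$ the body $K$ has exactly one supporting plane, and near that point $\Im$ is a regular $C^1$ surface. Each of $a,b,c,d$ is a vertex singularity of $\Im$: a boundary point of $K$ at which the cone of outward normals of $K$ has non-empty interior. -/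

import Mathlib

noncomputable section

namespace Peabody

/-- Euclidean three-space. -/
abbrev E3 : Type := EuclideanSpace ℝ (Fin 3)

/-- The type of a pea pod frame together with its second circle: in the elliptic and hyperbolic
cases the centre of the secondary circle; in the parabolic case the second circle is the line
through the longitudinal beam, so there is no further datum. -/
inductive SecondCircle where
  | elliptic (c' : E3)
  | hyperbolic (c' : E3)
  | parabolic

/-- A (frame of a) pea pod whose longitudinal beam is the chord `ab`. The circles of the frame lie
in `plane`, have their centres on the line `axis`, which is perpendicular to the beam, and pass
through `a` and `b`. `center` is the centre of the principal circle. -/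
structure PeaPod (a b : E3) where
  plane : AffineSubspace ℝ E3
  axis : AffineSubspace ℝ E3
  center : E3
  second : SecondCircle
  finrank_plane : Module.finrank ℝ plane.direction = 2
  finrank_axis : Module.finrank ℝ axis.direction = 1
  axis_le_plane : axis ≤ plane
  ne : a ≠ b
  left_mem : a ∈ plane
  right_mem : b ∈ plane
  perp : ∀ v ∈ axis.direction, inner ℝ v (b - a) = 0
  center_mem : center ∈ axis
  dist_center : dist center a = dist center b
  second_spec : match second with
    | .elliptic c' =>
        c' ∈ axis ∧ dist c' a = dist c' b ∧
        -- `m` is not between the centres, and the principal centre is the one closer to `m`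
        ¬ Sbtw ℝ center (midpoint ℝ a b) c' ∧
        dist center (midpoint ℝ a b) < dist c' (midpoint ℝ a b)
    | .hyperbolic c' =>
        c' ∈ axis ∧ dist c' a = dist c' b ∧
        -- `m` is between the centres, and the principal circle is the smaller one
        Sbtw ℝ center (midpoint ℝ a b) c' ∧ dist center a < dist c' a
    | .parabolic => center ∉ line[ℝ, a, b]

namespace PeaPod

variable {a b c d : E3}

/-- Radius of the principal circle. -/
def radius (S : PeaPod a b) : ℝ := dist S.center a

/-- The disk of centre `x` and radius `ρ ≥ 0` in the plane of the frame is one of the disks of the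
pea pod.  In all cases it is inside the principal circle and (internally) tangent to it.
Elliptic: it is outside the secondary circle and tangent to it.
Hyperbolic: it is inside the secondary circle and tangent to it.
Parabolic: it is tangent to the line of the beam, on the side opposite to the principal centre. -/
def IsPea (S : PeaPod a b) (x : E3) (ρ : ℝ) : Prop :=
  x ∈ S.plane ∧ 0 ≤ ρ ∧ dist x S.center + ρ = S.radius ∧
    match S.second with
    | .elliptic c' => dist x c' = dist c' a + ρ
    | .hyperbolic c' => dist x c' + ρ = dist c' a
    | .parabolic => Metric.infDist x (line[ℝ, a, b] : Set E3) = ρ ∧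
        (line[ℝ, a, b]).WOppSide x S.center

/-- The arc `E(Σ)` of the centres of the peas. -/
def arc (S : PeaPod a b) : Set E3 := {x | ∃ ρ, S.IsPea x ρ}

/-- The radius `R(x)` of the pea with centre `x ∈ E(Σ)`; indeed `S.IsPea x ρ` forces
`ρ = S.peaRadius x`. -/
def peaRadius (S : PeaPod a b) (x : E3) : ℝ := S.radius - dist x S.center

/-- `x` is the centre of the bulb, the pea whose centre lies on the axis. -/
def IsBulbCenter (S : PeaPod a b) (x : E3) : Prop := x ∈ S.arc ∧ x ∈ S.axis

/-- Directrix of the parabolic pea string: the line parallel to the beam `ab`, at distance `radius`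
from it, on the side of it opposite to the principal centre. -/
def directrix (S : PeaPod a b) : AffineSubspace ℝ E3 :=
  AffineSubspace.mk'
    (midpoint ℝ a b +
      (S.radius / dist (midpoint ℝ a b) S.center) • (midpoint ℝ a b - S.center))
    (Submodule.span ℝ {b - a})

/-- The pea string: the full conic (ellipse, hyperbola with both branches, or parabola) that
contains the centres of the peas. -/
def string (S : PeaPod a b) : Set E3 :=
  {x | x ∈ S.plane ∧
    match S.second with
    | .elliptic c' => dist x S.center + dist x c' = S.radius + dist c' a
    | .hyperbolic c' => |dist x c' - dist x S.center| = dist c' a - S.radius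
    | .parabolic => dist x S.center = Metric.infDist x (S.directrix : Set E3)}

/-- The foci of the pea string. -/
def foci (S : PeaPod a b) : Set E3 :=
  match S.second with
  | .elliptic c' => {S.center, c'}
  | .hyperbolic c' => {S.center, c'}
  | .parabolic => {S.center}

/-- Confocal pea pods: same axis, orthogonal planes, and the foci of each pea string lie on the
other one. -/
structure Confocal (S : PeaPod a b) (S' : PeaPod c d) : Prop where
  axis_eq : S.axis = S'.axis
  ortho : S.plane.directionᗮ ⟂ S'.plane.directionᗮ
  foci_left : S.foci ⊆ S'.string
  foci_right : S'.foci ⊆ S.string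

/-- Convex confocal pea pods: moreover the principal centre of one of them is the centre of the
bulb of the other. -/
structure ConvexConfocal (S : PeaPod a b) (S' : PeaPod c d) : Prop extends Confocal S S' where
  bulb : S'.IsBulbCenter S.center ∨ S.IsBulbCenter S'.center

/-- The point on the line through `x` and `y` at distance `R(x)` from `x`, with `x` between it
and `y`. -/
def phi (S : PeaPod a b) (x y : E3) : E3 := x + (S.peaRadius x / dist x y) • (x - y)

/-- The wedge-pod surface of `S` with respect to the other device `S'`. -/
def wedge (S : PeaPod a b) (S' : PeaPod c d) : Set E3 :=
  {p | ∃ x ∈ S.arc, ∃ y ∈ S'.arc, p = S.phi x y}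

/-- The boundary curve of the wedge-pod surface of `S` obtained from the end `v` of the opposite
beam; it joins `a` to `b` on the sphere with centre `v`. -/
def edgeCurve (S : PeaPod a b) (v : E3) : Set E3 := {p | ∃ x ∈ S.arc, p = S.phi x v}

end PeaPod

/-- `abcd` is a regular tetrahedron of side `s`. -/
def IsRegularTetrahedron (s : ℝ) (a b c d : E3) : Prop :=
  dist a b = s ∧ dist a c = s ∧ dist a d = s ∧ dist b c = s ∧ dist b d = s ∧ dist c d = s

/-- The Reuleaux tetrahedron over the regular tetrahedron `abcd` of side `2`. -/
def reuleaux (a b c d : E3) : Set E3 :=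
  Metric.closedBall a 2 ∩ Metric.closedBall b 2 ∩ Metric.closedBall c 2 ∩ Metric.closedBall d 2

/-- The cap of the sphere `𝕊(v,2)` bounded by the curve `Γ` and contained in the boundary of `T`:
the curve, together with the component of its complement in the sphere that lies in the boundary
of `T`. -/
def cap (T : Set E3) (v : E3) (Γ : Set E3) : Set E3 :=
  Γ ∪ {x | x ∈ Metric.sphere v 2 \ Γ ∧
    connectedComponentIn (Metric.sphere v 2 \ Γ) x ⊆ frontier T}

/-- The surface obtained by gluing six wedge-pod surfaces and four spherical caps. -/
def surface {a b c d : E3} (AB : PeaPod a b) (CD : PeaPod c d) (AC : PeaPod a c)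
    (BD : PeaPod b d) (AD : PeaPod a d) (BC : PeaPod b c) : Set E3 :=
  (AB.wedge CD ∪ CD.wedge AB ∪ AC.wedge BD ∪ BD.wedge AC ∪ AD.wedge BC ∪ BC.wedge AD) ∪
  (cap (reuleaux a b c d) a (BC.edgeCurve a ∪ CD.edgeCurve a ∪ BD.edgeCurve a) ∪
   cap (reuleaux a b c d) b (CD.edgeCurve b ∪ AD.edgeCurve b ∪ AC.edgeCurve b) ∪
   cap (reuleaux a b c d) c (AB.edgeCurve c ∪ BD.edgeCurve c ∪ AD.edgeCurve c) ∪
   cap (reuleaux a b c d) d (AB.edgeCurve d ∪ BC.edgeCurve d ∪ AC.edgeCurve d))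

/-- Width of `K` in the direction of the unit vector `u`: the distance between the two supporting
planes of `K` orthogonal to `u`. -/
def width (K : Set E3) (u : E3) : ℝ :=
  sSup ((fun x => inner ℝ u x) '' K) - sInf ((fun x => inner ℝ u x) '' K)

/-- `K` has the same width `w` in every direction. -/
def HasConstantWidth (K : Set E3) (w : ℝ) : Prop := ∀ u : E3, ‖u‖ = 1 → width K u = w

/-- The cone of outward normal vectors of `K` at `p`. -/
def normalCone (K : Set E3) (p : E3) : Set E3 := {u | ∀ x ∈ K, inner ℝ u (x - p) ≤ 0}

/-- There is exactly one supporting plane of `K` at `p`, that is, one outward unit normal. -/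
def HasUniqueSupportPlane (K : Set E3) (p : E3) : Prop := ∃! u : E3, ‖u‖ = 1 ∧ u ∈ normalCone K p

/-- Near `p` the set `M` is a regular surface of class `C¹`. -/
def IsRegularSurfaceAt (M : Set E3) (p : E3) : Prop :=
  ∃ (U : Set E3) (f : E3 → ℝ), IsOpen U ∧ p ∈ U ∧ ContDiffOn ℝ 1 f U ∧
    (∀ x ∈ U, fderiv ℝ f x ≠ 0) ∧ M ∩ U = {x ∈ U | f x = 0}

/-- `p` is a vertex singularity of the boundary of `K`: a boundary point at which the normal cone is
three-dimensional. -/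
def IsVertexSingularity (K : Set E3) (p : E3) : Prop :=
  p ∈ frontier K ∧ (interior (normalCone K p)).Nonempty

end Peabody

end

/-!
`ℑ` is the boundary of the set `K` of the points whose distance to the centre of each pea, on any of
the six edges, is at most `2` minus the radius of the pea, that is, of the points at distance at
most `2` from all points of all peas.

In barycentric coordinates of the tetrahedron two confocal frames differ only by a parameter: on the
edge `ij` the peas have radii `k s` and centres
`(1 / 2 + ξ / 2 + s, 1 / 2 - ξ / 2 + s, -s, -s)` with `ξ² + 3 + 8 s + 8 s² = (2 - k s)²`, and convex
confocality means that the parameters of opposite edges satisfy `k k' = 8`. This product makes the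
distance of a pea centre on `ij` from a pea centre on `lm` equal to `2` minus the sum of the radii.
Hence each segment joining the far ends of two opposite peas is a chord of `K` of length `2` that is
normal to `K` at both ends. Every boundary point is an end of such a chord, possibly with degenerate
peas, which gives constant width `2` and identifies the boundary with `ℑ`. Away from the vertices
only one pea constraint is active, so the support plane is unique, and for a convex body uniqueness
of the support planes on an open part of the boundary makes the gauge `C¹` there.
-/

noncomputable section

namespace Peabody

open Metric Set Filter Topology Module
open scoped Pointwise RealInnerProductSpace

/-! ### Outward normals of convex sets -/

section OuterNormals

variable {E : Type*} [NormedAddCommGroup E] [InnerProductSpace ℝ E] {K L : Set E} {p q u : E}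

/-- The cone of outward normals of `K` at `p` in any inner product space; on `E3` it is
definitionally `normalCone`. -/
def outerNormals (K : Set E) (p : E) : Set E := {u | ∀ x ∈ K, ⟪u, x - p⟫ ≤ 0}

lemma inner_le_of_mem_outerNormals (h : u ∈ outerNormals K p) {x : E} (hx : x ∈ K) :
    ⟪u, x⟫ ≤ ⟪u, p⟫ := by
  simpa [inner_sub_right] using h x hx

lemma mem_outerNormals_iff : u ∈ outerNormals K p ↔ ∀ x ∈ K, ⟪u, x⟫ ≤ ⟪u, p⟫ := by
  simp [outerNormals, inner_sub_right]

lemma outerNormals_anti (h : K ⊆ L) : outerNormals L p ⊆ outerNormals K p :=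
  fun _ hu x hx => hu x (h hx)

lemma smul_mem_outerNormals {t : ℝ} (ht : 0 ≤ t) (hu : u ∈ outerNormals K p) :
    t • u ∈ outerNormals K p := fun x hx => by
  simpa only [real_inner_smul_left] using mul_nonpos_of_nonneg_of_nonpos ht (hu x hx)

lemma eventually_add_smul_mem (hp : K ∈ 𝓝 p) (w : E) : ∀ᶠ t : ℝ in 𝓝[>] 0, p + t • w ∈ K := by
  have hcont : Continuous fun t : ℝ => p + t • w := by fun_prop
  exact (((hcont.tendsto' 0 p (by simp)).mono_left nhdsWithin_le_nhds).eventually hp)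

lemma notMem_interior_of_mem_outerNormals (hu : u ≠ 0) (h : u ∈ outerNormals K p) :
    p ∉ interior K := by
  intro hp
  obtain ⟨t, htK, ht⟩ := ((eventually_add_smul_mem (mem_interior_iff_mem_nhds.1 hp) u).and
    self_mem_nhdsWithin).exists
  have htu : t * ‖u‖ ^ 2 ≤ 0 := by
    simpa [inner_smul_right, real_inner_self_eq_norm_sq] using h _ htK
  have : 0 < t * ‖u‖ ^ 2 := mul_pos ht (by positivity)
  linarith

lemma inner_sub_pos_of_mem_outerNormals (hu : u ≠ 0) (h : u ∈ outerNormals K p)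
    (hq : q ∈ interior K) : 0 < ⟪u, p - q⟫ := by
  have hle := inner_le_of_mem_outerNormals h (interior_subset hq)
  rw [inner_sub_right, sub_pos]
  refine hle.lt_of_ne fun heq => notMem_interior_of_mem_outerNormals hu (p := q) ?_ hq
  exact mem_outerNormals_iff.2 fun x hx => heq ▸ inner_le_of_mem_outerNormals h hx

lemma mem_outerNormals_sub_iff (hp : p ∈ K) (hq : q ∈ L) :
    u ∈ outerNormals (K - L) (p - q) ↔ u ∈ outerNormals K p ∧ -u ∈ outerNormals L q := by
  refine ⟨fun h => ⟨fun x hx => ?_, fun y hy => ?_⟩, fun ⟨hK, hL⟩ => ?_⟩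
  · simpa using h _ (sub_mem_sub hx hq)
  · simpa [inner_sub_right] using h _ (sub_mem_sub hp hy)
  · rintro _ ⟨x, hx, y, hy, rfl⟩
    have hx' := inner_le_of_mem_outerNormals hK hx
    have hy' := inner_le_of_mem_outerNormals hL hy
    simp only [inner_neg_left, inner_sub_right] at hx' hy' ⊢
    linarith

lemma exists_ne_zero_mem_outerNormals [CompleteSpace E] (hK : Convex ℝ K)
    (hne : (interior K).Nonempty) (hp : p ∉ interior K) : ∃ u ≠ 0, u ∈ outerNormals K p := by
  obtain ⟨f, hf0, hf⟩ := geometric_hahn_banach_of_nonempty_interior_point hK hp hne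
  obtain ⟨u, rfl⟩ := (InnerProductSpace.toDual ℝ E).surjective f
  exact ⟨u, by simpa using hf0, mem_outerNormals_iff.2 hf⟩

lemma self_mem_outerNormals_of_norm_le (h : ∀ x ∈ K, ‖x‖ ≤ ‖p‖) : p ∈ outerNormals K p :=
  mem_outerNormals_iff.2 fun x hx => by
    rw [real_inner_self_eq_norm_mul_norm]
    exact (real_inner_le_norm p x).trans
      (mul_le_mul_of_nonneg_left (h x hx) (norm_nonneg p))

lemma norm_smul_eq_of_mem_outerNormals_closedBall
    (hu : u ∈ outerNormals (closedBall (0 : E) ‖p‖) p) : ‖u‖ • p = ‖p‖ • u := by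
  rcases eq_or_ne u 0 with rfl | hu0
  · simp
  refine (inner_eq_norm_mul_iff_real.1 (le_antisymm (real_inner_le_norm u p) ?_)).symm
  have hmem : (‖p‖ / ‖u‖) • u ∈ closedBall (0 : E) ‖p‖ := by
    simp [norm_smul, div_mul_cancel₀ _ (norm_ne_zero_iff.2 hu0)]
  calc ‖u‖ * ‖p‖ = ⟪u, (‖p‖ / ‖u‖) • u⟫ := by
        rw [inner_smul_right, real_inner_self_eq_norm_sq]
        field_simp
    _ ≤ ⟪u, p⟫ := inner_le_of_mem_outerNormals hu hmem

end OuterNormals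

/-! ### Constant width from double normals -/

section ConstantWidth

variable {E : Type*} [NormedAddCommGroup E] [InnerProductSpace ℝ E] {K D : Set E} {w : ℝ}

lemma norm_le_of_radial_normals [Nontrivial E] (hD : IsCompact D) (h0 : D ∈ 𝓝 0)
    (hw : ∀ z ∈ D, z ≠ 0 → z ∈ outerNormals D z → ‖z‖ = w) {x : E} (hx : x ∈ D) : ‖x‖ ≤ w := by
  obtain ⟨z, hz, hmax⟩ := hD.exists_isMaxOn ⟨x, hx⟩ continuous_norm.continuousOn
  have hle : ∀ y ∈ D, ‖y‖ ≤ ‖z‖ := fun y hy => hmax hy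
  have hz0 : z ≠ 0 := by
    rintro rfl
    have hD0 : D ⊆ {0} := fun y hy => by simpa using hle y hy
    obtain ⟨e, he⟩ := exists_ne (0 : E)
    obtain ⟨t, htD, ht⟩ := ((eventually_add_smul_mem h0 e).and self_mem_nhdsWithin).exists
    exact smul_ne_zero (ne_of_gt ht) he (by simpa using hD0 htD)
  exact (hle x hx).trans (hw z hz hz0 (self_mem_outerNormals_of_norm_le hle)).le

lemma exists_closedBall_subset_norm_notMem_interior [FiniteDimensional ℝ E] (hD : IsClosed D)
    (h0 : D ∈ 𝓝 0) (hne : D ≠ univ) : ∃ z ∉ interior D, closedBall (0 : E) ‖z‖ ⊆ D := by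
  have hne' : Dᶜ.Nonempty := nonempty_compl.2 hne
  obtain ⟨z, hz, hdist⟩ := isClosed_closure.exists_infDist_eq_dist hne'.closure (0 : E)
  rw [infDist_closure, dist_zero_left] at hdist
  rw [closure_compl] at hz
  have hz0 : z ≠ 0 := fun h => hz (h ▸ mem_interior_iff_mem_nhds.2 h0)
  refine ⟨z, hz, ?_⟩
  rw [← closure_ball _ (norm_ne_zero_iff.2 hz0), ← hdist]
  exact closure_minimal ball_infDist_compl_subset hD

lemma closedBall_subset_of_radial_normals [FiniteDimensional ℝ E] (hD : IsClosed D)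
    (hconv : Convex ℝ D) (h0 : D ∈ 𝓝 0) (hne : D ≠ univ)
    (hw : ∀ z ∈ D, z ≠ 0 → z ∈ outerNormals D z → ‖z‖ = w) : closedBall 0 w ⊆ D := by
  obtain ⟨z, hz, hsub⟩ := exists_closedBall_subset_norm_notMem_interior hD h0 hne
  have h0' : (0 : E) ∈ interior D := mem_interior_iff_mem_nhds.2 h0
  have hz0 : z ≠ 0 := fun h => hz (h ▸ h0')
  obtain ⟨u, hu0, hu⟩ := exists_ne_zero_mem_outerNormals hconv ⟨0, h0'⟩ hz
  have hpar := norm_smul_eq_of_mem_outerNormals_closedBall (outerNormals_anti hsub hu)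
  have hzu : z = (‖z‖ / ‖u‖) • u := by
    rw [div_eq_inv_mul, mul_smul, ← hpar, inv_smul_smul₀ (norm_ne_zero_iff.2 hu0)]
  have hzN : z ∈ outerNormals D z := by
    have := smul_mem_outerNormals (t := ‖z‖ / ‖u‖) (by positivity) hu
    rwa [← hzu] at this
  exact hw z (hsub (by simp)) hz0 hzN ▸ hsub

-- The longest vector and the shortest boundary vector of `K - K` are double normals of `K`.
theorem sub_self_eq_closedBall_of_doubleNormals [FiniteDimensional ℝ E] [Nontrivial E]
    (hK : IsCompact K) (hconv : Convex ℝ K) (hne : (interior K).Nonempty)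
    (hw : ∀ p ∈ K, ∀ q ∈ K, p ≠ q → p - q ∈ outerNormals K p → q - p ∈ outerNormals K q →
      dist p q = w) : K - K = closedBall 0 w := by
  have hD : IsCompact (K - K) := sub_eq_add_neg K K ▸ hK.add hK.neg
  have h0 : K - K ∈ 𝓝 0 := by
    obtain ⟨o, ho⟩ := hne
    have : interior K - {o} ∈ 𝓝 (0 : E) :=
      (isOpen_interior.sub_right).mem_nhds ⟨o, ho, o, rfl, sub_self o⟩
    exact mem_of_superset this
      (sub_subset_sub interior_subset (singleton_subset_iff.2 (interior_subset ho)))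
  have hnormal : ∀ z ∈ K - K, z ≠ 0 → z ∈ outerNormals (K - K) z → ‖z‖ = w := by
    rintro _ ⟨p, hp, q, hq, rfl⟩ hz hN
    obtain ⟨hNp, hNq⟩ := (mem_outerNormals_sub_iff hp hq).1 hN
    rw [neg_sub] at hNq
    exact dist_eq_norm p q ▸ hw p hp q hq (sub_ne_zero.1 hz) hNp hNq
  refine Subset.antisymm (fun z hz => ?_) ?_
  · simpa using norm_le_of_radial_normals hD h0 hnormal hz
  · exact closedBall_subset_of_radial_normals hD.isClosed (hconv.sub hconv) h0 hD.ne_univ hnormal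

lemma hasConstantWidth_of_sub_self_eq_closedBall {K : Set E3} (hw : 0 ≤ w)
    (hK : K - K = closedBall 0 w) : HasConstantWidth K w := by
  intro u hu
  obtain ⟨p, hp, q, hq, hpq⟩ : w • u ∈ K - K := by
    simp [hK, norm_smul, hu, abs_of_nonneg hw]
  have hval : ⟪u, p⟫ - ⟪u, q⟫ = w := by
    rw [← inner_sub_right, show p - q = w • u from hpq, inner_smul_right,
      real_inner_self_eq_norm_sq, hu, one_pow, mul_one]
  have hle : ∀ x ∈ K, ∀ y ∈ K, ⟪u, x⟫ - ⟪u, y⟫ ≤ w := fun x hx y hy => by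
    have hxy : ‖x - y‖ ≤ w := by simpa using hK.subset (sub_mem_sub hx hy)
    rw [← inner_sub_right]
    exact (real_inner_le_norm _ _).trans (by rwa [hu, one_mul])
  have hmax : IsGreatest ((⟪u, ·⟫) '' K) ⟪u, p⟫ :=
    ⟨mem_image_of_mem _ hp, forall_mem_image.2 fun x hx => by linarith [hle x hx q hq]⟩
  have hmin : IsLeast ((⟪u, ·⟫) '' K) ⟪u, q⟫ :=
    ⟨mem_image_of_mem _ hq, forall_mem_image.2 fun x hx => by linarith [hle p hp x hx]⟩
  rw [width, hmax.csSup_eq, hmin.csInf_eq, hval]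

end ConstantWidth

/-! ### Differentiability of gauges -/

section Subgradients

variable {E : Type*} [NormedAddCommGroup E] [InnerProductSpace ℝ E] {f : E → ℝ} {K : Set E}
  {x p u v : E}

/-- The subdifferential of `f` at `x`. -/
def subgradients (f : E → ℝ) (x : E) : Set E := {v | ∀ y, f x + ⟪v, y - x⟫ ≤ f y}

lemma hasFDerivAt_of_continuousAt_subgradient {ν : E → E}
    (hν : ∀ᶠ y in 𝓝 x, ν y ∈ subgradients f y) (hcont : ContinuousAt ν x) :
    HasFDerivAt f (innerSL ℝ (ν x)) x := by
  rw [hasFDerivAt_iff_isLittleO, Asymptotics.isLittleO_iff]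
  intro ε hε
  filter_upwards [hν, hcont.eventually (ball_mem_nhds (ν x) hε)] with y hy hdist
  have hlower := hν.self_of_nhds y
  have hupper := hy x
  have hdiff : ⟪ν y - ν x, y - x⟫ ≤ ε * ‖y - x‖ :=
    (real_inner_le_norm _ _).trans
      (mul_le_mul_of_nonneg_right (mem_ball_iff_norm.1 hdist).le (norm_nonneg _))
  have hswap : ⟪ν y, x - y⟫ = -⟪ν y, y - x⟫ := by rw [← inner_neg_right, neg_sub]
  have hpos : 0 ≤ ε * ‖y - x‖ := by positivity
  rw [inner_sub_left] at hdiff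
  rw [innerSL_apply_apply, Real.norm_eq_abs, abs_le]
  constructor <;> linarith

lemma norm_le_of_mem_subgradients {C : NNReal} (hf : LipschitzWith C f)
    (hv : v ∈ subgradients f x) : ‖v‖ ≤ C := by
  have hsub : f x + ‖v‖ ^ 2 ≤ f (x + v) := by
    simpa [real_inner_self_eq_norm_sq] using hv (x + v)
  have hlip : f (x + v) - f x ≤ C * ‖v‖ := by
    simpa [Real.dist_eq] using (le_abs_self _).trans (hf.dist_le_mul (x + v) x)
  by_contra! h
  nlinarith [C.2]

lemma continuousAt_of_subgradients_eq_singleton [FiniteDimensional ℝ E] {C : NNReal} {ν : E → E}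
    (hf : LipschitzWith C f) (hν : ∀ᶠ y in 𝓝 x, ν y ∈ subgradients f y)
    (huniq : subgradients f x ⊆ {ν x}) : ContinuousAt ν x := by
  refine (isCompact_closedBall (0 : E) C).tendsto_nhds_of_unique_mapClusterPt ?_ ?_
  · filter_upwards [hν] with y hy
    simpa using norm_le_of_mem_subgradients hf hy
  · intro v _ hcluster
    obtain ⟨F, hF, hlim⟩ := mapClusterPt_iff_ultrafilter.1 hcluster
    refine huniq fun z => ?_
    have hlim' : Tendsto (fun y => f y + ⟪ν y, z - y⟫) F (𝓝 (f x + ⟪v, z - x⟫)) :=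
      ((hf.continuous.tendsto x).mono_left hF).add
        (hlim.inner (tendsto_const_nhds.sub (tendsto_id.mono_left hF)))
    exact le_of_tendsto hlim' ((hν.filter_mono hF).mono fun y hy => hy z)

theorem contDiffOn_one_of_unique_subgradient [FiniteDimensional ℝ E] {C : NNReal} {U : Set E}
    (hU : IsOpen U) (hf : LipschitzWith C f) (huniq : ∀ x ∈ U, ∃! v, v ∈ subgradients f x) :
    ContDiffOn ℝ 1 f U ∧ ∀ x ∈ U, ∃ v ∈ subgradients f x, HasFDerivAt f (innerSL ℝ v) x := by
  choose! ν hν hνu using huniq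
  have hev : ∀ x ∈ U, ∀ᶠ y in 𝓝 x, ν y ∈ subgradients f y := fun x hx =>
    (hU.eventually_mem hx).mono hν
  have hcont : ∀ x ∈ U, ContinuousAt ν x := fun x hx =>
    continuousAt_of_subgradients_eq_singleton hf (hev x hx) fun v hv => hνu x hx v hv
  have hderiv : ∀ x ∈ U, HasFDerivAt f (innerSL ℝ (ν x)) x := fun x hx =>
    hasFDerivAt_of_continuousAt_subgradient (hev x hx) (hcont x hx)
  refine ⟨?_, fun x hx => ⟨ν x, hν x hx, hderiv x hx⟩⟩
  rw [show (1 : WithTop ℕ∞) = 0 + 1 from (zero_add 1).symm,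
    contDiffOn_succ_iff_fderiv_of_isOpen hU, contDiffOn_zero]
  refine ⟨fun x hx => (hderiv x hx).differentiableAt.differentiableWithinAt, by simp, ?_⟩
  refine ContinuousOn.congr (f := fun x => innerSL ℝ (ν x)) (fun x hx => ?_)
    fun x hx => (hderiv x hx).fderiv
  exact ((innerSL ℝ).continuous.continuousAt.comp (hcont x hx)).continuousWithinAt

lemma inner_le_gauge (hK : Absorbent ℝ K) (hv : ∀ z ∈ K, ⟪v, z⟫ ≤ 1) (y : E) :
    ⟪v, y⟫ ≤ gauge K y := by
  refine le_of_forall_gt_imp_ge_of_dense fun a ha => ?_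
  obtain ⟨b, hb0, hba, z, hz, rfl⟩ := exists_lt_of_gauge_lt hK ha
  calc ⟪v, b • z⟫ = b * ⟪v, z⟫ := inner_smul_right _ _ _
    _ ≤ b := mul_le_of_le_one_right hb0.le (hv z hz)
    _ ≤ a := hba.le

lemma inner_eq_gauge_of_mem_subgradients (hv : v ∈ subgradients (gauge K) x) :
    ⟪v, x⟫ = gauge K x := by
  have h0 := hv 0
  have h2 := hv ((2 : ℝ) • x)
  rw [gauge_smul_of_nonneg zero_le_two, smul_eq_mul, two_smul, add_sub_cancel_right] at h2
  rw [gauge_zero, zero_sub, inner_neg_right] at h0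
  linarith

lemma mem_subgradients_gauge_smul_iff (hK : Absorbent ℝ K) (hp : gauge K p = 1) {t : ℝ}
    (ht : 0 < t) :
    v ∈ subgradients (gauge K) (t • p) ↔ v ∈ outerNormals K p ∧ ⟪v, p⟫ = 1 := by
  have hgauge : gauge K (t • p) = t := by
    rw [gauge_smul_of_nonneg ht.le, hp, smul_eq_mul, mul_one]
  constructor
  · intro hv
    have htp := inner_eq_gauge_of_mem_subgradients hv
    have hvp : ⟪v, p⟫ = 1 := by
      rw [hgauge, inner_smul_right] at htp
      exact mul_left_cancel₀ ht.ne' (htp.trans (mul_one t).symm)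
    refine ⟨mem_outerNormals_iff.2 fun z hz => ?_, hvp⟩
    have hz' := hv z
    rw [inner_sub_right, htp] at hz'
    linarith [gauge_le_one_of_mem hz]
  · rintro ⟨hN, hvp⟩ y
    have hvtp : ⟪v, t • p⟫ = t := by rw [inner_smul_right, hvp, mul_one]
    have := inner_le_gauge hK (fun z hz => hvp ▸ inner_le_of_mem_outerNormals hN hz) y
    rw [hgauge, inner_sub_right, hvtp]
    linarith

lemma existsUnique_outerNormal_inner_eq_one (h0 : 0 ∈ interior K)
    (h : ∃! u, ‖u‖ = 1 ∧ u ∈ outerNormals K p) : ∃! v, v ∈ outerNormals K p ∧ ⟪v, p⟫ = 1 := by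
  obtain ⟨u, ⟨hu1, huN⟩, huniq⟩ := h
  have hup : 0 < ⟪u, p⟫ := by
    simpa using inner_sub_pos_of_mem_outerNormals (norm_ne_zero_iff.1 (by simp [hu1])) huN h0
  refine ⟨⟪u, p⟫⁻¹ • u, ⟨smul_mem_outerNormals (inv_nonneg.2 hup.le) huN, ?_⟩, ?_⟩
  · rw [real_inner_smul_left, inv_mul_cancel₀ hup.ne']
  rintro v ⟨hvN, hvp⟩
  have hv0 : ‖v‖ ≠ 0 := by
    rintro h
    simp [norm_eq_zero.1 h] at hvp
  have hvu : ‖v‖⁻¹ • v = u := huniq _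
    ⟨by simp [norm_smul, hv0], smul_mem_outerNormals (inv_nonneg.2 (norm_nonneg v)) hvN⟩
  rw [← hvu, real_inner_smul_left, hvp, mul_one, inv_inv, smul_inv_smul₀ hv0]

theorem contDiffOn_gauge_of_unique_normals [FiniteDimensional ℝ E] (hK : Convex ℝ K)
    (h0 : K ∈ 𝓝 0) {U : Set E} (hU : IsOpen U) (hpos : ∀ x ∈ U, 0 < gauge K x)
    (huniq : ∀ x ∈ U, ∃! u, ‖u‖ = 1 ∧ u ∈ outerNormals K ((gauge K x)⁻¹ • x)) :
    ContDiffOn ℝ 1 (gauge K) U ∧ ∀ x ∈ U, fderiv ℝ (gauge K) x ≠ 0 := by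
  obtain ⟨C, hC⟩ := hK.lipschitz_gauge h0
  have hsub : ∀ x ∈ U, ∃! v, v ∈ subgradients (gauge K) x := fun x hx => by
    have hg := hpos x hx
    have hgp : gauge K ((gauge K x)⁻¹ • x) = 1 := by
      rw [gauge_smul_of_nonneg (inv_nonneg.2 hg.le), smul_eq_mul, inv_mul_cancel₀ hg.ne']
    have hiff := fun v =>
      mem_subgradients_gauge_smul_iff (v := v) (absorbent_nhds_zero h0) hgp hg
    simp only [smul_inv_smul₀ hg.ne'] at hiff
    simpa only [hiff] using
      existsUnique_outerNormal_inner_eq_one (mem_interior_iff_mem_nhds.2 h0) (huniq x hx)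
  obtain ⟨hdiff, hderiv⟩ := contDiffOn_one_of_unique_subgradient hU hC hsub
  refine ⟨hdiff, fun x hx hzero => ?_⟩
  obtain ⟨v, hv, hvd⟩ := hderiv x hx
  have hvx := inner_eq_gauge_of_mem_subgradients hv
  rw [← innerSL_apply_apply (𝕜 := ℝ), ← hvd.fderiv, hzero, zero_apply] at hvx
  exact (hpos x hx).ne hvx

lemma mem_outerNormals_add_left_preimage_iff (o : E) :
    u ∈ outerNormals ((o + ·) ⁻¹' K) p ↔ u ∈ outerNormals K (o + p) := by
  refine ⟨fun h x hx => ?_, fun h x hx => ?_⟩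
  · simpa [sub_sub] using h (x - o) (by simpa using hx)
  · simpa using h _ hx

theorem isRegularSurfaceAt_frontier {K V : Set E3} (hK : IsCompact K) (hconv : Convex ℝ K)
    (hne : (interior K).Nonempty) (hV : IsClosed V)
    (huniq : ∀ p ∈ frontier K, p ∉ V → HasUniqueSupportPlane K p) {p : E3}
    (hp : p ∈ frontier K) (hpV : p ∉ V) : IsRegularSurfaceAt (frontier K) p := by
  obtain ⟨o, ho⟩ := hne
  let τ : E3 ≃ₜ E3 := Homeomorph.addLeft o
  let K₀ : Set E3 := τ ⁻¹' K
  have hK₀ : Convex ℝ K₀ := hconv.translate_preimage_right o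
  have h0 : K₀ ∈ 𝓝 0 := τ.continuous.continuousAt.preimage_mem_nhds
    (by simpa [τ] using mem_interior_iff_mem_nhds.1 ho)
  have hbdd : Bornology.IsVonNBounded ℝ K₀ := (τ.isCompact_preimage.2 hK).isVonNBounded ℝ
  have hfrontier : ∀ x, gauge K₀ x = 1 ↔ o + x ∈ frontier K := fun x => by
    rw [gauge_eq_one_iff_mem_frontier hK₀ h0, ← τ.preimage_frontier]
    rfl
  have hpos : ∀ {x}, x ≠ 0 → 0 < gauge K₀ x := fun hx =>
    (gauge_pos (absorbent_nhds_zero h0) hbdd).2 hx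
  let ρ : E3 → E3 := fun x => (gauge K₀ x)⁻¹ • x
  have hρ : ContinuousOn ρ {0}ᶜ :=
    ((continuous_gauge hK₀ h0).continuousOn.inv₀ fun x hx => (hpos hx).ne').smul continuousOn_id
  let U : Set E3 := {0}ᶜ ∩ ρ ⁻¹' (τ ⁻¹' V)ᶜ
  have hU : IsOpen U := hρ.isOpen_inter_preimage isOpen_compl_singleton
    (hV.preimage τ.continuous).isOpen_compl
  have hρ_frontier : ∀ x ∈ U, o + ρ x ∈ frontier K := fun x hx => by
    rw [← hfrontier, gauge_smul_of_nonneg (inv_nonneg.2 (hpos hx.1).le), smul_eq_mul,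
      inv_mul_cancel₀ (hpos hx.1).ne']
  obtain ⟨hdiff, hderiv⟩ := contDiffOn_gauge_of_unique_normals hK₀ h0 hU (fun x hx => hpos hx.1)
    fun x hx => by
      have hnormals : outerNormals K₀ (ρ x) = normalCone K (o + ρ x) :=
        Set.ext fun _ => mem_outerNormals_add_left_preimage_iff o
      exact hnormals ▸ huniq _ (hρ_frontier x hx) hx.2
  refine ⟨(· - o) ⁻¹' U, fun x => gauge K₀ (x - o) - 1, hU.preimage (by fun_prop), ⟨?_, ?_⟩,
    ?_, fun x hx => ?_, ?_⟩
  · rw [mem_compl_singleton_iff, sub_ne_zero]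
    exact fun h => hp.2 (h ▸ ho)
  · have hgp : gauge K₀ (p - o) = 1 := (hfrontier _).2 (by simpa using hp)
    simpa [ρ, τ, hgp] using hpV
  · exact (hdiff.comp (contDiffOn_id.sub contDiffOn_const) fun x hx => hx).sub contDiffOn_const
  · rw [fderiv_sub_const, fderiv_comp_sub]
    exact hderiv _ hx
  · ext x
    simp [sub_eq_zero, hfrontier, and_comm]

end Subgradients

/-! ### Intersections of balls -/

section BallIntersection

/-- The intersection of the balls with centre `c.1` and radius `R - c.2`, for `c ∈ C`: the points
at distance at most `R` from all points of all the balls with centre `c.1` and radius `c.2`. -/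
def ballIntersection {X : Type*} [PseudoMetricSpace X] (C : Set (X × ℝ)) (R : ℝ) : Set X :=
  {z | ∀ c ∈ C, dist z c.1 + c.2 ≤ R}

section Metric

variable {X : Type*} [PseudoMetricSpace X] {C : Set (X × ℝ)} {R : ℝ} {p : X}

lemma mem_ballIntersection : p ∈ ballIntersection C R ↔ ∀ c ∈ C, dist p c.1 + c.2 ≤ R := Iff.rfl

lemma ballIntersection_eq_biInter (C : Set (X × ℝ)) (R : ℝ) :
    ballIntersection C R = ⋂ c ∈ C, closedBall c.1 (R - c.2) := by
  ext z
  simp [ballIntersection, le_sub_iff_add_le]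

lemma isClosed_ballIntersection (C : Set (X × ℝ)) (R : ℝ) : IsClosed (ballIntersection C R) := by
  rw [ballIntersection_eq_biInter]
  exact isClosed_biInter fun _ _ => isClosed_closedBall

lemma mem_interior_ballIntersection (hC : IsCompact C) (h : ∀ c ∈ C, dist p c.1 + c.2 < R) :
    p ∈ interior (ballIntersection C R) := by
  rw [mem_interior_iff_mem_nhds]
  refine hC.eventually_forall_of_forall_eventually (P := fun z c => dist z c.1 + c.2 ≤ R)
    fun c hc => ?_
  have hcont : Continuous fun z : X × (X × ℝ) => dist z.1 z.2.1 + z.2.2 := by fun_prop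
  exact (hcont.tendsto (p, c)).eventually_le_const (h c hc)

end Metric

variable {E : Type*} [NormedAddCommGroup E] [InnerProductSpace ℝ E] {C : Set (E × ℝ)} {R : ℝ}
  {p u : E} {c : E × ℝ}

lemma convex_ballIntersection (C : Set (E × ℝ)) (R : ℝ) : Convex ℝ (ballIntersection C R) := by
  rw [ballIntersection_eq_biInter]
  exact convex_iInter₂ fun _ _ => convex_closedBall _ _

lemma sub_mem_outerNormals_ballIntersection (hc : c ∈ C) (h : dist p c.1 + c.2 = R) :
    p - c.1 ∈ outerNormals (ballIntersection C R) p := by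
  intro z hz
  have hle : ‖z - c.1‖ ≤ ‖p - c.1‖ := by
    rw [← dist_eq_norm, ← dist_eq_norm]
    linarith [hz c hc]
  calc ⟪p - c.1, z - p⟫ = ⟪p - c.1, z - c.1⟫ - ‖p - c.1‖ ^ 2 := by
        rw [← sub_sub_sub_cancel_right z p c.1, inner_sub_right, real_inner_self_eq_norm_sq]
    _ ≤ ‖p - c.1‖ * ‖z - c.1‖ - ‖p - c.1‖ ^ 2 := by gcongr; exact real_inner_le_norm _ _
    _ ≤ 0 := by nlinarith [norm_nonneg (p - c.1)]

lemma dist_add_smul_le_of_inner_nonpos {p c w : E} {t : ℝ} (ht : 0 ≤ t)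
    (h : ⟪p + t • w - c, w⟫ ≤ 0) : dist (p + t • w) c ≤ dist p c := by
  have hp : p - c = (p + t • w - c) - t • w := by abel
  have hsq := norm_sub_sq_real (p + t • w - c) (t • w)
  rw [← hp, inner_smul_right] at hsq
  rw [dist_eq_norm, dist_eq_norm, ← sq_le_sq₀ (norm_nonneg _) (norm_nonneg _), hsq]
  nlinarith [mul_nonpos_of_nonneg_of_nonpos ht h, sq_nonneg ‖t • w‖]

lemma eventually_add_smul_mem_ballIntersection (hC : IsCompact C)
    (hp : p ∈ ballIntersection C R) {w : E}
    (hw : ∀ c ∈ C, dist p c.1 + c.2 = R → ⟪p - c.1, w⟫ < 0) :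
    ∀ᶠ t : ℝ in 𝓝[>] 0, p + t • w ∈ ballIntersection C R := by
  have key : ∀ᶠ t : ℝ in 𝓝 0, ∀ c ∈ C, 0 < t → c ∈ C → dist (p + t • w) c.1 + c.2 ≤ R := by
    refine hC.eventually_forall_of_forall_eventually
      (P := fun t c => 0 < t → c ∈ C → dist (p + t • w) c.1 + c.2 ≤ R) fun c hc => ?_
    rcases (hp c hc).lt_or_eq with hlt | heq
    · have hcont : Continuous fun z : ℝ × (E × ℝ) => dist (p + z.1 • w) z.2.1 + z.2.2 := by
        fun_prop
      exact ((hcont.tendsto' (0, c) _ rfl).eventually_le_const (by simpa using hlt)).mono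
        fun z hz _ _ => hz
    · have hcont : Continuous fun z : ℝ × (E × ℝ) => ⟪p + z.1 • w - z.2.1, w⟫ := by fun_prop
      refine ((hcont.tendsto' (0, c) _ rfl).eventually_le_const
        (by simpa using hw c hc heq)).mono fun z hz ht hzC => ?_
      linarith [dist_add_smul_le_of_inner_nonpos ht.le hz, hp _ hzC]
  filter_upwards [nhdsWithin_le_nhds key, self_mem_nhdsWithin] with t ht ht0 c hc
  exact ht c hc ht0 hc

lemma eq_normalize_of_mem_outerNormals_ballIntersection (hC : IsCompact C)
    (hp : p ∈ ballIntersection C R) (hpc : p ≠ c.1)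
    (huniq : ∀ c' ∈ C, dist p c'.1 + c'.2 = R → c' = c) (hu : ‖u‖ = 1)
    (hN : u ∈ outerNormals (ballIntersection C R) p) : u = (dist p c.1)⁻¹ • (p - c.1) := by
  have hd : 0 < dist p c.1 := dist_pos.2 hpc
  set n : E := (dist p c.1)⁻¹ • (p - c.1) with hn
  have hn1 : ‖n‖ = 1 := by
    rw [hn, norm_smul, norm_inv, ← dist_eq_norm, Real.norm_of_nonneg hd.le,
      inv_mul_cancel₀ hd.ne']
  by_contra hne
  have hlt : ⟪u, n⟫ < 1 := (inner_lt_one_iff_real_of_norm_eq_one hu hn1).2 hne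
  have hnw : ⟪p - c.1, u - n⟫ < 0 := by
    rw [← smul_inv_smul₀ hd.ne' (p - c.1), ← hn, real_inner_smul_left, inner_sub_right,
      real_inner_self_eq_norm_sq, hn1, real_inner_comm]
    nlinarith
  obtain ⟨t, hmem, ht⟩ := ((eventually_add_smul_mem_ballIntersection hC hp
    fun c' hc' hact => huniq c' hc' hact ▸ hnw).and self_mem_nhdsWithin).exists
  have hle := hN _ hmem
  rw [add_sub_cancel_left, inner_smul_right, inner_sub_right, real_inner_self_eq_norm_sq, hu]
    at hle
  have : (0 : ℝ) < t := ht
  nlinarith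

end BallIntersection

/-! ### Barycentric coordinates of a regular simplex -/

section RegularSimplex

variable {E ι : Type*} [NormedAddCommGroup E] [InnerProductSpace ℝ E]

/-- The points `v i` are the vertices of a regular simplex; its side is normalized to `2`. -/
def RegularSimplex (v : ι → E) : Prop := Pairwise fun i j => dist (v i) (v j) = 2

variable [Fintype ι]

/-- The centroid of the points `v i`, the common centre of the spheres attached to a regular
simplex. -/
def vertexCentroid (v : ι → E) : E := (Fintype.card ι : ℝ)⁻¹ • ∑ i, v i

/-- The `i`-th barycentric coordinate with respect to a regular simplex of side `2`. The formula
makes sense for arbitrary points `v i`, but has that meaning only for such simplices. -/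
def bary (v : ι → E) (i : ι) (z : E) : ℝ :=
  (Fintype.card ι : ℝ)⁻¹ + ⟪z - vertexCentroid v, v i - vertexCentroid v⟫ / 2

@[fun_prop]
lemma continuous_bary (v : ι → E) (i : ι) : Continuous (bary v i) := by
  unfold bary; fun_prop

lemma sum_sub_vertexCentroid [Nonempty ι] (v : ι → E) : ∑ i, (v i - vertexCentroid v) = 0 := by
  rw [Finset.sum_sub_distrib, Finset.sum_const, Finset.card_univ, vertexCentroid,
    ← Nat.cast_smul_eq_nsmul ℝ, smul_inv_smul₀ (Nat.cast_ne_zero.2 Fintype.card_ne_zero), sub_self]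

variable {v : ι → E}

lemma bary_sub (i : ι) (z w : E) :
    bary v i z - bary v i w = ⟪z - w, v i - vertexCentroid v⟫ / 2 := by
  simp only [bary, inner_sub_left]; ring

lemma bary_add_smul_sub (i : ι) (z x y : E) (t : ℝ) :
    bary v i (z + t • (x - y)) = bary v i z + t * (bary v i x - bary v i y) := by
  have h := bary_sub (v := v) i (z + t • (x - y)) z
  rw [add_sub_cancel_left, real_inner_smul_left] at h
  rw [bary_sub]
  linarith

lemma sum_bary [Nonempty ι] (v : ι → E) (z : E) : ∑ i, bary v i z = 1 := by
  simp only [bary, Finset.sum_add_distrib, ← Finset.sum_div, ← inner_sum, sum_sub_vertexCentroid,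
    inner_zero_right, zero_div, add_zero, Finset.sum_const, Finset.card_univ, nsmul_eq_mul]
  exact mul_inv_cancel₀ (Nat.cast_ne_zero.2 Fintype.card_ne_zero)

namespace RegularSimplex

variable [Nonempty ι]

lemma inner_sub_vertexCentroid [DecidableEq ι] (hv : RegularSimplex v) (i j : ι) :
    ⟪v i - vertexCentroid v, v j - vertexCentroid v⟫
      = 2 * ((if i = j then 1 else 0) - (Fintype.card ι : ℝ)⁻¹) := by
  set w : ι → E := fun i => v i - vertexCentroid v
  set n : ℝ := (Fintype.card ι : ℝ)
  have hn : n ≠ 0 := Nat.cast_ne_zero.2 Fintype.card_ne_zero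
  have hsum : ∑ j, w j = 0 := sum_sub_vertexCentroid v
  have hpair (i j) : ‖w i‖ ^ 2 + ‖w j‖ ^ 2 - 2 * ⟪w i, w j⟫ = 4 * (1 - if i = j then 1 else 0) := by
    have h := norm_sub_sq_real (w i) (w j)
    rw [show w i - w j = v i - v j from sub_sub_sub_cancel_right .., ← dist_eq_norm] at h
    rcases eq_or_ne i j with rfl | hij
    · rw [dist_self] at h
      rw [if_pos rfl]
      linarith
    · rw [hv hij] at h
      rw [if_neg hij]
      linarith
  have hrow (i) : n * ‖w i‖ ^ 2 + ∑ j, ‖w j‖ ^ 2 = 4 * (n - 1) := by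
    have h : ∑ j, (‖w i‖ ^ 2 + ‖w j‖ ^ 2 - 2 * ⟪w i, w j⟫)
        = ∑ j, 4 * (1 - if i = j then (1 : ℝ) else 0) :=
      Finset.sum_congr rfl fun j _ => hpair i j
    simpa only [Finset.sum_sub_distrib, Finset.sum_add_distrib, ← Finset.mul_sum, ← inner_sum,
      hsum, inner_zero_right, mul_zero, sub_zero, Finset.sum_const, Finset.card_univ,
      nsmul_eq_mul, mul_one, Finset.sum_ite_eq, Finset.mem_univ, if_true] using h
  have htotal : ∑ j, ‖w j‖ ^ 2 = 2 * (n - 1) := by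
    have h : ∑ i, (n * ‖w i‖ ^ 2 + ∑ j, ‖w j‖ ^ 2) = ∑ _i : ι, 4 * (n - 1) :=
      Finset.sum_congr rfl fun i _ => hrow i
    simp only [Finset.sum_add_distrib, ← Finset.mul_sum, Finset.sum_const, Finset.card_univ,
      nsmul_eq_mul] at h
    apply mul_left_cancel₀ hn
    linarith
  have hnorm (i) : ‖w i‖ ^ 2 = 2 * (1 - n⁻¹) := by
    have h := hrow i
    field_simp
    linarith
  have h := hpair i j
  rw [hnorm, hnorm] at h
  change ⟪w i, w j⟫ = _
  linarith

lemma bary_sum_smul (hv : RegularSimplex v) {β : ι → ℝ} (hβ : ∑ i, β i = 1)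
    (i : ι) : bary v i (∑ j, β j • v j) = β i := by
  classical
  have hz : ∑ j, β j • v j - vertexCentroid v = ∑ j, β j • (v j - vertexCentroid v) := by
    simp only [smul_sub, Finset.sum_sub_distrib, ← Finset.sum_smul, hβ, one_smul]
  simp only [bary, hz, sum_inner, real_inner_smul_left, hv.inner_sub_vertexCentroid,
    mul_left_comm _ (2 : ℝ), ← Finset.mul_sum, mul_sub, Finset.sum_sub_distrib, ← Finset.sum_mul,
    hβ, mul_ite, mul_one, mul_zero, Finset.sum_ite_eq', Finset.mem_univ, if_true]
  ring

lemma bary_vertex [DecidableEq ι] (hv : RegularSimplex v) (i j : ι) :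
    bary v i (v j) = if i = j then 1 else 0 := by
  rw [bary, real_inner_comm, hv.inner_sub_vertexCentroid]
  ring

omit [Fintype ι] in
lemma affineIndependent [Finite ι] (hv : RegularSimplex v) : AffineIndependent ℝ v := by
  classical
  have := Fintype.ofFinite ι
  rw [affineIndependent_iff_of_fintype]
  intro c hc hcv j
  have h : ∑ i, c i • (v i - vertexCentroid v) = 0 := by
    rw [Finset.weightedVSub_eq_linear_combination _ hc] at hcv
    simp only [smul_sub, Finset.sum_sub_distrib, hcv, ← Finset.sum_smul, hc, zero_smul, sub_zero]
  have h' := congrArg (fun z => ⟪z, v j - vertexCentroid v⟫) h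
  simp only [sum_inner, real_inner_smul_left, hv.inner_sub_vertexCentroid,
    mul_left_comm _ (2 : ℝ), ← Finset.mul_sum, mul_sub, Finset.sum_sub_distrib, ← Finset.sum_mul,
    hc, mul_ite, mul_one, mul_zero, Finset.sum_ite_eq', Finset.mem_univ, if_true, inner_zero_left]
    at h'
  linarith

lemma span_sub_vertexCentroid [FiniteDimensional ℝ E] (hv : RegularSimplex v)
    (hcard : Fintype.card ι = finrank ℝ E + 1) :
    Submodule.span ℝ (range fun i => v i - vertexCentroid v) = ⊤ := by
  rw [eq_top_iff, ← hv.affineIndependent.vectorSpan_eq_top_of_card_eq_finrank_add_one hcard,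
    vectorSpan_def, Submodule.span_le]
  rintro _ ⟨_, ⟨i, rfl⟩, _, ⟨j, rfl⟩, rfl⟩
  beta_reduce
  rw [vsub_eq_sub, ← sub_sub_sub_cancel_right _ _ (vertexCentroid v)]
  exact Submodule.sub_mem _ (Submodule.subset_span ⟨i, rfl⟩) (Submodule.subset_span ⟨j, rfl⟩)

/-- The vectors from the centroid to the vertices form a tight frame. -/
lemma sum_inner_smul_sub_vertexCentroid [FiniteDimensional ℝ E] (hv : RegularSimplex v)
    (hcard : Fintype.card ι = finrank ℝ E + 1) (u : E) :
    ∑ i, ⟪u, v i - vertexCentroid v⟫ • (v i - vertexCentroid v) = (2 : ℝ) • u := by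
  classical
  have hu : u ∈ Submodule.span ℝ (range fun i => v i - vertexCentroid v) := by
    rw [hv.span_sub_vertexCentroid hcard]
    exact Submodule.mem_top
  induction hu using Submodule.span_induction with
  | mem _ h =>
    obtain ⟨j, rfl⟩ := h
    simp only [hv.inner_sub_vertexCentroid, mul_smul, sub_smul, ite_smul, one_smul, zero_smul,
      ← Finset.smul_sum, Finset.sum_sub_distrib (fun _ => ite _ _ _), Finset.sum_ite_eq,
      Finset.mem_univ, if_true, sum_sub_vertexCentroid, smul_zero, sub_zero]
  | zero => simp only [inner_zero_left, zero_smul, Finset.sum_const_zero, smul_zero]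
  | add x y _ _ hx hy => simp only [inner_add_left, add_smul, Finset.sum_add_distrib, hx, hy,
      smul_add]
  | smul t x _ hx => simp only [real_inner_smul_left, mul_smul, ← Finset.smul_sum, hx,
      smul_comm t (2 : ℝ)]

lemma inner_eq [FiniteDimensional ℝ E] (hv : RegularSimplex v)
    (hcard : Fintype.card ι = finrank ℝ E + 1) (u w : E) :
    ⟪u, w⟫ = (∑ i, ⟪u, v i - vertexCentroid v⟫ * ⟪w, v i - vertexCentroid v⟫) / 2 := by
  have h := congrArg (fun z => ⟪w, z⟫) (hv.sum_inner_smul_sub_vertexCentroid hcard u)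
  simp only [inner_sum, real_inner_smul_right, real_inner_comm u w] at h
  linarith

lemma dist_sq [FiniteDimensional ℝ E] (hv : RegularSimplex v)
    (hcard : Fintype.card ι = finrank ℝ E + 1) (z w : E) :
    dist z w ^ 2 = 2 * ∑ i, (bary v i z - bary v i w) ^ 2 := by
  rw [dist_eq_norm, ← real_inner_self_eq_norm_sq, hv.inner_eq hcard]
  simp only [bary_sub, div_pow, ← Finset.sum_div, ← sq]
  ring

end RegularSimplex

end RegularSimplex

/-! ### The regular tetrahedron -/

section Tetrahedron

/-- `i, j, l, m` are the four indices of the vertices of a tetrahedron, in some order; `i j` and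
`l m` then label a pair of opposite edges. -/
def Quad (i j l m : Fin 4) : Prop := i ≠ j ∧ i ≠ l ∧ i ≠ m ∧ j ≠ l ∧ j ≠ m ∧ l ≠ m

instance (i j l m : Fin 4) : Decidable (Quad i j l m) := by unfold Quad; infer_instance

variable {v : Fin 4 → E3} {i j l m : Fin 4}

lemma exists_quad (h : i ≠ j) : ∃ l m, Quad i j l m := by
  revert i j; decide

namespace Quad

lemma swap_left (h : Quad i j l m) : Quad j i l m := by
  unfold Quad at *; tauto

lemma swap_right (h : Quad i j l m) : Quad i j m l := by
  unfold Quad at *; tauto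

lemma swap_middle (h : Quad i j l m) : Quad i l j m := by
  unfold Quad at *; tauto

lemma opp (h : Quad i j l m) : Quad l m i j := by
  unfold Quad at *; tauto

lemma cases (h : Quad i j l m) (t : Fin 4) : t = i ∨ t = j ∨ t = l ∨ t = m := by
  revert i j l m t; decide

lemma sum_eq (h : Quad i j l m) {M : Type*} [AddCommMonoid M] (f : Fin 4 → M) :
    ∑ x, f x = f i + f j + f l + f m := by
  have huniv : Finset.univ = {i, j, l, m} := by
    ext t; simpa using h.cases t
  obtain ⟨hij, hil, him, hjl, hjm, hlm⟩ := h
  rw [huniv, Finset.sum_insert (by simp [hij, hil, him]), Finset.sum_insert (by simp [hjl, hjm]),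
    Finset.sum_pair hlm, ← add_assoc, ← add_assoc]

lemma sum_bary (h : Quad i j l m) (z : E3) :
    bary v i z + bary v j z + bary v l z + bary v m z = 1 := by
  rw [← h.sum_eq fun i => bary v i z, Peabody.sum_bary]

end Quad

/-- `Σ αᵢ² - 1` in barycentric coordinates; the circumscribed sphere is its zero set. -/
def quadForm (v : Fin 4 → E3) (z : E3) : ℝ := ∑ i, bary v i z ^ 2 - 1

lemma Quad.quadForm_eq (h : Quad i j l m) (z : E3) :
    quadForm v z = bary v i z ^ 2 + bary v j z ^ 2 + bary v l z ^ 2 + bary v m z ^ 2 - 1 := by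
  rw [quadForm, h.sum_eq fun i => bary v i z ^ 2]

lemma card_fin_four_eq_finrank_add_one : Fintype.card (Fin 4) = finrank ℝ E3 + 1 := by
  simp

namespace RegularSimplex

lemma dist_sq_quad (hv : RegularSimplex v) (h : Quad i j l m) (z w : E3) :
    dist z w ^ 2 = 2 * ((bary v i z - bary v i w) ^ 2 + (bary v j z - bary v j w) ^ 2 +
      (bary v l z - bary v l w) ^ 2 + (bary v m z - bary v m w) ^ 2) := by
  rw [hv.dist_sq card_fin_four_eq_finrank_add_one, h.sum_eq]

lemma bary_ext (hv : RegularSimplex v) {z w : E3} (h : ∀ i, bary v i z = bary v i w) :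
    z = w := by
  have := hv.dist_sq card_fin_four_eq_finrank_add_one z w
  simpa [h] using this

lemma bary_quad (hv : RegularSimplex v) (h : Quad i j l m) {p q r t : ℝ}
    (hs : p + q + r + t = 1) :
    bary v i (p • v i + q • v j + r • v l + t • v m) = p ∧
    bary v j (p • v i + q • v j + r • v l + t • v m) = q ∧
    bary v l (p • v i + q • v j + r • v l + t • v m) = r ∧
    bary v m (p • v i + q • v j + r • v l + t • v m) = t := by
  obtain ⟨hij, hil, him, hjl, hjm, hlm⟩ := id h
  set β : Fin 4 → ℝ := fun x => if x = i then p else if x = j then q else if x = l then r else t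
    with hβd
  have hi : β i = p := by simp [hβd]
  have hj : β j = q := by simp [hβd, hij.symm]
  have hl : β l = r := by simp [hβd, hil.symm, hjl.symm]
  have hm : β m = t := by simp [hβd, him.symm, hjm.symm, hlm.symm]
  have hβ : ∑ x, β x = 1 := by rw [h.sum_eq, hi, hj, hl, hm, hs]
  have hc : ∑ x, β x • v x = p • v i + q • v j + r • v l + t • v m := by
    rw [h.sum_eq fun x => β x • v x, hi, hj, hl, hm]
  simp only [← hc, hv.bary_sum_smul hβ, hi, hj, hl, hm, and_self]

lemma dist_vertex_sq (hv : RegularSimplex v) (z : E3) (i : Fin 4) :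
    dist z (v i) ^ 2 = 2 * quadForm v z - 4 * bary v i z + 4 := by
  have hsum : ∑ j, bary v j z * (if j = i then 1 else 0) = bary v i z := by simp
  have hone : ∑ j, (if j = i then (1 : ℝ) else 0) ^ 2 = 1 := by simp
  simp only [hv.dist_sq card_fin_four_eq_finrank_add_one, hv.bary_vertex, sub_sq, quadForm,
    Finset.sum_add_distrib, Finset.sum_sub_distrib, mul_assoc, ← Finset.mul_sum, hsum, hone]
  ring

lemma dist_vertex_le (hv : RegularSimplex v) (z : E3) (i : Fin 4) :
    dist z (v i) ≤ 2 ↔ quadForm v z ≤ 2 * bary v i z := by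
  rw [← abs_of_nonneg (dist_nonneg (x := z) (y := v i)), ← abs_two (α := ℝ), ← sq_le_sq,
    hv.dist_vertex_sq, abs_two]
  constructor <;> intro h <;> linarith

lemma dist_vertex_eq (hv : RegularSimplex v) (z : E3) (i : Fin 4) :
    dist z (v i) = 2 ↔ quadForm v z = 2 * bary v i z := by
  rw [← sq_eq_sq₀ dist_nonneg zero_le_two, hv.dist_vertex_sq]
  constructor <;> intro h <;> linarith

lemma eq_vertex_of_bary_nonpos (hv : RegularSimplex v) (h : Quad i j l m) {z : E3}
    (hT : ∀ t, quadForm v z ≤ 2 * bary v t z) (hi : bary v i z ≤ 0) (hj : bary v j z ≤ 0)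
    (hl : bary v l z ≤ 0) : z = v m := by
  have hs := h.sum_bary (v := v) z
  have hq := h.quadForm_eq (v := v) z
  have hQ : 0 ≤ quadForm v z := by
    rw [hq]; nlinarith [sq_nonneg (bary v i z), sq_nonneg (bary v j z), sq_nonneg (bary v l z)]
  have ei := hT i
  have ej := hT j
  have el := hT l
  obtain ⟨-, -, him, -, hjm, hlm⟩ := id h
  refine hv.bary_ext fun t => ?_
  rw [hv.bary_vertex]
  rcases h.cases t with rfl | rfl | rfl | rfl
  · rw [if_neg him]; linarith
  · rw [if_neg hjm]; linarith
  · rw [if_neg hlm]; linarith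
  · rw [if_pos rfl]; linarith

end RegularSimplex

end Tetrahedron

/-! ### The arc of pea centres in normalized coordinates -/

section Arc

variable {k ξ s ξ' s' Q x y : ℝ}

/-- `(ξ, s)` is the centre of a pea, in the coordinates `ξ` along the beam and `s` along the axis;
`s` is scaled so that the barycentric coordinates at the two ends of the opposite edge are `-s`.
The pea has radius `k * s`. -/
structure OnArc (k ξ s : ℝ) : Prop where
  nonneg : 0 ≤ s
  mul_le : k * s ≤ 2
  eq : ξ ^ 2 + 3 + 8 * s + 8 * s ^ 2 = (2 - k * s) ^ 2

/-- Half of the difference of the squares of the two sides of the constraint imposed by the pea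
`(ξ, s)` on a point with barycentric coordinates `x, y` at the ends of the beam, where `Q` stands
for `quadForm`: the constraint is `gap Q x y ξ s ≤ 0`, and the pea is active when equality holds. -/
def gap (Q x y ξ s : ℝ) : ℝ := Q - (1 + 4 * s) * (x + y) - ξ * (x - y)

lemma gap_neg (Q x y ξ s : ℝ) : gap Q x y (-ξ) s = gap Q y x ξ s := by
  unfold gap; ring

lemma gap_le (hx : Q ≤ 2 * x) (hy : Q ≤ 2 * y) :
    gap Q x y ξ s ≤ (|ξ| - 1) * |x - y| - 4 * s * (x + y) := by
  have hQ : Q ≤ x + y - |x - y| := by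
    rcases abs_cases (x - y) with ⟨h, _⟩ | ⟨h, _⟩ <;> linarith
  have hξ : -(ξ * (x - y)) ≤ |ξ| * |x - y| := by
    rw [← abs_mul]; exact neg_le_abs _
  unfold gap
  linarith

namespace OnArc

lemma one_zero (k : ℝ) : OnArc k 1 0 := ⟨le_rfl, by simp, by norm_num⟩

lemma neg (h : OnArc k ξ s) : OnArc k (-ξ) s := ⟨h.nonneg, h.mul_le, by rw [← h.eq]; ring⟩

lemma neg_one_zero (k : ℝ) : OnArc k (-1) 0 := (one_zero k).neg

lemma eq_one_or_eq_neg_one (h : OnArc k ξ 0) : ξ = 1 ∨ ξ = -1 := by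
  exact sq_eq_one_iff.1 (by linarith [h.eq])

variable (hk : 0 < k)
include hk

lemma eight_mul_le (h : OnArc k ξ s) : 8 * s + 2 * (k * s) ≤ 1 := by
  have hks : 0 ≤ k * s := mul_nonneg hk.le h.nonneg
  nlinarith [sq_nonneg ξ, sq_nonneg s, mul_nonneg hks (sub_nonneg.2 h.mul_le), h.eq]

lemma abs_le (h : OnArc k ξ s) : |ξ| ≤ 1 - (4 + 2 * k) * s := by
  have hs := h.eight_mul_le hk
  have h0 := h.nonneg
  refine abs_le_of_sq_le_sq ?_ (by nlinarith)
  nlinarith [h.eq, sq_nonneg s, mul_nonneg hk.le (sq_nonneg s), sq_nonneg (k * s)]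

lemma abs_lt (h : OnArc k ξ s) (hs : 0 < s) : |ξ| < 1 - (4 + 2 * k) * s := by
  have hs' := h.eight_mul_le hk
  refine abs_lt_of_sq_lt_sq ?_ (by nlinarith)
  nlinarith [h.eq, pow_pos hs 2, mul_nonneg hk.le (sq_nonneg s), sq_nonneg (k * s)]

lemma abs_le_one (h : OnArc k ξ s) : |ξ| ≤ 1 := by
  have h' : 0 ≤ (4 + 2 * k) * s := mul_nonneg (by linarith) h.nonneg
  linarith [h.abs_le hk]

omit hk in
lemma midpoint_lt (h : OnArc k ξ s) (h' : OnArc k ξ' s') (hne : ξ ≠ ξ' ∨ s ≠ s') :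
    ((ξ + ξ') / 2) ^ 2 + 3 + 8 * ((s + s') / 2) + 8 * ((s + s') / 2) ^ 2
      < (2 - k * ((s + s') / 2)) ^ 2 := by
  have hN := h.mul_le
  have hN' := h'.mul_le
  have hpos : 0 < (ξ - ξ') ^ 2 + 8 * (s - s') ^ 2 := by
    rcases hne with hne | hne
    · have := sq_pos_of_ne_zero (sub_ne_zero.2 hne)
      positivity
    · have := sq_pos_of_ne_zero (sub_ne_zero.2 hne)
      positivity
  -- a strict Cauchy-Schwarz inequality for the vectors `(ξ, 1, √2 (1 + 2 s))`, whose norms are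
  -- `2 - k s`
  have hcs : ξ * ξ' + 1 + 2 * ((1 + 2 * s) * (1 + 2 * s')) < (2 - k * s) * (2 - k * s') := by
    refine lt_of_pow_lt_pow_left₀ 2 (mul_nonneg (by linarith) (by linarith)) ?_
    rw [mul_pow (2 - k * s), ← h.eq, ← h'.eq]
    nlinarith [sq_nonneg (ξ * (1 + 2 * s') - ξ' * (1 + 2 * s))]
  nlinarith [h.eq, h'.eq]

lemma exists_ge (h0 : 0 ≤ s) (h1 : k * s ≤ 2)
    (h2 : ξ ^ 2 + 3 + 8 * s + 8 * s ^ 2 ≤ (2 - k * s) ^ 2) : ∃ s', s ≤ s' ∧ OnArc k ξ s' := by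
  have hs : s ≤ 2 / k := by rw [le_div_iff₀ hk]; linarith
  have hk2 : k * (2 / k) = 2 := mul_div_cancel₀ 2 hk.ne'
  have hcont : ContinuousOn (fun t : ℝ => (2 - k * t) ^ 2 - (ξ ^ 2 + 3 + 8 * t + 8 * t ^ 2))
      (Icc s (2 / k)) := by fun_prop
  have hpos : 0 < 2 / k := by positivity
  obtain ⟨t, ht, ht0⟩ := intermediate_value_Icc' hs hcont
    (show (0 : ℝ) ∈ _ from
      ⟨by rw [hk2]; nlinarith [sq_nonneg ξ, sq_nonneg (2 / k)], by linarith⟩)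
  refine ⟨t, ht.1, h0.trans ht.1, ?_, by linarith⟩
  exact (mul_le_mul_of_nonneg_left ht.2 hk.le).trans_eq hk2

lemma exists_zero : ∃ s, 0 < s ∧ OnArc k 0 s := by
  obtain ⟨s, hs, h⟩ := exists_ge (ξ := 0) (s := 0) hk le_rfl (by simp) (by norm_num)
  refine ⟨s, hs.lt_of_ne' ?_, h⟩
  rintro rfl
  have := h.eq
  norm_num at this

lemma isCompact_setOf : IsCompact {w : ℝ × ℝ | OnArc k w.1 w.2} := by
  have hset : {w : ℝ × ℝ | OnArc k w.1 w.2} = {w | 0 ≤ w.2} ∩ ({w | k * w.2 ≤ 2} ∩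
      {w | w.1 ^ 2 + 3 + 8 * w.2 + 8 * w.2 ^ 2 = (2 - k * w.2) ^ 2}) := by
    ext w
    exact ⟨fun h => ⟨h.nonneg, h.mul_le, h.eq⟩, fun h => ⟨h.1, h.2.1, h.2.2⟩⟩
  refine (isCompact_Icc.prod isCompact_Icc :
    IsCompact (Icc (-1 : ℝ) 1 ×ˢ Icc (0 : ℝ) 1)).of_isClosed_subset ?_ ?_
  · rw [hset]
    exact (isClosed_le (by fun_prop) (by fun_prop)).inter
      ((isClosed_le (by fun_prop) (by fun_prop)).inter (isClosed_eq (by fun_prop) (by fun_prop)))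
  · rintro ⟨ξ, s⟩ (h : OnArc k ξ s)
    have hs := h.eight_mul_le hk
    have hks : 0 ≤ k * s := mul_nonneg hk.le h.nonneg
    exact ⟨_root_.abs_le.1 (h.abs_le_one hk), h.nonneg, by linarith⟩

lemma exists_one_sub_le (h0 : 0 ≤ s) (h1 : (4 + 2 * k) * s ≤ 1 / 8) :
    ∃ ξ, OnArc k ξ s ∧ 1 - (4 + 2 * k) * s - 2 * ((4 + 2 * k) * s) ^ 2 ≤ ξ := by
  set τ := (4 + 2 * k) * s with hτ
  set q := (2 - k * s) ^ 2 - (3 + 8 * s + 8 * s ^ 2) with hq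
  have hτ0 : 0 ≤ τ := by positivity
  have hqτ : q = 1 - 2 * τ + (k * s) ^ 2 - 8 * s ^ 2 := by rw [hq, hτ]; ring
  have hsτ : 16 * s ^ 2 ≤ τ ^ 2 := by
    rw [mul_pow]; exact mul_le_mul_of_nonneg_right (by nlinarith) (sq_nonneg s)
  have hbound : (1 - τ - 2 * τ ^ 2) ^ 2 ≤ q := by
    have hτ3 : τ ^ 3 ≤ τ ^ 2 * (1 / 8) := by
      rw [pow_succ]; exact mul_le_mul_of_nonneg_left h1 (sq_nonneg _)
    have hτ4 : τ ^ 4 ≤ τ ^ 3 := by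
      rw [pow_succ]; exact mul_le_of_le_one_right (pow_nonneg hτ0 3) (by linarith)
    rw [hqτ]
    nlinarith [sq_nonneg (k * s)]
  have hq0 : 0 ≤ q := (sq_nonneg _).trans hbound
  refine ⟨√q, ⟨h0, by nlinarith, ?_⟩, Real.le_sqrt_of_sq_le hbound⟩
  rw [Real.sq_sqrt hq0, hq]; ring

/-! The wedge `(2 + k) |x - y| < -2 (x + y)` is bounded by the planes tangent to the arc at its two
ends. -/

lemma gap_nonpos (h : OnArc k ξ s) (hx : Q ≤ 2 * x) (hy : Q ≤ 2 * y)
    (hw : -(2 * (x + y)) ≤ (2 + k) * |x - y|) : gap Q x y ξ s ≤ 0 := by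
  have hξ : (|ξ| - 1) * |x - y| ≤ -((4 + 2 * k) * s) * |x - y| :=
    mul_le_mul_of_nonneg_right (by linarith [h.abs_le hk]) (abs_nonneg _)
  have hs : -(2 * (x + y)) * s ≤ (2 + k) * |x - y| * s := mul_le_mul_of_nonneg_right hw h.nonneg
  linarith [gap_le (ξ := ξ) (s := s) hx hy]

lemma wedge_of_gap_eq_zero (h : OnArc k ξ s) (hs : 0 < s) (hx : Q ≤ 2 * x) (hy : Q ≤ 2 * y)
    (hg : gap Q x y ξ s = 0) : (2 + k) * |x - y| < -(2 * (x + y)) ∨ (x = 0 ∧ y = 0) := by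
  by_contra! ⟨hw, hne⟩
  have hle := gap_le (ξ := ξ) (s := s) hx hy
  have hws : -(2 * (x + y)) * s ≤ (2 + k) * |x - y| * s := mul_le_mul_of_nonneg_right hw hs.le
  rcases eq_or_ne x y with rfl | hxy
  · simp only [sub_self, abs_zero, mul_zero] at hw hle
    have hx0 : x ≤ 0 := by nlinarith
    have : x = 0 := by linarith
    exact hne this this
  · have hξ : (|ξ| - 1) * |x - y| < -((4 + 2 * k) * s) * |x - y| :=
      mul_lt_mul_of_pos_right (by linarith [h.abs_lt hk hs]) (abs_pos.2 (sub_ne_zero.2 hxy))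
    linarith

lemma exists_gap_pos_of_wedge (hx : Q = 2 * x) (hxy : x ≤ y)
    (hw : (2 + k) * |x - y| < -(2 * (x + y))) : ∃ ξ s, OnArc k ξ s ∧ 0 < gap Q x y ξ s := by
  rw [abs_of_nonpos (by linarith), neg_sub] at hw
  set M := 4 + 2 * k
  have hM : 0 < M := by positivity
  set c := 2 * M ^ 2 * (y - x)
  have hc : 0 ≤ c := mul_nonneg (by positivity) (by linarith)
  set δ := -(4 * (x + y)) - M * (y - x)
  have hδ : 0 < δ := by linarith
  obtain ⟨s, hs, hMs, hcs⟩ : ∃ s : ℝ, 0 < s ∧ M * s ≤ 1 / 8 ∧ c * s < δ := by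
    refine ⟨min (1 / (8 * M)) (δ / (2 * (c + 1))), by positivity, ?_, ?_⟩
    · calc M * _ ≤ M * (1 / (8 * M)) := mul_le_mul_of_nonneg_left (min_le_left _ _) hM.le
        _ = 1 / 8 := by field_simp
    · calc c * _ ≤ c * (δ / (2 * (c + 1))) := mul_le_mul_of_nonneg_left (min_le_right _ _) hc
        _ < δ := by
          rw [mul_div_assoc', div_lt_iff₀ (by positivity)]
          nlinarith
  obtain ⟨ξ, ha, hξ⟩ := exists_one_sub_le hk hs.le hMs
  refine ⟨ξ, s, ha, ?_⟩
  calc 0 < s * (δ - c * s) := mul_pos hs (by linarith)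
    _ = (y - x) * (1 - M * s - 2 * (M * s) ^ 2) - (y - x) - 4 * s * (x + y) := by ring
    _ ≤ (y - x) * ξ - (y - x) - 4 * s * (x + y) := by
      gcongr
    _ = gap Q x y ξ s := by unfold gap; rw [hx]; ring

/-- The arc is strictly convex, and moving into the wedge along the axis increases the gap. -/
lemma eq_of_gap_eq_zero (h : OnArc k ξ s) (h' : OnArc k ξ' s') (hxy : x + y < 0)
    (hall : ∀ ξ s, OnArc k ξ s → gap Q x y ξ s ≤ 0) (hg : gap Q x y ξ s = 0)
    (hg' : gap Q x y ξ' s' = 0) : ξ = ξ' ∧ s = s' := by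
  by_contra hne
  have hm := h.midpoint_lt h' (by tauto)
  obtain ⟨t, ht, hta⟩ := exists_ge (ξ := (ξ + ξ') / 2) (s := (s + s') / 2) hk
    (by linarith [h.nonneg, h'.nonneg]) (by linarith [h.mul_le, h'.mul_le]) hm.le
  have hlt : (s + s') / 2 < t := by
    refine ht.lt_of_ne ?_
    rintro rfl
    exact hm.ne hta.eq
  have hgt := hall _ _ hta
  unfold gap at hg hg' hgt
  nlinarith

omit hk in
lemma hasStrictFDerivAt_sub (k ξ s : ℝ) : HasStrictFDerivAt
    (fun w : ℝ × ℝ => w.1 ^ 2 + 3 + 8 * w.2 + 8 * w.2 ^ 2 - (2 - k * w.2) ^ 2)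
    ((2 * ξ) • ContinuousLinearMap.fst ℝ ℝ ℝ
      + (2 * (4 + 8 * s + k * (2 - k * s))) • ContinuousLinearMap.snd ℝ ℝ ℝ) (ξ, s) := by
  have d1 : HasStrictFDerivAt (fun w : ℝ × ℝ => w.1) (ContinuousLinearMap.fst ℝ ℝ ℝ) (ξ, s) :=
    hasStrictFDerivAt_fst
  have d2 : HasStrictFDerivAt (fun w : ℝ × ℝ => w.2) (ContinuousLinearMap.snd ℝ ℝ ℝ) (ξ, s) :=
    hasStrictFDerivAt_snd
  have hd := ((((d1.pow 2).add_const 3).add (d2.const_mul 8)).add ((d2.pow 2).const_mul 8)).sub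
    (((d2.const_mul k).const_sub 2).pow 2)
  refine hd.congr_fderiv ?_
  ext <;> simp
  ring

omit hk in
lemma hasStrictFDerivAt_gap (Q x y ξ s : ℝ) : HasStrictFDerivAt
    (fun w : ℝ × ℝ => gap Q x y w.1 w.2)
    ((y - x) • ContinuousLinearMap.fst ℝ ℝ ℝ
      + (-(4 * (x + y))) • ContinuousLinearMap.snd ℝ ℝ ℝ) (ξ, s) := by
  have d1 : HasStrictFDerivAt (fun w : ℝ × ℝ => w.1) (ContinuousLinearMap.fst ℝ ℝ ℝ) (ξ, s) :=
    hasStrictFDerivAt_fst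
  have d2 : HasStrictFDerivAt (fun w : ℝ × ℝ => w.2) (ContinuousLinearMap.snd ℝ ℝ ℝ) (ξ, s) :=
    hasStrictFDerivAt_snd
  have hd := (((d2.const_mul 4).const_add 1).mul_const (x + y)).const_sub Q |>.sub
    (d1.mul_const (x - y))
  refine hd.congr_fderiv ?_
  ext <;> simp
  ring

lemma isLocalExtrOn_gap (h : OnArc k ξ s) (hs : 0 < s)
    (hall : ∀ ξ s, OnArc k ξ s → gap Q x y ξ s ≤ 0) (hg : gap Q x y ξ s = 0) :
    IsLocalExtrOn (fun w : ℝ × ℝ => gap Q x y w.1 w.2)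
      {w | w.1 ^ 2 + 3 + 8 * w.2 + 8 * w.2 ^ 2 - (2 - k * w.2) ^ 2
        = ξ ^ 2 + 3 + 8 * s + 8 * s ^ 2 - (2 - k * s) ^ 2} (ξ, s) := by
  have hks : k * s < 2 := by linarith [h.eight_mul_le hk]
  have hopen : ∀ᶠ w : ℝ × ℝ in 𝓝 (ξ, s), 0 < w.2 ∧ k * w.2 < 2 :=
    (continuous_snd.continuousAt.eventually (lt_mem_nhds hs)).and
      ((continuous_const.mul continuous_snd).continuousAt.eventually (gt_mem_nhds hks))
  right
  filter_upwards [self_mem_nhdsWithin, nhdsWithin_le_nhds hopen] with w hw hw'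
  rw [h.eq, sub_self] at hw
  exact (hall _ _ ⟨hw'.1.le, hw'.2.le, sub_eq_zero.1 hw⟩).trans_eq hg.symm

/-- The Lagrange multiplier condition for the maximum of `gap` along the arc. -/
lemma tangent_of_gap_eq_zero (h : OnArc k ξ s) (hs : 0 < s)
    (hall : ∀ ξ s, OnArc k ξ s → gap Q x y ξ s ≤ 0) (hg : gap Q x y ξ s = 0) :
    (x - y) * (4 + 8 * s + k * (2 - k * s)) = 4 * (x + y) * ξ := by
  set D := 4 + 8 * s + k * (2 - k * s)
  have hD : 0 < D := by
    have : 0 ≤ k * (2 - k * s) := mul_nonneg hk.le (by linarith [h.mul_le])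
    positivity
  obtain ⟨α, β, hαβ, hlin⟩ := (h.isLocalExtrOn_gap hk hs hall hg)
    |>.exists_multipliers_of_hasStrictFDerivAt_1d (hasStrictFDerivAt_sub k ξ s)
      (hasStrictFDerivAt_gap Q x y ξ s)
  have e1 : α * (2 * ξ) + β * (y - x) = 0 := by
    simpa using congrArg (fun f : ℝ × ℝ →L[ℝ] ℝ => f (1, 0)) hlin
  have e2 : α * (2 * D) + β * -(4 * (x + y)) = 0 := by
    simpa using congrArg (fun f : ℝ × ℝ →L[ℝ] ℝ => f (0, 1)) hlin
  have hβ : β ≠ 0 := by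
    rintro rfl
    have hα : α = 0 := by simpa [hD.ne'] using e2
    exact hαβ (by rw [hα]; rfl)
  apply mul_left_cancel₀ hβ
  linear_combination (-D) * e1 + ξ * e2

end OnArc

end Arc

/-! ### The body of constant width -/

section Tip

variable {E : Type*} [NormedAddCommGroup E] [NormedSpace ℝ E] {x y : E} {R : ℝ}

/-- The point at distance `R` from `x` on the ray from `y` through `x`, beyond `x`; if `x = y` it
is `x`. The parametrization `PeaPod.phi` of a wedge-pod surface is of this form. -/
def tip (x y : E) (R : ℝ) : E := x + (R / dist x y) • (x - y)

@[simp]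
lemma tip_zero (x y : E) : tip x y 0 = x := by
  rw [tip, zero_div, zero_smul, add_zero]

lemma dist_tip_left (hxy : x ≠ y) (hR : 0 ≤ R) : dist (tip x y R) x = R := by
  rw [tip, dist_self_add_left, norm_smul, ← dist_eq_norm, Real.norm_of_nonneg (by positivity),
    div_mul_cancel₀ _ (dist_ne_zero.2 hxy)]

lemma dist_tip_right (hxy : x ≠ y) (hR : 0 ≤ R) : dist (tip x y R) y = dist x y + R := by
  have h : tip x y R - y = (1 + R / dist x y) • (x - y) := by rw [tip]; module
  rw [dist_eq_norm, h, norm_smul, ← dist_eq_norm, Real.norm_of_nonneg (by positivity), add_mul,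
    one_mul, div_mul_cancel₀ _ (dist_ne_zero.2 hxy)]

lemma inv_dist_smul_tip_sub (hxy : x ≠ y) (hR : 0 ≤ R) :
    (dist (tip x y R) y)⁻¹ • (tip x y R - y) = (dist x y)⁻¹ • (x - y) := by
  have hd : 0 < dist x y := dist_pos.2 hxy
  have hsub : tip x y R - y = ((dist x y + R) / dist x y) • (x - y) := by
    rw [tip, add_div, div_self hd.ne']; module
  rw [dist_tip_right hxy hR, hsub, smul_smul, inv_mul_eq_div, div_div_cancel_left' (by positivity)]

lemma tip_sub_tip (hxy : x ≠ y) (R R' : ℝ) :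
    tip x y R - tip y x R' = (dist x y + R + R') • (dist x y)⁻¹ • (x - y) := by
  rw [tip, tip, dist_comm y x, add_smul, add_smul, smul_inv_smul₀ (dist_ne_zero.2 hxy)]
  module

end Tip

section PeaBody

variable {v : Fin 4 → E3} {κ : Fin 4 → Fin 4 → ℝ} {i j l m i' j' l' m' : Fin 4}
  {k k' ξ s ξ' s' : ℝ} {p z : E3}

/-- The ratios between the radius of a pea and the height of its centre, for the pea pods on the
six edges. Confocality of the pods on opposite edges is the relation `prod`. -/
structure Weights (κ : Fin 4 → Fin 4 → ℝ) : Prop where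
  symm : ∀ i j, κ i j = κ j i
  pos : ∀ i j, i ≠ j → 0 < κ i j
  prod : ∀ i j l m, Quad i j l m → κ i j * κ l m = 8

/-- The point with coordinates `(ξ, s)` in the plane that contains the edge `i, j` and the midpoint
of the opposite edge; for `OnArc` coordinates it is the centre of a pea on the edge `i, j`. -/
def arcPt (v : Fin 4 → E3) (i j l m : Fin 4) (ξ s : ℝ) : E3 :=
  (1 / 2 + ξ / 2 + s) • v i + (1 / 2 - ξ / 2 + s) • v j + (-s) • v l + (-s) • v m

/-- The centres and radii of all peas on the six edges. -/
def peas (v : Fin 4 → E3) (κ : Fin 4 → Fin 4 → ℝ) : Set (E3 × ℝ) :=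
  {c | ∃ i j l m ξ s, Quad i j l m ∧ OnArc (κ i j) ξ s ∧ c = (arcPt v i j l m ξ s, κ i j * s)}

/-- The points at distance at most `2` from all points of all peas. -/
def peaBody (v : Fin 4 → E3) (κ : Fin 4 → Fin 4 → ℝ) : Set E3 := ballIntersection (peas v κ) 2

/-- The constraints on `z` coming from the arc on the edge `i, j`. -/
def ArcOK (v : Fin 4 → E3) (κ : Fin 4 → Fin 4 → ℝ) (z : E3) (i j : Fin 4) : Prop :=
  ∀ ξ s, OnArc (κ i j) ξ s → gap (quadForm v z) (bary v i z) (bary v j z) ξ s ≤ 0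

/-- `z` lies in the Reuleaux tetrahedron; see `RegularSimplex.dist_vertex_le` for the shape of the
inequalities. -/
def InReuleaux (v : Fin 4 → E3) (z : E3) : Prop := ∀ t, quadForm v z ≤ 2 * bary v t z

/-- The wedge beyond the edge opposite to `i, j` in which the arc on `i, j` is relevant. -/
def InWedge (v : Fin 4 → E3) (κ : Fin 4 → Fin 4 → ℝ) (z : E3) (i j : Fin 4) : Prop :=
  (2 + κ i j) * |bary v i z - bary v j z| < -(2 * (bary v i z + bary v j z))

@[simp]
lemma arcPt_one_zero (v : Fin 4 → E3) (i j l m : Fin 4) : arcPt v i j l m 1 0 = v i := by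
  simp only [arcPt]; norm_num

@[simp]
lemma arcPt_neg_one_zero (v : Fin 4 → E3) (i j l m : Fin 4) : arcPt v i j l m (-1) 0 = v j := by
  simp only [arcPt]; norm_num

lemma arcPt_comm_left (v : Fin 4 → E3) (i j l m : Fin 4) (ξ s : ℝ) :
    arcPt v j i l m ξ s = arcPt v i j l m (-ξ) s := by
  simp only [arcPt]; module

lemma arcPt_comm_right (v : Fin 4 → E3) (i j l m : Fin 4) (ξ s : ℝ) :
    arcPt v i j m l ξ s = arcPt v i j l m ξ s := by
  simp only [arcPt]; module

lemma Quad.exists_arcPt_eq (h : Quad i j l m) (h' : Quad i' j' l' m') (hκ : Weights κ)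
    (hi : i' = i ∨ i' = j) (hj : j' = i ∨ j' = j) (ha : OnArc (κ i' j') ξ s) :
    ∃ ξ', OnArc (κ i j) ξ' s ∧
      (arcPt v i' j' l' m' ξ s, κ i' j' * s) = (arcPt v i j l m ξ' s, κ i j * s) := by
  have hlm : (l' = l ∧ m' = m) ∨ (l' = m ∧ m' = l) := by
    clear ha
    revert i j l m i' j' l' m'
    decide
  have hright : ∀ ξ, arcPt v i j l' m' ξ s = arcPt v i j l m ξ s := by
    rcases hlm with ⟨rfl, rfl⟩ | ⟨rfl, rfl⟩ <;> intro ξ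
    · rfl
    · exact arcPt_comm_right ..
  rcases hi with rfl | rfl <;> rcases hj with rfl | rfl
  · exact (h'.1 rfl).elim
  · exact ⟨ξ, ha, by rw [hright]⟩
  · exact ⟨-ξ, hκ.symm i' j' ▸ ha.neg, by rw [arcPt_comm_left, hright, hκ.symm]⟩
  · exact (h'.1 rfl).elim

lemma isCompact_peas (hκ : Weights κ) : IsCompact (peas v κ) := by
  have hset : peas v κ =
      ⋃ q ∈ {q : Fin 4 × Fin 4 × Fin 4 × Fin 4 | Quad q.1 q.2.1 q.2.2.1 q.2.2.2},
        (fun w : ℝ × ℝ =>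
          ((arcPt v q.1 q.2.1 q.2.2.1 q.2.2.2 w.1 w.2, κ q.1 q.2.1 * w.2) : E3 × ℝ)) ''
          {w | OnArc (κ q.1 q.2.1) w.1 w.2} := by
    ext c
    simp only [peas, mem_ofPred_eq, mem_iUnion, mem_image, Prod.exists, exists_prop]
    constructor
    · rintro ⟨i, j, l, m, ξ, s, hq, ha, rfl⟩
      exact ⟨i, j, l, m, hq, ξ, s, ha, rfl⟩
    · rintro ⟨i, j, l, m, hq, ξ, s, ha, rfl⟩
      exact ⟨i, j, l, m, ξ, s, hq, ha, rfl⟩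
  rw [hset]
  refine (toFinite _).isCompact_biUnion fun q (hq : Quad _ _ _ _) => ?_
  refine (OnArc.isCompact_setOf (hκ.pos _ _ hq.1)).image ?_
  unfold arcPt
  fun_prop

lemma ArcOK.symm (hκ : Weights κ) (h : ArcOK v κ z i j) : ArcOK v κ z j i := by
  intro ξ s ha
  rw [hκ.symm] at ha
  have := h (-ξ) s ha.neg
  rwa [gap_neg] at this

lemma InWedge.neg (hκ : Weights κ) (hij : i ≠ j) (h : InWedge v κ z i j) :
    bary v i z < 0 ∧ bary v j z < 0 := by
  unfold InWedge at h
  have hk : 0 ≤ κ i j * |bary v i z - bary v j z| :=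
    mul_nonneg (hκ.pos i j hij).le (abs_nonneg _)
  have h1 := le_abs_self (bary v i z - bary v j z)
  have h2 := neg_le_abs (bary v i z - bary v j z)
  constructor <;> linarith

lemma arcOK_of_not_inWedge (hκ : Weights κ) (hij : i ≠ j) (hT : InReuleaux v z)
    (h : ¬ InWedge v κ z i j) : ArcOK v κ z i j := fun _ _ ha =>
  ha.gap_nonpos (hκ.pos i j hij) (hT i) (hT j) (not_lt.1 h)

lemma bary_sq_le (h : ∀ t, 0 ≤ bary v t z) (t : Fin 4) : bary v t z ^ 2 ≤ bary v t z := by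
  have hle : bary v t z ≤ 1 :=
    (Finset.single_le_sum (fun i _ => h i) (Finset.mem_univ t)).trans_eq (sum_bary v z)
  nlinarith [h t]

lemma quadForm_nonpos (h : ∀ t, 0 ≤ bary v t z) : quadForm v z ≤ 0 := by
  rw [quadForm, sub_nonpos, ← sum_bary v z]
  exact Finset.sum_le_sum fun t _ => bary_sq_le h t

namespace RegularSimplex

lemma mem_range_of_bary_nonneg (hv : RegularSimplex v) (h : ∀ t, 0 ≤ bary v t z)
    (hQ : 0 ≤ quadForm v z) : z ∈ range v := by
  have hQ0 : quadForm v z = 0 := (quadForm_nonpos h).antisymm hQ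
  have hsq : ∑ t, bary v t z ^ 2 = ∑ t, bary v t z := by
    rw [sum_bary]; exact sub_eq_zero.1 hQ0
  obtain ⟨t, -, ht⟩ : ∃ t ∈ Finset.univ, bary v t z ≠ 0 := by
    apply Finset.exists_ne_zero_of_sum_ne_zero
    rw [sum_bary]; exact one_ne_zero
  have hone : bary v t z = 1 := by
    have := (Finset.sum_eq_sum_iff_of_le fun t _ => bary_sq_le h t).1 hsq t (Finset.mem_univ t)
    rw [sq] at this
    exact (mul_eq_left₀ ht).1 this
  have hdist := hv.dist_vertex_sq z t
  rw [hQ0, hone] at hdist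
  exact ⟨t, (dist_eq_zero.1 (pow_eq_zero_iff two_ne_zero |>.1 (by linarith))).symm⟩

lemma bary_pos_of_nonpos (hv : RegularSimplex v) (h : Quad i j l m) (hT : InReuleaux v z)
    (hz : z ∉ range v) (hi : bary v i z ≤ 0) (hj : bary v j z ≤ 0) :
    0 < bary v l z ∧ 0 < bary v m z := by
  constructor <;> by_contra! hneg
  · exact hz ⟨m, (hv.eq_vertex_of_bary_nonpos h hT hi hj hneg).symm⟩
  · exact hz ⟨l, (hv.eq_vertex_of_bary_nonpos h.swap_right hT hi hj hneg).symm⟩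

lemma bary_vertex_nonneg (hv : RegularSimplex v) (t r : Fin 4) : 0 ≤ bary v t (v r) := by
  rw [hv.bary_vertex]
  split_ifs <;> norm_num

lemma inReuleaux_vertex (hv : RegularSimplex v) (t : Fin 4) : InReuleaux v (v t) := by
  intro r
  rw [← hv.dist_vertex_le]
  rcases eq_or_ne t r with rfl | h
  · simp
  · rw [hv h]

lemma bary_arcPt (hv : RegularSimplex v) (h : Quad i j l m) (ξ s : ℝ) :
    bary v i (arcPt v i j l m ξ s) = 1 / 2 + ξ / 2 + s ∧
    bary v j (arcPt v i j l m ξ s) = 1 / 2 - ξ / 2 + s ∧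
    bary v l (arcPt v i j l m ξ s) = -s ∧ bary v m (arcPt v i j l m ξ s) = -s :=
  hv.bary_quad h (by ring)

lemma dist_arcPt_sq (hv : RegularSimplex v) (h : Quad i j l m) (ha : OnArc k ξ s) (z : E3) :
    dist z (arcPt v i j l m ξ s) ^ 2 - (2 - k * s) ^ 2 =
      2 * gap (quadForm v z) (bary v i z) (bary v j z) ξ s := by
  obtain ⟨hi, hj, hl, hm⟩ := hv.bary_arcPt h ξ s
  rw [hv.dist_sq_quad h, hi, hj, hl, hm, h.quadForm_eq, ← ha.eq, gap]
  linear_combination 4 * s * h.sum_bary (v := v) z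

lemma dist_arcPt_add_le (hv : RegularSimplex v) (h : Quad i j l m) (ha : OnArc k ξ s) (z : E3) :
    dist z (arcPt v i j l m ξ s) + k * s ≤ 2 ↔
      gap (quadForm v z) (bary v i z) (bary v j z) ξ s ≤ 0 := by
  have hsq := hv.dist_arcPt_sq h ha z
  rw [← le_sub_iff_add_le, ← pow_le_pow_iff_left₀ dist_nonneg (sub_nonneg.2 ha.mul_le) two_ne_zero]
  constructor <;> intro h <;> linarith

lemma dist_arcPt_add_eq (hv : RegularSimplex v) (h : Quad i j l m) (ha : OnArc k ξ s) (z : E3) :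
    dist z (arcPt v i j l m ξ s) + k * s = 2 ↔
      gap (quadForm v z) (bary v i z) (bary v j z) ξ s = 0 := by
  have hsq := hv.dist_arcPt_sq h ha z
  rw [← eq_sub_iff_add_eq, ← sq_eq_sq₀ dist_nonneg (sub_nonneg.2 ha.mul_le)]
  constructor <;> intro h <;> linarith

/-- Points of two confocal conics: with `k * k' = 8` the mixed terms of the squared distance
complete a square. -/
lemma dist_arcPt_opp_sq (hv : RegularSimplex v) (h : Quad i j l m) (hkk : k * k' = 8)
    (ha : OnArc k ξ s) (ξ' s' : ℝ) :
    dist (arcPt v i j l m ξ s) (arcPt v l m i j ξ' s') ^ 2 - (2 - k * s - k' * s') ^ 2 =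
      ξ' ^ 2 + 3 + 8 * s' + 8 * s' ^ 2 - (2 - k' * s') ^ 2 := by
  obtain ⟨hi, hj, hl, hm⟩ := hv.bary_arcPt h ξ s
  obtain ⟨hl', hm', hi', hj'⟩ := hv.bary_arcPt h.opp ξ' s'
  rw [hv.dist_sq_quad h, hi, hj, hl, hm, hi', hj', hl', hm']
  linear_combination ha.eq - 2 * s * s' * hkk

/-- The focal property of confocal conics. -/
lemma dist_arcPt_opp (hv : RegularSimplex v) (h : Quad i j l m) (hκ : Weights κ)
    (ha : OnArc (κ i j) ξ s) (ha' : OnArc (κ l m) ξ' s') :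
    dist (arcPt v i j l m ξ s) (arcPt v l m i j ξ' s') = 2 - κ i j * s - κ l m * s' := by
  have hs := ha.eight_mul_le (hκ.pos i j h.1)
  have hs' := ha'.eight_mul_le (hκ.pos l m h.opp.1)
  have hsq := hv.dist_arcPt_opp_sq h (hκ.prod i j l m h) ha ξ' s'
  rw [ha'.eq, sub_self, sub_eq_zero] at hsq
  exact (sq_eq_sq₀ dist_nonneg (by linarith [ha.nonneg, ha'.nonneg])).1 hsq

lemma arcPt_ne_arcPt_opp (hv : RegularSimplex v) (h : Quad i j l m) (hκ : Weights κ)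
    (ha : OnArc (κ i j) ξ s) (ha' : OnArc (κ l m) ξ' s') :
    arcPt v i j l m ξ s ≠ arcPt v l m i j ξ' s' := by
  have hs := ha.eight_mul_le (hκ.pos i j h.1)
  have hs' := ha'.eight_mul_le (hκ.pos l m h.opp.1)
  rw [← dist_pos, hv.dist_arcPt_opp h hκ ha ha']
  linarith [ha.nonneg, ha'.nonneg]

lemma dist_arcPt_left_add_le (hv : RegularSimplex v) (h : Quad i j l m) (hk : 0 < k)
    (ha : OnArc k ξ s) : dist (arcPt v i j l m ξ s) (v i) + k * s ≤ 2 := by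
  obtain ⟨hi, hj, hl, hm⟩ := hv.bary_arcPt h ξ s
  obtain ⟨hij, hil, him, -⟩ := id h
  have h8 := ha.eight_mul_le hk
  have hs := ha.nonneg
  have hks : 0 ≤ k * s := mul_nonneg hk.le hs
  have hξ := abs_le.1 (ha.abs_le hk)
  rw [← le_sub_iff_add_le, ← pow_le_pow_iff_left₀ dist_nonneg (by linarith) two_ne_zero,
    hv.dist_sq_quad h, hi, hj, hl, hm]
  simp only [hv.bary_vertex, hij.symm, hil.symm, him.symm, if_true, if_false]
  have h1 : 0 ≤ 1 - ξ := by nlinarith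
  have h2 : 1 - ξ ≤ 2 - k * s - 4 * s := by linarith
  nlinarith [h1, h2, mul_nonneg hs hs, mul_nonneg hs hks]

lemma mem_peaBody_iff (hv : RegularSimplex v) :
    z ∈ peaBody v κ ↔ ∀ i j, i ≠ j → ArcOK v κ z i j := by
  constructor
  · intro h i j hij ξ s ha
    obtain ⟨l, m, hq⟩ := exists_quad hij
    have hc : ((arcPt v i j l m ξ s, κ i j * s) : E3 × ℝ) ∈ peas v κ :=
      ⟨i, j, l, m, ξ, s, hq, ha, rfl⟩
    have hle := mem_ballIntersection.1 h _ hc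
    exact (hv.dist_arcPt_add_le hq ha z).1 hle
  · refine fun h => mem_ballIntersection.2 fun c hc => ?_
    obtain ⟨i, j, l, m, ξ, s, hq, ha, rfl⟩ := hc
    exact (hv.dist_arcPt_add_le hq ha z).2 (h i j hq.1 ξ s ha)

lemma inReuleaux_of_mem_peaBody (hv : RegularSimplex v) (h : z ∈ peaBody v κ) :
    InReuleaux v z := by
  intro t
  obtain ⟨j, hj⟩ := exists_ne t
  have := hv.mem_peaBody_iff.1 h t j hj.symm 1 0 (OnArc.one_zero _)
  unfold gap at this
  linarith

lemma isCompact_peaBody (hv : RegularSimplex v) : IsCompact (peaBody v κ) := by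
  refine (isCompact_closedBall (v 0) 2).of_isClosed_subset (isClosed_ballIntersection _ _)
    fun z hz => ?_
  rw [mem_closedBall, hv.dist_vertex_le]
  exact hv.inReuleaux_of_mem_peaBody hz 0

lemma mem_peaBody_of_bary_nonneg (hv : RegularSimplex v) (hκ : Weights κ) (hT : InReuleaux v z)
    (h : ∀ t, 0 ≤ bary v t z) : z ∈ peaBody v κ :=
  hv.mem_peaBody_iff.2 fun i _ hij =>
    arcOK_of_not_inWedge hκ hij hT fun hw => (h i).not_gt (hw.neg hκ hij).1

lemma vertex_mem_peaBody (hv : RegularSimplex v) (hκ : Weights κ) (t : Fin 4) :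
    v t ∈ peaBody v κ :=
  hv.mem_peaBody_of_bary_nonneg hκ (hv.inReuleaux_vertex t) fun r => hv.bary_vertex_nonneg r t

lemma interior_peaBody_nonempty (hv : RegularSimplex v) (hκ : Weights κ) :
    (interior (peaBody v κ)).Nonempty := by
  have hopen : IsOpen {z : E3 | ∀ t, 0 < bary v t z} := by
    simp only [ofPred_forall]
    exact isOpen_iInter_of_finite fun t => isOpen_lt continuous_const (continuous_bary v t)
  refine ⟨vertexCentroid v, mem_interior.2 ⟨_, fun z hz => ?_, hopen, fun t => by simp [bary]⟩⟩
  have h0 : ∀ t, 0 ≤ bary v t z := fun t => (hz t).le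
  exact hv.mem_peaBody_of_bary_nonneg hκ
    (fun t => (quadForm_nonpos h0).trans (by linarith [h0 t])) h0

/-- Beyond the edge `l, m` only the arc on that edge matters: a violated wedge `p, q` would make
`bary v p z` and `bary v q z` negative, and three nonpositive coordinates occur only at vertices. -/
lemma mem_peaBody_of_opp (hv : RegularSimplex v) (hκ : Weights κ) (h : Quad i j l m)
    (hT : InReuleaux v z) (hl : bary v l z ≤ 0) (hm : bary v m z ≤ 0) (hok : ArcOK v κ z l m) :
    z ∈ peaBody v κ := by
  by_cases hz : z ∈ range v
  · obtain ⟨t, rfl⟩ := hz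
    exact hv.vertex_mem_peaBody hκ t
  obtain ⟨hi, hj⟩ := hv.bary_pos_of_nonpos h.opp hT hz hl hm
  have hneg : ∀ t, bary v t z < 0 → t = l ∨ t = m := by
    intro t ht
    rcases h.cases t with rfl | rfl | rfl | rfl
    · exact (hi.not_gt ht).elim
    · exact (hj.not_gt ht).elim
    · exact .inl rfl
    · exact .inr rfl
  refine hv.mem_peaBody_iff.2 fun p q hpq => ?_
  by_cases hw : InWedge v κ z p q
  · obtain ⟨hp, hq⟩ := hw.neg hκ hpq
    rcases hneg p hp with rfl | rfl <;> rcases hneg q hq with rfl | rfl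
    · exact (hpq rfl).elim
    · exact hok
    · exact hok.symm hκ
    · exact (hpq rfl).elim
  · exact arcOK_of_not_inWedge hκ hpq hT hw

lemma dist_arcPt_opp_add_le (hv : RegularSimplex v) (hκ : Weights κ) (h : Quad i j l m)
    (ha : OnArc (κ i j) ξ s) (ha' : OnArc (κ l m) ξ' s')
    (hp : dist p (arcPt v i j l m ξ s) ≤ κ i j * s) :
    dist p (arcPt v l m i j ξ' s') + κ l m * s' ≤ 2 := by
  have := dist_triangle p (arcPt v i j l m ξ s) (arcPt v l m i j ξ' s')
  rw [hv.dist_arcPt_opp h hκ ha ha'] at this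
  linarith

lemma inReuleaux_of_dist_arcPt_le (hv : RegularSimplex v) (hκ : Weights κ) (h : Quad i j l m)
    (ha : OnArc (κ i j) ξ s) (hp : dist p (arcPt v i j l m ξ s) ≤ κ i j * s) :
    InReuleaux v p := by
  have hk := hκ.pos i j h.1
  intro t
  rw [← hv.dist_vertex_le]
  rcases h.cases t with rfl | rfl | rfl | rfl
  · have := hv.dist_arcPt_left_add_le h hk ha
    linarith [dist_triangle p (arcPt v t j l m ξ s) (v t)]
  · have := hv.dist_arcPt_left_add_le h.swap_left hk ha.neg
    rw [arcPt_comm_left, neg_neg] at this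
    linarith [dist_triangle p (arcPt v i t l m ξ s) (v t)]
  · simpa using hv.dist_arcPt_opp_add_le hκ h ha (.one_zero _) hp
  · simpa using hv.dist_arcPt_opp_add_le hκ h ha (.neg_one_zero _) hp

lemma tip_mem_peaBody (hv : RegularSimplex v) (hκ : Weights κ) (h : Quad i j l m)
    (ha : OnArc (κ i j) ξ s) (ha' : OnArc (κ l m) ξ' s') :
    tip (arcPt v i j l m ξ s) (arcPt v l m i j ξ' s') (κ i j * s) ∈ peaBody v κ := by
  have hR : 0 ≤ κ i j * s := mul_nonneg (hκ.pos i j h.1).le ha.nonneg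
  obtain ⟨-, -, hl, hm⟩ := hv.bary_arcPt h ξ s
  obtain ⟨hl', hm', -, -⟩ := hv.bary_arcPt h.opp ξ' s'
  have hξ' := abs_le.1 (ha'.abs_le_one (hκ.pos l m h.opp.1))
  have hdist := (dist_tip_left (hv.arcPt_ne_arcPt_opp h hκ ha ha') hR).le
  have hμ : 0 ≤ κ i j * s / dist (arcPt v i j l m ξ s) (arcPt v l m i j ξ' s') := by positivity
  have hs := ha.nonneg
  have hs' := ha'.nonneg
  refine hv.mem_peaBody_of_opp hκ h (hv.inReuleaux_of_dist_arcPt_le hκ h ha hdist) ?_ ?_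
    fun ξ₁ s₁ h₁ => (hv.dist_arcPt_add_le h.opp h₁ _).1 (hv.dist_arcPt_opp_add_le hκ h ha h₁ hdist)
  · rw [tip, bary_add_smul_sub, hl, hl']
    nlinarith [mul_nonneg hμ (show 0 ≤ 1 / 2 + ξ' / 2 + s' + s by linarith)]
  · rw [tip, bary_add_smul_sub, hm, hm']
    nlinarith [mul_nonneg hμ (show 0 ≤ 1 / 2 - ξ' / 2 + s' + s by linarith)]

end RegularSimplex

end PeaBody

section ActivePeas

variable {v : Fin 4 → E3} {κ : Fin 4 → Fin 4 → ℝ} {i j l m : Fin 4} {k k' ξ s ξ' s' : ℝ} {p : E3}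
  {c c' : E3 × ℝ}

namespace RegularSimplex

lemma inWedge_of_gap_eq_zero (hv : RegularSimplex v) (hκ : Weights κ) (hij : i ≠ j)
    (hT : InReuleaux v p) (hpv : p ∉ range v) (ha : OnArc (κ i j) ξ s) (hs : 0 < s)
    (hg : gap (quadForm v p) (bary v i p) (bary v j p) ξ s = 0) : InWedge v κ p i j := by
  refine (ha.wedge_of_gap_eq_zero (hκ.pos i j hij) hs (hT i) (hT j) hg).resolve_right ?_
  rintro ⟨hi, hj⟩
  have hQ : quadForm v p = 0 := by simpa [gap, hi, hj] using hg
  exact hpv (hv.mem_range_of_bary_nonneg (fun t => by linarith [hT t]) hQ.ge)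

lemma eq_of_two_vertices_active (hv : RegularSimplex v) (hκ : Weights κ)
    (hp : p ∈ peaBody v κ) (hpv : p ∉ range v) (hi : quadForm v p = 2 * bary v i p)
    (hj : quadForm v p = 2 * bary v j p) : i = j := by
  by_contra hij
  have hT := hv.inReuleaux_of_mem_peaBody hp
  rcases le_or_gt 0 (bary v i p) with h0 | h0
  · exact hpv (hv.mem_range_of_bary_nonneg (fun t => by linarith [hT t]) (by linarith))
  · obtain ⟨s, hs, ha⟩ := OnArc.exists_zero (hκ.pos i j hij)
    have hgap := hv.mem_peaBody_iff.1 hp i j hij 0 s ha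
    unfold gap at hgap
    nlinarith [mul_pos hs (neg_pos.2 h0)]

lemma active_cases (hv : RegularSimplex v) (hc : c ∈ peas v κ) (h : dist p c.1 + c.2 = 2) :
    (∃ t, c = (v t, 0) ∧ quadForm v p = 2 * bary v t p) ∨
    ∃ i j l m ξ s, Quad i j l m ∧ OnArc (κ i j) ξ s ∧ 0 < s ∧
      c = (arcPt v i j l m ξ s, κ i j * s) ∧
      gap (quadForm v p) (bary v i p) (bary v j p) ξ s = 0 := by
  obtain ⟨i, j, l, m, ξ, s, hq, ha, rfl⟩ := hc
  have hg := (hv.dist_arcPt_add_eq hq ha p).1 h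
  rcases ha.nonneg.eq_or_lt with rfl | hs
  · left
    unfold gap at hg
    rcases ha.eq_one_or_eq_neg_one with rfl | rfl
    · exact ⟨i, by rw [arcPt_one_zero, mul_zero], by linarith⟩
    · exact ⟨j, by rw [arcPt_neg_one_zero, mul_zero], by linarith⟩
  · exact .inr ⟨i, j, l, m, ξ, s, hq, ha, hs, rfl, hg⟩

/-- An active pea of positive radius excludes all others: by strict convexity on its own edge, and
on the other edges because the coordinates belonging to these are not both negative. -/
lemma eq_of_gap_eq_zero (hv : RegularSimplex v) (hκ : Weights κ) (h : Quad i j l m)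
    (hp : p ∈ peaBody v κ) (hpv : p ∉ range v) (ha : OnArc (κ i j) ξ s) (hs : 0 < s)
    (hg : gap (quadForm v p) (bary v i p) (bary v j p) ξ s = 0)
    (hc : c ∈ peas v κ) (hcp : dist p c.1 + c.2 = 2) :
    c = (arcPt v i j l m ξ s, κ i j * s) := by
  have hT := hv.inReuleaux_of_mem_peaBody hp
  obtain ⟨hi, hj⟩ := (hv.inWedge_of_gap_eq_zero hκ h.1 hT hpv ha hs hg).neg hκ h.1
  obtain ⟨hl, hm⟩ := hv.bary_pos_of_nonpos h hT hpv hi.le hj.le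
  have huniq : ∀ ξ' s', OnArc (κ i j) ξ' s' →
      gap (quadForm v p) (bary v i p) (bary v j p) ξ' s' = 0 → ξ' = ξ ∧ s' = s :=
    fun ξ' s' ha' hg' => ha'.eq_of_gap_eq_zero (hκ.pos i j h.1) ha (by linarith)
      (hv.mem_peaBody_iff.1 hp i j h.1) hg' hg
  rcases hv.active_cases hc hcp with
    ⟨t, rfl, ht⟩ | ⟨i', j', l', m', ξ', s', hq, ha', hs', rfl, hg'⟩
  · have hti := hT i
    rcases h.cases t with rfl | rfl | rfl | rfl
    · exact (hs.ne (huniq 1 0 (.one_zero _) (by unfold gap; linarith)).2).elim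
    · exact (hs.ne (huniq (-1) 0 (.neg_one_zero _) (by unfold gap; linarith)).2).elim
    · linarith
    · linarith
  · obtain ⟨hi', hj'⟩ := (hv.inWedge_of_gap_eq_zero hκ hq.1 hT hpv ha' hs' hg').neg hκ hq.1
    have hneg : ∀ t, bary v t p < 0 → t = i ∨ t = j := by
      intro t ht
      rcases h.cases t with rfl | rfl | rfl | rfl
      · exact .inl rfl
      · exact .inr rfl
      · exact (hl.not_gt ht).elim
      · exact (hm.not_gt ht).elim
    obtain ⟨ξ₁, ha₁, he⟩ := h.exists_arcPt_eq hq hκ (hneg i' hi') (hneg j' hj') ha'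
    rw [he] at hcp
    obtain ⟨rfl, rfl⟩ := huniq ξ₁ s' ha₁ ((hv.dist_arcPt_add_eq h ha₁ p).1 hcp)
    exact he

lemma active_unique (hv : RegularSimplex v) (hκ : Weights κ) (hp : p ∈ peaBody v κ)
    (hpv : p ∉ range v) (hc : c ∈ peas v κ) (hc' : c' ∈ peas v κ) (h : dist p c.1 + c.2 = 2)
    (h' : dist p c'.1 + c'.2 = 2) : c' = c := by
  rcases hv.active_cases hc h with ⟨t, rfl, ht⟩ | ⟨i, j, l, m, ξ, s, hq, ha, hs, rfl, hg⟩
  · rcases hv.active_cases hc' h' with ⟨t', rfl, ht'⟩ | ⟨i, j, l, m, ξ, s, hq, ha, hs, rfl, hg⟩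
    · rw [hv.eq_of_two_vertices_active hκ hp hpv ht ht']
    · exact (hv.eq_of_gap_eq_zero hκ hq hp hpv ha hs hg hc h).symm
  · exact hv.eq_of_gap_eq_zero hκ hq hp hpv ha hs hg hc' h'

lemma onArc_of_dist_arcPt_opp (hv : RegularSimplex v) (h : Quad i j l m) (hkk : k * k' = 8)
    (ha : OnArc k ξ s) (hs' : 0 ≤ s') (hle : k' * s' ≤ 2)
    (hd : dist (arcPt v i j l m ξ s) (arcPt v l m i j ξ' s') = 2 - k * s - k' * s') :
    OnArc k' ξ' s' := by
  have hsq := hv.dist_arcPt_opp_sq h hkk ha ξ' s'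
  rw [hd, sub_self] at hsq
  exact ⟨hs', hle, by linarith⟩

/-- In barycentric coordinates tangency says that the line from `p` to the centre of the pea meets
the plane of the opposite pod in a point of the height given below. -/
lemma exists_eq_add_smul_of_tangent (hv : RegularSimplex v) (h : Quad i j l m) (hk : 0 < k)
    (hs : 0 ≤ s) (hle : 0 ≤ 2 - k * s) (hsum : bary v i p + bary v j p ≤ 0)
    (htan : (bary v i p - bary v j p) * (4 + 8 * s + k * (2 - k * s)) =
      4 * (bary v i p + bary v j p) * ξ) :
    ∃ μ ξ' s', 0 ≤ μ ∧ 8 * (1 + μ) * s' = μ * k * (2 - k * s) ∧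
      p = arcPt v l m i j ξ' s' + μ • (arcPt v l m i j ξ' s' - arcPt v i j l m ξ s) := by
  set D := 4 + 8 * s + k * (2 - k * s) with hD
  have hDpos : 0 < D := by linarith [mul_nonneg hk.le hle]
  set μ := -(4 * (bary v i p + bary v j p)) / D with hμ
  have hμ0 : 0 ≤ μ := div_nonneg (by linarith) hDpos.le
  have hμ1 : 1 + μ ≠ 0 := by linarith
  have hμD : μ * D = -(4 * (bary v i p + bary v j p)) := div_mul_cancel₀ _ hDpos.ne'
  have hdiff : bary v i p - bary v j p = -(μ * ξ) := by
    apply mul_right_cancel₀ hDpos.ne'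
    rw [htan]
    linear_combination ξ * hμD
  obtain ⟨s', hs'⟩ : ∃ s', (1 + μ) * s' = μ * k * (2 - k * s) / 8 :=
    ⟨_, mul_div_cancel₀ _ hμ1⟩
  obtain ⟨ξ', hξ'⟩ : ∃ ξ', (1 + μ) * ξ' = bary v l p - bary v m p := ⟨_, mul_div_cancel₀ _ hμ1⟩
  obtain ⟨hi, hj, hl, hm⟩ := hv.bary_arcPt h ξ s
  obtain ⟨hl', hm', hi', hj'⟩ := hv.bary_arcPt h.opp ξ' s'
  have hone := h.sum_bary (v := v) p
  rw [hD] at hμD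
  refine ⟨μ, ξ', s', hμ0, by linarith, hv.bary_ext fun t => ?_⟩
  rw [bary_add_smul_sub]
  rcases h.cases t with rfl | rfl | rfl | rfl
  · rw [hi', hi]; linear_combination hs' + hdiff / 2 + hμD / 8
  · rw [hj', hj]; linear_combination hs' - hdiff / 2 + hμD / 8
  · rw [hl', hl]; linear_combination -hξ' / 2 - hs' + hone / 2 - hμD / 8
  · rw [hm', hm]; linear_combination hξ' / 2 - hs' + hone / 2 - hμD / 8

lemma eq_tip_of_tangent (hv : RegularSimplex v) (hκ : Weights κ) (h : Quad i j l m)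
    (ha : OnArc (κ i j) ξ s) (hsum : bary v i p + bary v j p ≤ 0)
    (hg : gap (quadForm v p) (bary v i p) (bary v j p) ξ s = 0)
    (htan : (bary v i p - bary v j p) * (4 + 8 * s + κ i j * (2 - κ i j * s)) =
      4 * (bary v i p + bary v j p) * ξ) :
    ∃ ξ' s', OnArc (κ l m) ξ' s' ∧
      p = tip (arcPt v l m i j ξ' s') (arcPt v i j l m ξ s) (κ l m * s') := by
  have hk := hκ.pos i j h.1
  have hkk := hκ.prod _ _ _ _ h
  obtain ⟨μ, ξ', s', hμ, hs', hp⟩ := hv.exists_eq_add_smul_of_tangent h hk ha.nonneg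
    (sub_nonneg.2 ha.mul_le) hsum htan
  set x := arcPt v i j l m ξ s
  set y := arcPt v l m i j ξ' s'
  have hμ1 : 0 < 1 + μ := by linarith
  have hN : 0 < 2 - κ i j * s := by linarith [ha.eight_mul_le hk, ha.nonneg]
  have hks' : (1 + μ) * (κ l m * s') = μ * (2 - κ i j * s) := by
    linear_combination κ l m / 8 * hs' + μ * (2 - κ i j * s) / 8 * hkk
  have hpx : dist p x = 2 - κ i j * s := eq_sub_of_add_eq ((hv.dist_arcPt_add_eq h ha p).2 hg)
  have hyx : (1 + μ) * dist y x = 2 - κ i j * s := by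
    rw [← hpx, hp, dist_eq_norm (y + _), show y + μ • (y - x) - x = (1 + μ) • (y - x) by module,
      norm_smul, Real.norm_of_nonneg hμ1.le, dist_eq_norm]
  have hyx_pos : 0 < dist y x := pos_of_mul_pos_right (hyx.symm ▸ hN) hμ1.le
  have hks'_eq : κ l m * s' = μ * dist y x := by
    apply mul_left_cancel₀ hμ1.ne'
    linear_combination hks' - μ * hyx
  refine ⟨ξ', s', hv.onArc_of_dist_arcPt_opp h hkk ha ?_ ?_ ?_, ?_⟩
  · exact nonneg_of_mul_nonneg_right
      (hs'.symm ▸ mul_nonneg (mul_nonneg hμ hk.le) hN.le) (by linarith)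
  · linarith [mul_nonneg hk.le ha.nonneg]
  · rw [dist_comm]; linarith
  · rw [tip, hks'_eq, mul_div_cancel_right₀ _ hyx_pos.ne', ← hp]

lemma eq_tip_of_active (hv : RegularSimplex v) (hκ : Weights κ) (h : Quad i j l m)
    (hp : p ∈ peaBody v κ) (hpv : p ∉ range v) (ha : OnArc (κ i j) ξ s) (hs : 0 < s)
    (hg : gap (quadForm v p) (bary v i p) (bary v j p) ξ s = 0) :
    ∃ ξ' s', OnArc (κ l m) ξ' s' ∧
      p = tip (arcPt v l m i j ξ' s') (arcPt v i j l m ξ s) (κ l m * s') := by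
  have hw := hv.inWedge_of_gap_eq_zero hκ h.1 (hv.inReuleaux_of_mem_peaBody hp) hpv ha hs hg
  obtain ⟨hi, hj⟩ := hw.neg hκ h.1
  exact hv.eq_tip_of_tangent hκ h ha (by linarith) hg
    (ha.tangent_of_gap_eq_zero (hκ.pos i j h.1) hs (hv.mem_peaBody_iff.1 hp i j h.1) hg)

end RegularSimplex

end ActivePeas

/-! ### Constant width -/

section ConstantWidth

variable {v : Fin 4 → E3} {κ : Fin 4 → Fin 4 → ℝ} {i j l m t t' : Fin 4} {ξ s ξ' s' d : ℝ}
  {p q u : E3} {c : E3 × ℝ}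

lemma snd_le_of_mem_peas (hκ : Weights κ) (hc : c ∈ peas v κ) : c.2 ≤ 1 / 2 := by
  obtain ⟨i, j, l, m, ξ, s, hq, ha, rfl⟩ := hc
  have hs := ha.eight_mul_le (hκ.pos i j hq.1)
  change κ i j * s ≤ 1 / 2
  linarith [ha.nonneg]

lemma ne_fst_of_active (hκ : Weights κ) (hc : c ∈ peas v κ) (h : dist p c.1 + c.2 = 2) :
    p ≠ c.1 := by
  rintro rfl
  rw [dist_self] at h
  linarith [snd_le_of_mem_peas hκ hc]

lemma mem_frontier_peaBody_iff (hκ : Weights κ) :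
    p ∈ frontier (peaBody v κ) ↔ p ∈ peaBody v κ ∧ ∃ c ∈ peas v κ, dist p c.1 + c.2 = 2 := by
  constructor
  · intro h
    have hp : p ∈ peaBody v κ := (isClosed_ballIntersection _ _).frontier_subset h
    refine ⟨hp, ?_⟩
    by_contra! hne
    exact h.2 (mem_interior_ballIntersection (isCompact_peas hκ) fun c hc =>
      (mem_ballIntersection.1 hp c hc).lt_of_ne (hne c hc))
  · rintro ⟨hp, c, hc, h⟩
    exact ⟨subset_closure hp, notMem_interior_of_mem_outerNormals
      (sub_ne_zero.2 (ne_fst_of_active hκ hc h)) (sub_mem_outerNormals_ballIntersection hc h)⟩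

lemma exists_active_of_mem_outerNormals (hκ : Weights κ) (hp : p ∈ peaBody v κ) (hu : u ≠ 0)
    (hN : u ∈ outerNormals (peaBody v κ) p) : ∃ c ∈ peas v κ, dist p c.1 + c.2 = 2 :=
  ((mem_frontier_peaBody_iff hκ).1
    ⟨subset_closure hp, notMem_interior_of_mem_outerNormals hu hN⟩).2

lemma le_of_sub_eq_smul_of_mem_outerNormals {E : Type*} [NormedAddCommGroup E]
    [InnerProductSpace ℝ E] {K : Set E} {p q q' u : E} {d w : ℝ} (hu : ‖u‖ = 1)
    (hpq : p - q = d • u) (hN : -u ∈ outerNormals K q) (hq' : q' ∈ K) (hpq' : p - q' = w • u) :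
    w ≤ d := by
  have hqq' : q' - q = (d - w) • u := by
    rw [sub_smul, ← hpq, ← hpq']; abel
  have hle := hN q' hq'
  rw [hqq', inner_neg_left, inner_smul_right, real_inner_self_eq_norm_sq, hu] at hle
  linarith

namespace RegularSimplex

lemma eq_normalize_of_mem_outerNormals (hv : RegularSimplex v) (hκ : Weights κ)
    (hp : p ∈ peaBody v κ) (hpv : p ∉ range v) (hc : c ∈ peas v κ) (h : dist p c.1 + c.2 = 2)
    (hu : ‖u‖ = 1) (hN : u ∈ outerNormals (peaBody v κ) p) :
    u = (dist p c.1)⁻¹ • (p - c.1) :=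
  eq_normalize_of_mem_outerNormals_ballIntersection (isCompact_peas hκ) hp
    (ne_fst_of_active hκ hc h) (fun _ hc' h' => hv.active_unique hκ hp hpv hc hc' h h') hu hN

lemma hasUniqueSupportPlane (hv : RegularSimplex v) (hκ : Weights κ)
    (hp : p ∈ frontier (peaBody v κ)) (hpv : p ∉ range v) :
    HasUniqueSupportPlane (peaBody v κ) p := by
  obtain ⟨hpK, c, hc, h⟩ := (mem_frontier_peaBody_iff hκ).1 hp
  have hpc : p - c.1 ≠ 0 := sub_ne_zero.2 (ne_fst_of_active hκ hc h)
  refine ⟨(dist p c.1)⁻¹ • (p - c.1), ⟨?_, ?_⟩,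
    fun u hu => hv.eq_normalize_of_mem_outerNormals hκ hpK hpv hc h hu.1 hu.2⟩
  · rw [dist_eq_norm]
    exact norm_smul_inv_norm (𝕜 := ℝ) hpc
  · exact smul_mem_outerNormals (inv_nonneg.2 dist_nonneg)
      (sub_mem_outerNormals_ballIntersection hc h)

lemma dist_tip_le_of_mem_peaBody (hv : RegularSimplex v) (hκ : Weights κ) (h : Quad i j l m)
    (ha : OnArc (κ i j) ξ s) (ha' : OnArc (κ l m) ξ' s') (hq : q ∈ peaBody v κ) :
    dist (tip (arcPt v i j l m ξ s) (arcPt v l m i j ξ' s') (κ i j * s)) q ≤ 2 := by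
  have hR : 0 ≤ κ i j * s := mul_nonneg (hκ.pos i j h.1).le ha.nonneg
  have hleft := dist_tip_left (hv.arcPt_ne_arcPt_opp h hκ ha ha') hR
  have hle := (hv.dist_arcPt_add_le h ha q).2 (hv.mem_peaBody_iff.1 hq i j h.1 ξ s ha)
  rw [dist_comm] at hle
  linarith [dist_triangle (tip (arcPt v i j l m ξ s) (arcPt v l m i j ξ' s') (κ i j * s))
    (arcPt v i j l m ξ s) q]

lemma dist_tip_arcPt_opp (hv : RegularSimplex v) (hκ : Weights κ) (h : Quad i j l m)
    (ha : OnArc (κ i j) ξ s) (ha' : OnArc (κ l m) ξ' s') :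
    dist (tip (arcPt v i j l m ξ s) (arcPt v l m i j ξ' s') (κ i j * s))
      (arcPt v l m i j ξ' s') + κ l m * s' = 2 := by
  rw [dist_tip_right (hv.arcPt_ne_arcPt_opp h hκ ha ha')
    (mul_nonneg (hκ.pos i j h.1).le ha.nonneg), hv.dist_arcPt_opp h hκ ha ha']
  ring

lemma sub_eq_two_smul_of_mem_outerNormals (hv : RegularSimplex v) (hκ : Weights κ)
    (hp : p ∈ peaBody v κ) (hpv : p ∉ range v) (hu : ‖u‖ = 1)
    (hN : u ∈ outerNormals (peaBody v κ) p) :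
    (∃ t, p - v t = (2 : ℝ) • u) ∨
    ((∃ q ∈ peaBody v κ, p - q = (2 : ℝ) • u) ∧ ∀ q ∈ peaBody v κ, dist p q ≤ 2) := by
  obtain ⟨c, hc, h⟩ :=
    exists_active_of_mem_outerNormals hκ hp (norm_ne_zero_iff.1 (hu.symm ▸ one_ne_zero)) hN
  have hu' := hv.eq_normalize_of_mem_outerNormals hκ hp hpv hc h hu hN
  rcases hv.active_cases hc h with ⟨t, rfl, -⟩ | ⟨i, j, l, m, ξ, s, hq, ha, hs, rfl, hg⟩
  · rw [add_zero] at h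
    rw [h] at hu'
    exact .inl ⟨t, by rw [hu', smul_inv_smul₀ two_ne_zero]⟩
  · right
    obtain ⟨ξ', s', ha', rfl⟩ := hv.eq_tip_of_active hκ hq hp hpv ha hs hg
    have hne := hv.arcPt_ne_arcPt_opp hq.opp hκ ha' ha
    have hR : 0 ≤ κ l m * s' := mul_nonneg (hκ.pos l m hq.opp.1).le ha'.nonneg
    refine ⟨⟨_, hv.tip_mem_peaBody hκ hq ha ha', ?_⟩,
      fun q hqK => hv.dist_tip_le_of_mem_peaBody hκ hq.opp ha' ha hqK⟩
    have htwo :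
        dist (arcPt v l m i j ξ' s') (arcPt v i j l m ξ s) + κ l m * s' + κ i j * s = 2 := by
      rw [hv.dist_arcPt_opp hq.opp hκ ha' ha]; ring
    rw [tip_sub_tip hne, htwo, hu', inv_dist_smul_tip_sub hne hR]

lemma dist_vertex_le_two (hv : RegularSimplex v) (hp : p ∈ peaBody v κ) (t : Fin 4) :
    dist p (v t) ≤ 2 := (hv.dist_vertex_le p t).2 (hv.inReuleaux_of_mem_peaBody hp t)

lemma two_le_of_doubleNormal_of_notMem (hv : RegularSimplex v) (hκ : Weights κ)
    (hp : p ∈ peaBody v κ) (hpv : p ∉ range v) (hu : ‖u‖ = 1) (hpq : p - q = d • u)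
    (hNp : u ∈ outerNormals (peaBody v κ) p) (hNq : -u ∈ outerNormals (peaBody v κ) q) :
    2 ≤ d := by
  rcases hv.sub_eq_two_smul_of_mem_outerNormals hκ hp hpv hu hNp with
    ⟨t, ht⟩ | ⟨⟨q', hq', hpq'⟩, -⟩
  · exact le_of_sub_eq_smul_of_mem_outerNormals hu hpq hNq (hv.vertex_mem_peaBody hκ t) ht
  · exact le_of_sub_eq_smul_of_mem_outerNormals hu hpq hNq hq' hpq'

lemma not_antipodal_about_vertex (hv : RegularSimplex v) (hp : p ∈ peaBody v κ)
    (hq : q ∈ peaBody v κ) (hu : ‖u‖ = 1) (hpt : p - v t = (2 : ℝ) • u)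
    (hqt : q - v t = -((2 : ℝ) • u)) : False := by
  obtain ⟨r, hr⟩ : ∃ r, t ≠ r := by clear * -; revert t; decide
  have hpr := hv.dist_vertex_le_two hp r
  have hqr := hv.dist_vertex_le_two hq r
  have htr := hv hr
  rw [dist_eq_norm] at hpr hqr htr
  rw [show p - v r = (v t - v r) + (2 : ℝ) • u by rw [← hpt]; abel] at hpr
  rw [show q - v r = (v t - v r) - (2 : ℝ) • u by
    rw [sub_eq_add_neg (v t - v r), ← hqt]; abel] at hqr
  have hpar := parallelogram_law_with_norm ℝ (v t - v r) ((2 : ℝ) • u)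
  rw [htr, norm_smul, hu, Real.norm_ofNat] at hpar
  nlinarith [mul_self_le_mul_self (norm_nonneg _) hpr, mul_self_le_mul_self (norm_nonneg _) hqr]

lemma eq_two_of_sub_vertex_eq (hv : RegularSimplex v) (hp : p ∈ peaBody v κ)
    (hq : q ∈ peaBody v κ) (hu : ‖u‖ = 1) (hpq : p - q = d • u) (hpt : p - v t = (2 : ℝ) • u)
    (hqt : q - v t' = -((2 : ℝ) • u)) : d = 2 := by
  have htt' : v t - v t' = (d - 4) • u := by
    rw [show v t - v t' = (p - q) - (p - v t) + (q - v t') by abel, hpq, hpt, hqt]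
    module
  have hd : |d - 2| ≤ 2 := by
    have hle := hv.dist_vertex_le_two hp t'
    have hpt' : p - v t' = (d - 2) • u := by
      rw [show p - v t' = (p - q) + (q - v t') by abel, hpq, hqt]
      module
    rwa [dist_eq_norm, hpt', norm_smul, hu, mul_one] at hle
  rcases eq_or_ne t t' with rfl | hne
  · exact (hv.not_antipodal_about_vertex hp hq hu hpt hqt).elim
  · have h4 : |d - 4| = 2 := by
      have hdist : dist (v t) (v t') = 2 := hv hne
      rwa [dist_eq_norm, htt', norm_smul, hu, mul_one] at hdist
    rw [abs_of_nonpos (by linarith [(abs_le.1 hd).2])] at h4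
    linarith

lemma dist_le_two_or_sub_vertex_eq (hv : RegularSimplex v) (hκ : Weights κ)
    (hp : p ∈ peaBody v κ) (hq : q ∈ peaBody v κ) (hu : ‖u‖ = 1)
    (hN : u ∈ outerNormals (peaBody v κ) p) :
    dist p q ≤ 2 ∨ ∃ t, p - v t = (2 : ℝ) • u := by
  by_cases hpv : p ∈ range v
  · obtain ⟨t, rfl⟩ := hpv
    exact .inl (dist_comm q (v t) ▸ hv.dist_vertex_le_two hq t)
  · exact (hv.sub_eq_two_smul_of_mem_outerNormals hκ hp hpv hu hN).symm.imp_left fun h => h.2 q hq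

lemma eq_two_of_doubleNormal (hv : RegularSimplex v) (hκ : Weights κ) (hp : p ∈ peaBody v κ)
    (hq : q ∈ peaBody v κ) (hu : ‖u‖ = 1) (hd : 0 < d) (hpq : p - q = d • u)
    (hNp : u ∈ outerNormals (peaBody v κ) p) (hNq : -u ∈ outerNormals (peaBody v κ) q) :
    d = 2 := by
  have hu' : ‖-u‖ = 1 := by rw [norm_neg, hu]
  have hdist : dist p q = d := by
    rw [dist_eq_norm, hpq, norm_smul, hu, mul_one, Real.norm_of_nonneg hd.le]
  have hge : 2 ≤ d := by
    by_cases hpv : p ∈ range v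
    · by_cases hqv : q ∈ range v
      · obtain ⟨⟨t, rfl⟩, t', rfl⟩ := And.intro hpv hqv
        have hne : t ≠ t' := fun h => hd.ne (by rw [← hdist, h, dist_self])
        rw [← hdist, hv hne]
      · refine hv.two_le_of_doubleNormal_of_notMem hκ hq hqv hu' ?_ hNq ((neg_neg u).symm ▸ hNp)
        rw [smul_neg, ← hpq, neg_sub]
    · exact hv.two_le_of_doubleNormal_of_notMem hκ hp hpv hu hpq hNp hNq
  rcases hv.dist_le_two_or_sub_vertex_eq hκ hp hq hu hNp with h | ⟨t, ht⟩
  · linarith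
  rcases hv.dist_le_two_or_sub_vertex_eq hκ hq hp hu' hNq with h | ⟨t', ht'⟩
  · linarith [dist_comm p q]
  exact hv.eq_two_of_sub_vertex_eq hp hq hu hpq ht (by rw [ht', smul_neg])

theorem hasConstantWidth (hv : RegularSimplex v) (hκ : Weights κ) :
    HasConstantWidth (peaBody v κ) 2 := by
  refine hasConstantWidth_of_sub_self_eq_closedBall zero_le_two
    (sub_self_eq_closedBall_of_doubleNormals hv.isCompact_peaBody (convex_ballIntersection _ _)
      (hv.interior_peaBody_nonempty hκ) fun p hp q hq hpq hNp hNq => ?_)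
  have hd := dist_pos.2 hpq
  have hinv := inv_nonneg.2 hd.le
  refine hv.eq_two_of_doubleNormal hκ hp hq (u := (dist p q)⁻¹ • (p - q)) ?_ hd
    (smul_inv_smul₀ hd.ne' _).symm (smul_mem_outerNormals hinv hNp) ?_
  · rw [dist_eq_norm]
    exact norm_smul_inv_norm (𝕜 := ℝ) (sub_ne_zero.2 hpq)
  · rw [← smul_neg, neg_sub]
    exact smul_mem_outerNormals hinv hNq

end RegularSimplex

end ConstantWidth

/-! ### Caps and vertices -/

section Caps

variable {v : Fin 4 → E3} {κ : Fin 4 → Fin 4 → ℝ} {i j l m r t : Fin 4} {k ξ s ξ' s' h τ τ₀ δ : ℝ}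
  {p u x : E3}

/-- The union of the boundary curves of the three wedge surfaces that touch the sphere about the
vertex `i`; for a regular simplex these curves lie on the sphere. -/
def gammaSet (v : Fin 4 → E3) (κ : Fin 4 → Fin 4 → ℝ) (i : Fin 4) : Set E3 :=
  {p | ∃ j l m ξ s, Quad i j l m ∧ OnArc (κ l m) ξ s ∧
    p = tip (arcPt v l m i j ξ s) (v i) (κ l m * s)}

lemma vertex_mem_gammaSet (hil : i ≠ l) : v l ∈ gammaSet v κ i := by
  obtain ⟨j, m, hq⟩ := exists_quad hil
  exact ⟨j, l, m, 1, 0, hq.swap_middle, OnArc.one_zero _,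
    by rw [arcPt_one_zero, mul_zero, tip_zero]⟩

lemma continuous_quadForm (v : Fin 4 → E3) : Continuous (quadForm v) := by
  unfold quadForm
  exact (continuous_finsetSum _ fun i _ => (continuous_bary v i).pow 2).sub continuous_const

lemma isClosed_setOf_inReuleaux (v : Fin 4 → E3) : IsClosed {z | InReuleaux v z} := by
  simp only [InReuleaux, ofPred_forall]
  exact isClosed_iInter fun t =>
    isClosed_le (continuous_quadForm v) (continuous_const.mul (continuous_bary v t))

/-- The point whose barycentric coordinates have the sum `h` and the difference `τ` on the edge
`i, j`, and the difference `δ` on the edge `l, m`. -/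
def pairPt (v : Fin 4 → E3) (i j l m : Fin 4) (h τ δ : ℝ) : E3 :=
  ((h + τ) / 2) • v i + ((h - τ) / 2) • v j + ((1 - h + δ) / 2) • v l + ((1 - h - δ) / 2) • v m

/-- On the sphere about the first vertex the coordinate `h` of a `pairPt` is a function of `τ` and
`δ`; it does not increase when `τ` grows up to `1`, so that one stays in the wedge until `τ`
becomes positive. -/
lemma exists_wedge_curve (hk : 0 < k) (hS : 2 * (1 - h) ^ 2 = 3 + 2 * τ₀ - τ₀ ^ 2 - δ ^ 2)
    (hτ₀ : τ₀ ≤ 0) (hw : (2 + k) * |τ₀| < -(2 * h)) :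
    ∃ (g : ℝ → ℝ) (ε : ℝ), Continuous g ∧ g τ₀ = h ∧ 0 < ε ∧ ∀ τ ∈ Icc τ₀ ε,
      2 * (1 - g τ) ^ 2 = 3 + 2 * τ - τ ^ 2 - δ ^ 2 ∧ (2 + k) * |τ| < -(2 * g τ) := by
  have hh : h < 0 := by linarith [show 0 ≤ (2 + k) * |τ₀| by positivity]
  set ε := -h / (2 + k)
  have hε : 0 < ε := div_pos (by linarith) (by linarith)
  have hεk : (2 + k) * ε = -h := mul_div_cancel₀ _ (by linarith)
  have hε1 : ε ≤ 1 := by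
    have : -h ≤ 1 := by nlinarith [sq_nonneg τ₀, sq_nonneg δ, sq_nonneg h]
    nlinarith
  refine ⟨fun τ => 1 - √((3 + 2 * τ - τ ^ 2 - δ ^ 2) / 2), ε, by fun_prop, ?_, hε,
    fun τ ⟨hτ, hτε⟩ => ?_⟩
  · beta_reduce
    rw [← hS, mul_div_cancel_left₀ _ two_ne_zero, Real.sqrt_sq (by linarith)]
    ring
  have hrad : (1 - h) ^ 2 ≤ (3 + 2 * τ - τ ^ 2 - δ ^ 2) / 2 := by
    nlinarith [mul_nonneg (sub_nonneg.2 hτ) (show 0 ≤ 2 - τ - τ₀ by linarith)]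
  have hsqrt := Real.le_sqrt_of_sq_le hrad
  refine ⟨by rw [sub_sub_cancel, Real.sq_sqrt ((sq_nonneg _).trans hrad)]; ring, ?_⟩
  suffices (2 + k) * |τ| < -(2 * h) by linarith
  rcases le_total 0 τ with h0 | h0
  · rw [abs_of_nonneg h0]
    linarith [mul_le_mul_of_nonneg_left hτε (show 0 ≤ 2 + k by linarith)]
  · refine (mul_le_mul_of_nonneg_left ?_ (show 0 ≤ 2 + k by linarith)).trans_lt hw
    rw [abs_of_nonpos h0, abs_of_nonpos hτ₀]
    linarith

namespace RegularSimplex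

lemma bary_pairPt (hv : RegularSimplex v) (hq : Quad i j l m) (h τ δ : ℝ) :
    bary v i (pairPt v i j l m h τ δ) = (h + τ) / 2 ∧
    bary v j (pairPt v i j l m h τ δ) = (h - τ) / 2 ∧
    bary v l (pairPt v i j l m h τ δ) = (1 - h + δ) / 2 ∧
    bary v m (pairPt v i j l m h τ δ) = (1 - h - δ) / 2 :=
  hv.bary_quad hq (by ring)

lemma pairPt_bary (hv : RegularSimplex v) (hq : Quad i j l m) (p : E3) :
    pairPt v i j l m (bary v i p + bary v j p) (bary v i p - bary v j p)
      (bary v l p - bary v m p) = p := by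
  obtain ⟨hi, hj, hl, hm⟩ := hv.bary_pairPt hq (bary v i p + bary v j p)
    (bary v i p - bary v j p) (bary v l p - bary v m p)
  have hsum := hq.sum_bary (v := v) p
  refine hv.bary_ext fun t => ?_
  rcases hq.cases t with rfl | rfl | rfl | rfl
  · rw [hi]; ring
  · rw [hj]; ring
  · rw [hl]; linear_combination hsum / -2
  · rw [hm]; linear_combination hsum / -2

lemma quadForm_pairPt_eq_iff (hv : RegularSimplex v) (hq : Quad i j l m) :
    quadForm v (pairPt v i j l m h τ δ) = 2 * bary v i (pairPt v i j l m h τ δ) ↔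
      2 * (1 - h) ^ 2 = 3 + 2 * τ - τ ^ 2 - δ ^ 2 := by
  obtain ⟨hi, hj, hl, hm⟩ := hv.bary_pairPt hq h τ δ
  rw [hq.quadForm_eq, hi, hj, hl, hm]
  constructor <;> intro heq
  · linear_combination 2 * heq
  · linear_combination heq / 2

lemma inWedge_pairPt_iff (hv : RegularSimplex v) (hq : Quad i j l m) :
    InWedge v κ (pairPt v i j l m h τ δ) i j ↔ (2 + κ i j) * |τ| < -(2 * h) := by
  obtain ⟨hi, hj, -⟩ := hv.bary_pairPt hq h τ δ
  rw [InWedge, hi, hj, show (h + τ) / 2 - (h - τ) / 2 = τ by ring,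
    show (h + τ) / 2 + (h - τ) / 2 = h by ring]

lemma exists_wedge_path (hv : RegularSimplex v) (hκ : Weights κ) (hq : Quad i j l m)
    (hS : quadForm v p = 2 * bary v i p) (hT : InReuleaux v p) (hw : InWedge v κ p i j) :
    ∃ P : Set E3, IsPreconnected P ∧ p ∈ P ∧
      (∀ z ∈ P, quadForm v z = 2 * bary v i z ∧ InWedge v κ z i j) ∧
      ∃ z ∈ P, ¬ InReuleaux v z := by
  set h := bary v i p + bary v j p
  set τ₀ := bary v i p - bary v j p
  set δ := bary v l p - bary v m p
  have hp : pairPt v i j l m h τ₀ δ = p := hv.pairPt_bary hq p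
  have hτ₀ : τ₀ ≤ 0 := sub_nonpos.2 (by linarith [hT j])
  rw [← hp] at hS hw
  obtain ⟨g, ε, hg, hgτ₀, hε, hcurve⟩ := exists_wedge_curve (hκ.pos i j hq.1)
    ((hv.quadForm_pairPt_eq_iff hq).1 hS) hτ₀ ((hv.inWedge_pairPt_iff hq).1 hw)
  set γ : ℝ → E3 := fun τ => pairPt v i j l m (g τ) τ δ
  have hγ : Continuous γ := by unfold γ pairPt; fun_prop
  have hsphere : ∀ τ ∈ Icc τ₀ ε, quadForm v (γ τ) = 2 * bary v i (γ τ) := fun τ hτ =>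
    (hv.quadForm_pairPt_eq_iff hq).2 (hcurve τ hτ).1
  have hεmem : ε ∈ Icc τ₀ ε := right_mem_Icc.2 (hτ₀.trans hε.le)
  refine ⟨γ '' Icc τ₀ ε, isPreconnected_Icc.image _ hγ.continuousOn,
    ⟨τ₀, left_mem_Icc.2 (hτ₀.trans hε.le), by simp only [γ, hgτ₀, hp]⟩, ?_,
    γ ε, mem_image_of_mem γ hεmem, fun hT' => ?_⟩
  · rintro _ ⟨τ, hτ, rfl⟩
    exact ⟨hsphere τ hτ, (hv.inWedge_pairPt_iff hq).2 (hcurve τ hτ).2⟩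
  · have hle := hT' j
    obtain ⟨hi, hj, -⟩ := hv.bary_pairPt hq (g ε) ε δ
    rw [hsphere ε hεmem, hi, hj] at hle
    linarith

lemma gammaSet_subset (hv : RegularSimplex v) (hκ : Weights κ) (i : Fin 4) :
    gammaSet v κ i ⊆ sphere (v i) 2 ∩ peaBody v κ := by
  rintro p ⟨j, l, m, ξ, s, hq, ha, rfl⟩
  have hdist := hv.dist_tip_arcPt_opp hκ hq.opp ha (OnArc.one_zero (κ i j))
  have hmem := hv.tip_mem_peaBody hκ hq.opp ha (OnArc.one_zero (κ i j))
  rw [arcPt_one_zero] at hdist hmem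
  rw [mul_zero, add_zero] at hdist
  exact ⟨hdist, hmem⟩

lemma notMem_peaBody_of_inWedge (hv : RegularSimplex v) (hκ : Weights κ) (hij : i ≠ j)
    (hS : quadForm v p = 2 * bary v i p) (hw : InWedge v κ p i j) : p ∉ peaBody v κ := by
  intro hp
  have hT := hv.inReuleaux_of_mem_peaBody hp j
  obtain ⟨ξ, s, ha, hg⟩ :=
    OnArc.exists_gap_pos_of_wedge (hκ.pos i j hij) hS (by linarith) hw
  exact hg.not_ge (hv.mem_peaBody_iff.1 hp i j hij ξ s ha)

lemma mem_peaBody_of_not_inWedge (hv : RegularSimplex v) (hκ : Weights κ)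
    (hS : quadForm v p = 2 * bary v i p) (hT : InReuleaux v p)
    (hw : ∀ j, i ≠ j → ¬ InWedge v κ p i j) : p ∈ peaBody v κ := by
  refine hv.mem_peaBody_iff.2 fun a b hab => ?_
  rcases eq_or_ne i a with rfl | ha
  · exact arcOK_of_not_inWedge hκ hab hT (hw b hab)
  rcases eq_or_ne i b with rfl | hb
  · exact (arcOK_of_not_inWedge hκ hab.symm hT (hw a hab.symm)).symm hκ
  refine arcOK_of_not_inWedge hκ hab hT fun hwab => ?_
  obtain ⟨ha0, hb0⟩ := hwab.neg hκ hab
  obtain ⟨m, hm⟩ : ∃ m, Quad a b i m := by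
    clear * - hab ha hb; revert a b i; decide
  obtain rfl := hv.eq_vertex_of_bary_nonpos hm hT ha0.le hb0.le (by linarith [hT a])
  exact ha0.not_ge (hv.bary_vertex_nonneg a m)

lemma mem_gammaSet_of_wedge_eq (hv : RegularSimplex v) (hκ : Weights κ) (hij : i ≠ j)
    (hT : InReuleaux v p) (hS : quadForm v p = 2 * bary v i p)
    (hw : (2 + κ i j) * |bary v i p - bary v j p| = -(2 * (bary v i p + bary v j p))) :
    p ∈ gammaSet v κ i := by
  obtain ⟨l, m, hq⟩ := exists_quad hij
  have hnonneg : 0 ≤ (2 + κ i j) * |bary v i p - bary v j p| :=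
    mul_nonneg (by linarith [hκ.pos i j hij]) (abs_nonneg _)
  rw [abs_of_nonpos (by linarith [hT j])] at hw hnonneg
  obtain ⟨ξ, s, ha, hp⟩ := hv.eq_tip_of_tangent hκ hq (OnArc.one_zero (κ i j)) (by linarith)
    (by unfold gap; linarith) (by linarith)
  rw [arcPt_one_zero] at hp
  exact ⟨j, l, m, ξ, s, hq, ha, hp⟩

lemma mem_peaBody_mem_nhds_of_mem_sphere (hv : RegularSimplex v) (hκ : Weights κ)
    (hp : p ∈ peaBody v κ) (hpS : p ∈ sphere (v i) 2) (hpΓ : p ∉ gammaSet v κ i) :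
    {z | z ∈ sphere (v i) 2 → z ∈ peaBody v κ} ∈ 𝓝 p := by
  have hS : quadForm v p = 2 * bary v i p := (hv.dist_vertex_eq p i).1 hpS
  have hT := hv.inReuleaux_of_mem_peaBody hp
  have hpv : p ∉ range v := by
    rintro ⟨t, rfl⟩
    rcases eq_or_ne i t with rfl | h
    · rw [mem_sphere, dist_self] at hpS
      exact two_ne_zero hpS.symm
    · exact hpΓ (vertex_mem_gammaSet h)
  have hReuleaux : ∀ᶠ z in 𝓝 p, ∀ t, i ≠ t → quadForm v z < 2 * bary v t z := by
    refine eventually_all.2 fun t => eventually_imp_distrib_left.2 fun hit => ?_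
    have hlt : quadForm v p < 2 * bary v t p :=
      (hT t).lt_of_ne fun h => hit (hv.eq_of_two_vertices_active hκ hp hpv hS h)
    exact (continuous_quadForm v).continuousAt.eventually_lt
      (continuous_const.mul (continuous_bary v t)).continuousAt hlt
  have hWedge : ∀ᶠ z in 𝓝 p, ∀ t, i ≠ t →
      -(2 * (bary v i z + bary v t z)) < (2 + κ i t) * |bary v i z - bary v t z| := by
    refine eventually_all.2 fun t => eventually_imp_distrib_left.2 fun hit => ?_
    have hlt : -(2 * (bary v i p + bary v t p)) < (2 + κ i t) * |bary v i p - bary v t p| :=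
      (not_lt.1 fun h => hv.notMem_peaBody_of_inWedge hκ hit hS h hp).lt_of_ne
        fun h => hpΓ (hv.mem_gammaSet_of_wedge_eq hκ hit hT hS h.symm)
    exact ContinuousAt.eventually_lt
      (continuous_const.mul ((continuous_bary v i).add (continuous_bary v t))).neg.continuousAt
      (continuous_const.mul ((continuous_bary v i).sub (continuous_bary v t)).abs).continuousAt hlt
  filter_upwards [hReuleaux, hWedge] with z hzT hzw hz
  have hzS : quadForm v z = 2 * bary v i z := (hv.dist_vertex_eq z i).1 hz
  refine hv.mem_peaBody_of_not_inWedge hκ hzS (fun t => ?_) fun t hit => (hzw t hit).not_gt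
  rcases eq_or_ne i t with rfl | hit
  · exact hzS.le
  · exact (hzT t hit).le

lemma cap_subset (hv : RegularSimplex v) (hκ : Weights κ) (i : Fin 4) :
    cap {z | InReuleaux v z} (v i) (gammaSet v κ i) ⊆ sphere (v i) 2 ∩ peaBody v κ := by
  rintro x (hx | ⟨hxA, hcomp⟩)
  · exact hv.gammaSet_subset hκ i hx
  have hinT : ∀ z ∈ connectedComponentIn (sphere (v i) 2 \ gammaSet v κ i) x, InReuleaux v z :=
    fun z hz => (isClosed_setOf_inReuleaux v).frontier_subset (hcomp hz)
  have hxT := hinT x (mem_connectedComponentIn hxA)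
  have hS : quadForm v x = 2 * bary v i x := (hv.dist_vertex_eq x i).1 hxA.1
  refine ⟨hxA.1, hv.mem_peaBody_of_not_inWedge hκ hS hxT fun j hij hw => ?_⟩
  obtain ⟨l, m, hq⟩ := exists_quad hij
  obtain ⟨P, hP, hxP, hPw, z, hzP, hz⟩ := hv.exists_wedge_path hκ hq hS hxT hw
  refine hz (hinT z (hP.subset_connectedComponentIn hxP (fun y hy => ?_) hzP))
  obtain ⟨hyS, hyw⟩ := hPw y hy
  exact ⟨(hv.dist_vertex_eq y i).2 hyS, fun hyΓ =>
    hv.notMem_peaBody_of_inWedge hκ hij hyS hyw (hv.gammaSet_subset hκ i hyΓ).2⟩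

lemma connectedComponentIn_subset_peaBody (hv : RegularSimplex v) (hκ : Weights κ)
    (hx : x ∈ sphere (v i) 2 \ gammaSet v κ i) (hxK : x ∈ peaBody v κ) :
    connectedComponentIn (sphere (v i) 2 \ gammaSet v κ i) x ⊆ peaBody v κ := by
  set C := connectedComponentIn (sphere (v i) 2 \ gammaSet v κ i) x
  have hC : ∀ z ∈ C, z ∈ sphere (v i) 2 \ gammaSet v κ i := connectedComponentIn_subset _ _
  have hnhds : ∀ z ∈ C, z ∈ peaBody v κ →
      z ∈ interior {z | z ∈ sphere (v i) 2 → z ∈ peaBody v κ} := fun z hz hzK =>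
    mem_interior_iff_mem_nhds.2
      (hv.mem_peaBody_mem_nhds_of_mem_sphere hκ hzK (hC z hz).1 (hC z hz).2)
  have hxC : x ∈ C := mem_connectedComponentIn hx
  intro y hy
  by_contra hyK
  obtain ⟨z, hz, hzint, hzK⟩ := isPreconnected_connectedComponentIn
    (interior {z | z ∈ sphere (v i) 2 → z ∈ peaBody v κ}) (peaBody v κ)ᶜ isOpen_interior
    (isClosed_ballIntersection _ _).isOpen_compl
    (fun z hz => (em (z ∈ peaBody v κ)).imp_left (hnhds z hz))
    ⟨x, hxC, hnhds x hxC hxK⟩ ⟨y, hy, hyK⟩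
  exact hzK (interior_subset hzint (hC z hz).1)

lemma mem_frontier_setOf_inReuleaux (hv : RegularSimplex v) (hT : InReuleaux v x)
    (hxS : x ∈ sphere (v i) 2) : x ∈ frontier {z | InReuleaux v z} := by
  refine ⟨subset_closure hT, fun hint => ?_⟩
  have hball : {z | InReuleaux v z} ⊆ closedBall (v i) 2 := fun z hz =>
    (hv.dist_vertex_le z i).2 (hz i)
  have hmem := interior_mono hball hint
  rw [interior_closedBall _ two_ne_zero] at hmem
  exact (mem_ball.1 hmem).ne hxS

theorem cap_eq (hv : RegularSimplex v) (hκ : Weights κ) (i : Fin 4) :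
    cap {z | InReuleaux v z} (v i) (gammaSet v κ i) = sphere (v i) 2 ∩ peaBody v κ := by
  refine (hv.cap_subset hκ i).antisymm fun x ⟨hxS, hxK⟩ => ?_
  by_cases hxΓ : x ∈ gammaSet v κ i
  · exact .inl hxΓ
  · exact .inr ⟨⟨hxS, hxΓ⟩, fun y hy => hv.mem_frontier_setOf_inReuleaux
      (hv.inReuleaux_of_mem_peaBody (hv.connectedComponentIn_subset_peaBody hκ ⟨hxS, hxΓ⟩ hxK hy))
      (connectedComponentIn_subset _ _ hy).1⟩

lemma tip_mem_frontier (hv : RegularSimplex v) (hκ : Weights κ) (hq : Quad i j l m)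
    (ha : OnArc (κ i j) ξ s) (ha' : OnArc (κ l m) ξ' s') :
    tip (arcPt v i j l m ξ s) (arcPt v l m i j ξ' s') (κ i j * s) ∈ frontier (peaBody v κ) :=
  (mem_frontier_peaBody_iff hκ).2 ⟨hv.tip_mem_peaBody hκ hq ha ha', _,
    ⟨l, m, i, j, ξ', s', hq.opp, ha', rfl⟩, hv.dist_tip_arcPt_opp hκ hq ha ha'⟩

lemma mem_frontier_of_mem_sphere (hκ : Weights κ) (hpS : p ∈ sphere (v i) 2)
    (hp : p ∈ peaBody v κ) : p ∈ frontier (peaBody v κ) := by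
  obtain ⟨j, hj⟩ := exists_ne i
  obtain ⟨l, m, hq⟩ := exists_quad hj.symm
  refine (mem_frontier_peaBody_iff hκ).2
    ⟨hp, _, ⟨i, j, l, m, 1, 0, hq, OnArc.one_zero _, rfl⟩, ?_⟩
  rw [arcPt_one_zero, mul_zero, add_zero]
  exact hpS

lemma exists_mem_sphere_of_mem_range (hv : RegularSimplex v) (hp : p ∈ range v) :
    ∃ i, p ∈ sphere (v i) 2 := by
  obtain ⟨t, rfl⟩ := hp
  obtain ⟨r, hr⟩ := exists_ne t
  exact ⟨r, hv hr.symm⟩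

theorem mem_frontier_iff (hv : RegularSimplex v) (hκ : Weights κ) :
    p ∈ frontier (peaBody v κ) ↔
      (∃ i j l m ξ s ξ' s', Quad i j l m ∧ OnArc (κ i j) ξ s ∧ OnArc (κ l m) ξ' s' ∧
        p = tip (arcPt v i j l m ξ s) (arcPt v l m i j ξ' s') (κ i j * s)) ∨
      ∃ i, p ∈ sphere (v i) 2 ∩ peaBody v κ := by
  constructor
  · intro hpF
    obtain ⟨hp, c, hc, h⟩ := (mem_frontier_peaBody_iff hκ).1 hpF
    by_cases hpv : p ∈ range v
    · exact .inr ((hv.exists_mem_sphere_of_mem_range hpv).imp fun _ h => ⟨h, hp⟩)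
    rcases hv.active_cases hc h with ⟨t, rfl, ht⟩ | ⟨i, j, l, m, ξ, s, hq, ha, hs, rfl, hg⟩
    · exact .inr ⟨t, (hv.dist_vertex_eq p t).2 ht, hp⟩
    · obtain ⟨ξ', s', ha', hpt⟩ := hv.eq_tip_of_active hκ hq hp hpv ha hs hg
      exact .inl ⟨l, m, i, j, ξ', s', ξ, s, hq.opp, ha', ha, hpt⟩
  · rintro (⟨i, j, l, m, ξ, s, ξ', s', hq, ha, ha', rfl⟩ | ⟨i, hpS, hp⟩)
    · exact hv.tip_mem_frontier hκ hq ha ha'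
    · exact mem_frontier_of_mem_sphere hκ hpS hp

lemma bary_sub_add_one_nonneg (hT : InReuleaux v x) (hrt : r ≠ t) :
    0 ≤ bary v r x - bary v t x + 1 := by
  obtain ⟨l, m, hq⟩ := exists_quad hrt
  have hQ := hT r
  rw [hq.quadForm_eq] at hQ
  by_contra! hneg
  rcases le_or_gt 0 (1 + bary v r x) with h0 | h0 <;>
    nlinarith [h0, sq_nonneg (bary v l x), sq_nonneg (bary v m x)]

lemma mem_outerNormals_vertex (hv : RegularSimplex v)
    (hu : ∀ r, r ≠ t → ⟪u, v r - vertexCentroid v⟫ ≤ 0) :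
    u ∈ outerNormals (peaBody v κ) (v t) := by
  intro x hx
  have hT := hv.inReuleaux_of_mem_peaBody hx
  have hsum : ∑ r, ⟪u, v r - vertexCentroid v⟫ = 0 := by
    rw [← inner_sum, sum_sub_vertexCentroid, inner_zero_right]
  -- Since the factors `⟪u, v r - vertexCentroid v⟫` add up to zero, a constant may be added to the
  -- other factors; the choice below makes the summand at `t` vanish.
  have hinner : ⟪u, x - v t⟫ =
      ∑ r, ⟪u, v r - vertexCentroid v⟫ *
        (bary v r x - bary v t x + 1 - if r = t then 1 else 0) := by
    have hexpand : ∀ r, ⟪x - v t, v r - vertexCentroid v⟫ =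
        2 * (bary v r x - if r = t then 1 else 0) := fun r => by
      rw [← hv.bary_vertex r t, bary_sub, mul_div_cancel₀ _ two_ne_zero]
    rw [hv.inner_eq card_fin_four_eq_finrank_add_one, Finset.sum_div, ← sub_eq_zero,
      ← Finset.sum_sub_distrib]
    calc _ = ∑ r, (bary v t x - 1) * ⟪u, v r - vertexCentroid v⟫ :=
          Finset.sum_congr rfl fun r _ => by rw [hexpand]; ring
      _ = 0 := by rw [← Finset.mul_sum, hsum, mul_zero]
  rw [hinner]
  refine Finset.sum_nonpos fun r _ => ?_
  rcases eq_or_ne r t with rfl | hrt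
  · simp
  · rw [if_neg hrt, sub_zero]
    exact mul_nonpos_of_nonpos_of_nonneg (hu r hrt) (bary_sub_add_one_nonneg hT hrt)

theorem isVertexSingularity (hv : RegularSimplex v) (hκ : Weights κ) (t : Fin 4) :
    IsVertexSingularity (peaBody v κ) (v t) := by
  obtain ⟨r, hr⟩ := hv.exists_mem_sphere_of_mem_range (mem_range_self t)
  refine ⟨mem_frontier_of_mem_sphere hκ hr (hv.vertex_mem_peaBody hκ t), ?_⟩
  have hopen : IsOpen {u : E3 | ∀ r, r ≠ t → ⟪u, v r - vertexCentroid v⟫ < 0} := by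
    simp only [ofPred_forall]
    exact isOpen_iInter_of_finite fun r => isOpen_iInter_of_finite fun _ =>
      isOpen_lt (by fun_prop) continuous_const
  refine ⟨v t - vertexCentroid v, mem_interior.2
    ⟨_, fun u hu => hv.mem_outerNormals_vertex fun r hrt => (hu r hrt).le, hopen, fun r hrt => ?_⟩⟩
  rw [hv.inner_sub_vertexCentroid, if_neg hrt.symm]
  norm_num

end RegularSimplex

end Caps

/-! ### The parameters of a confocal pair -/

section ConfocalParameters

variable {k L k' L' P Q P' Q' r r' h ξ s : ℝ} {F F' : Set ℝ}

/-- The point at height `h` on the axis lies on the conic `dist x c = r - k s`, where `s` is the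
height of `x`. If `P` is the height of `c` and `r ^ 2 = 1 + 8 P ^ 2`, this condition depends on `P`
and `r` only through `L = r k - 8 P`. -/
def IsAxisPoint (k L h : ℝ) : Prop := 1 - 2 * L * h + (k ^ 2 - 8) * h ^ 2 = 0

/-- The point at height `X` on the axis is a focus of the conic with parameters `k` and `L`. -/
def IsFocus (k L X : ℝ) : Prop := (L + 8 * X) ^ 2 = k ^ 2 * (1 + 8 * X ^ 2)

/-- The parameters of a frame with respect to its axis: the principal centre has height `P`, the
principal circle has radius `r`, a pea whose centre has height `s` has radius `k * s`, and `F`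
consists of the heights of the foci of the pea string. Heights are measured from the beam, with
length unit `√8`; the beam has length `2`. -/
structure FrameParams (k P r : ℝ) (F : Set ℝ) : Prop where
  pos : 0 < r
  sq_eq : r ^ 2 = 1 + 8 * P ^ 2
  mul_nonpos : k * P ≤ 0
  mem : P ∈ F
  parabolic_or : k ^ 2 = 8 ∨ ∃ Q ∈ F, P ≠ Q ∧ IsFocus k (r * k - 8 * P) Q

lemma quadratic_coeffs_of_roots {A B C X Y : ℝ} (hXY : X ≠ Y) (hX : A * X ^ 2 + B * X + C = 0)
    (hY : A * Y ^ 2 + B * Y + C = 0) : B = -(A * (X + Y)) ∧ C = A * (X * Y) := by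
  have hB : B = -(A * (X + Y)) := by
    apply mul_left_cancel₀ (sub_ne_zero.2 hXY)
    linear_combination hX - hY
  refine ⟨hB, ?_⟩
  rw [hB] at hX
  linear_combination hX

namespace IsFocus

lemma sum_prod (hP : IsFocus k L P) (hQ : IsFocus k L Q) (hPQ : P ≠ Q) :
    (k ^ 2 - 8) * (P + Q) = 2 * L ∧ 8 * (k ^ 2 - 8) * (P * Q) = k ^ 2 - L ^ 2 := by
  unfold IsFocus at hP hQ
  obtain ⟨hB, hC⟩ := quadratic_coeffs_of_roots (A := -(8 * (k ^ 2 - 8))) (B := 16 * L)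
    (C := L ^ 2 - k ^ 2) hPQ (by linear_combination hP) (by linear_combination hQ)
  exact ⟨by linear_combination (-1 / 8) * hB, by linear_combination hC⟩

lemma sq_ne (hP : IsFocus k L P) (hQ : IsFocus k L Q) (hPQ : P ≠ Q) : L ^ 2 ≠ k ^ 2 - 8 := by
  intro hL
  obtain ⟨hsum, hprod⟩ := hP.sum_prod hQ hPQ
  have hdisc : ((k ^ 2 - 8) * (P - Q)) ^ 2 = 0 := by
    linear_combination ((k ^ 2 - 8) * (P + Q) + 2 * L) * hsum - (k ^ 2 - 8) / 2 * hprod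
      + k ^ 2 / 2 * hL
  have hk : k ^ 2 - 8 = 0 :=
    (mul_eq_zero.1 (pow_eq_zero_iff two_ne_zero |>.1 hdisc)).resolve_right (sub_ne_zero.2 hPQ)
  rw [hk] at hprod hL
  linarith

end IsFocus

lemma IsAxisPoint.sum_prod (hP : IsAxisPoint k L (-1 / 2 - P)) (hQ : IsAxisPoint k L (-1 / 2 - Q))
    (hPQ : P ≠ Q) : 2 * L + (k ^ 2 - 8) = -((k ^ 2 - 8) * (P + Q)) ∧
      1 + L + (k ^ 2 - 8) / 4 = (k ^ 2 - 8) * (P * Q) := by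
  unfold IsAxisPoint at hP hQ
  exact quadratic_coeffs_of_roots hPQ (by linear_combination hP) (by linear_combination hQ)

lemma IsAxisPoint.sq_ne_eight (hP : IsAxisPoint k L (-1 / 2 - P))
    (hQ : IsAxisPoint k L (-1 / 2 - Q)) (hPQ : P ≠ Q) : k ^ 2 ≠ 8 := by
  intro hk
  obtain ⟨hsum, hprod⟩ := hP.sum_prod hQ hPQ
  rw [hk] at hsum hprod
  linarith

/-- The equations that the parameters of confocal pea strings satisfy, whatever the type of the
frames. The opposite beam is at height `-1 / 2`, whence the reflection `X ↦ -1 / 2 - X` between the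
heights over the two beams. -/
structure ConfocalParams (k L k' L' : ℝ) : Prop where
  sq_sub_four : (L - 4) ^ 2 = 4 * k ^ 2
  sq_mul : (k * k') ^ 2 = 64
  sub_four_mul : (L' - 4) * k ^ 2 = 8 * (L - 4)

namespace ConfocalParams

lemma of_central (hP : IsFocus k L P) (hQ : IsFocus k L Q) (hPQ : P ≠ Q)
    (hP' : IsFocus k' L' P') (hQ' : IsFocus k' L' Q') (hPQ' : P' ≠ Q')
    (sP : IsAxisPoint k' L' (-1 / 2 - P)) (sQ : IsAxisPoint k' L' (-1 / 2 - Q))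
    (sP' : IsAxisPoint k L (-1 / 2 - P')) (sQ' : IsAxisPoint k L (-1 / 2 - Q')) :
    ConfocalParams k L k' L' := by
  obtain ⟨hsum, hprod⟩ := hP.sum_prod hQ hPQ
  obtain ⟨hsum', hprod'⟩ := hP'.sum_prod hQ' hPQ'
  obtain ⟨tsum, tprod⟩ := sP.sum_prod sQ hPQ
  obtain ⟨-, tprod'⟩ := sP'.sum_prod sQ' hPQ'
  have hdisc := sub_ne_zero.2 (hP.sq_ne hQ hPQ)
  have ha : k ^ 2 - 8 ≠ 0 := sub_ne_zero.2 (sP'.sq_ne_eight sQ' hPQ')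
  obtain ⟨a, hk⟩ : ∃ a, k ^ 2 = a + 8 := ⟨k ^ 2 - 8, by ring⟩
  obtain ⟨a', hk'⟩ : ∃ a', k' ^ 2 = a' + 8 := ⟨k' ^ 2 - 8, by ring⟩
  simp only [hk, hk', add_sub_cancel_right]
    at hsum hprod hsum' hprod' tsum tprod tprod' hdisc ha
  -- the quadratic equations of the foci and of the axis points are proportional, with factor `c`
  obtain ⟨c, hc⟩ : ∃ c, a' = -(8 * a) * c := ⟨-a' / (8 * a), by field_simp⟩
  have hL' : L' = 4 * c * (2 * L + a) := by
    rw [hc] at tsum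
    linear_combination (1 / 2) * tsum + 4 * c * hsum
  have hcL : c * ((L - 4) ^ 2 - 3 * (a + 8)) = 1 := by
    rw [hL', hc] at tprod
    linear_combination -tprod + c * hprod
  have hc0 : c ≠ 0 := left_ne_zero_of_mul_eq_one hcL
  have hLa : L ^ 2 - 2 * a = 2 * c * (2 * L + a) ^ 2 := by
    have h : 64 * c * (1 + L + a / 4) = L' ^ 2 - (a' + 8) := by
      rw [tprod', ← neg_sub, ← hprod', hc]; ring
    apply mul_left_cancel₀ hc0
    rw [hL', hc] at h
    linear_combination (1 / 8) * h + hcL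
  have hL4 : (L - 4) ^ 2 - 4 * (a + 8) = 0 := by
    apply mul_left_cancel₀ hdisc
    linear_combination ((L - 4) ^ 2 - 3 * (a + 8)) * hLa + 2 * (2 * L + a) ^ 2 * hcL
  have hck : c * (a + 8) = 1 := by linear_combination hcL - c * hL4
  refine ⟨by rw [hk]; linarith, ?_, ?_⟩
  · rw [mul_pow, hk, hk', hc]
    linear_combination (-8 * a) * hck
  · rw [hk, hL']
    linear_combination (4 * (2 * L + a)) * hck

lemma of_parabolic (hk : k ^ 2 = 8) (hk' : k' ^ 2 = 8) (hP : IsFocus k L P)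
    (hP' : IsFocus k' L' P') (sP : IsAxisPoint k' L' (-1 / 2 - P))
    (sP' : IsAxisPoint k L (-1 / 2 - P')) : ConfocalParams k L k' L' := by
  unfold IsFocus at hP hP'
  unfold IsAxisPoint at sP sP'
  simp only [hk, hk', sub_self, zero_mul, add_zero] at hP hP' sP sP'
  have hL0 : L ≠ 0 := by rintro rfl; norm_num at sP'
  have hL0' : L' ≠ 0 := by rintro rfl; norm_num at sP
  have e : 8 * L + 8 * L * L' + L' * (8 - L ^ 2) = 0 := by
    linear_combination 8 * L * sP - L' * hP
  have e' : 8 * L' + 8 * L * L' + L * (8 - L' ^ 2) = 0 := by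
    linear_combination 8 * L' * sP' - L * hP'
  have hLL : L' = L := by
    apply mul_left_cancel₀ (mul_ne_zero hL0 hL0')
    linear_combination e - e'
  subst hLL
  refine ⟨?_, by rw [mul_pow, hk, hk']; norm_num, by rw [hk]; ring⟩
  apply mul_left_cancel₀ hL0
  rw [hk]
  linear_combination -e

lemma exists_signs (h : ConfocalParams k L k' L') : ∃ δ ε : ℝ, (δ = 1 ∨ δ = -1) ∧
    (ε = 1 ∨ ε = -1) ∧ k * k' = 8 * δ ∧ L = 4 + 2 * ε * k ∧ L' = 4 + 2 * (δ * ε) * k' := by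
  have hk : k ^ 2 ≠ 0 := by
    intro hk
    have := h.sq_mul
    rw [mul_pow, hk] at this
    norm_num at this
  obtain ⟨δ, hδ, hkk⟩ : ∃ δ : ℝ, (δ = 1 ∨ δ = -1) ∧ k * k' = 8 * δ := by
    rcases sq_eq_sq_iff_eq_or_eq_neg.1 (h.sq_mul.trans (by norm_num : (64 : ℝ) = 8 ^ 2)) with e | e
    · exact ⟨1, Or.inl rfl, by linarith⟩
    · exact ⟨-1, Or.inr rfl, by linarith⟩
  obtain ⟨ε, hε, hL⟩ : ∃ ε : ℝ, (ε = 1 ∨ ε = -1) ∧ L = 4 + 2 * ε * k := by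
    have hsq : (L - 4) ^ 2 = (2 * k) ^ 2 := by rw [h.sq_sub_four]; ring
    rcases sq_eq_sq_iff_eq_or_eq_neg.1 hsq with e | e
    · exact ⟨1, Or.inl rfl, by linarith⟩
    · exact ⟨-1, Or.inr rfl, by linarith⟩
  refine ⟨δ, ε, hδ, hε, hkk, hL, ?_⟩
  have hδ2 : δ ^ 2 = 1 := sq_eq_one_iff.2 hδ
  apply mul_right_cancel₀ hk
  have h3 := h.sub_four_mul
  rw [hL] at h3
  linear_combination h3 - 2 * δ * ε * k * hkk - 16 * ε * k * hδ2

end ConfocalParams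

namespace FrameParams

variable (D : FrameParams k P r F) (D₂ : FrameParams k' P' r' F')
include D

lemma isFocus : IsFocus k (r * k - 8 * P) P := by
  unfold IsFocus
  rw [← D.sq_eq]; ring

lemma isAxisPoint_iff : IsAxisPoint k (r * k - 8 * P) h ↔ 8 * (h - P) ^ 2 = (r - k * h) ^ 2 := by
  unfold IsAxisPoint
  constructor <;> intro e
  · linear_combination -e - D.sq_eq
  · linear_combination -e - D.sq_eq

lemma one_le : 1 ≤ r := by
  nlinarith [D.sq_eq, D.pos, sq_nonneg P]

lemma two_mul_lt : 2 * P < r :=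
  lt_of_pow_lt_pow_left₀ 2 D.pos.le (by rw [D.sq_eq]; nlinarith [sq_nonneg P])

include D₂ in
lemma eight_mul_le : 8 * (P * P') ≤ r * r' := by
  refine le_of_sq_le_sq ?_ (mul_pos D.pos D₂.pos).le
  rw [mul_pow r, D.sq_eq, D₂.sq_eq]
  nlinarith [sq_nonneg P, sq_nonneg P']

lemma sub_one_sq_le : (r - 1) ^ 2 ≤ 8 * P ^ 2 := by
  linarith [D.sq_eq, D.one_le]

include D₂ in
lemma sub_one_mul_le (hP : 0 ≤ P) (hP' : 0 ≤ P') : (r - 1) * (r' - 1) ≤ 8 * (P * P') := by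
  refine le_of_sq_le_sq ?_ (by positivity)
  calc ((r - 1) * (r' - 1)) ^ 2 = (r - 1) ^ 2 * (r' - 1) ^ 2 := mul_pow _ _ _
    _ ≤ (8 * P ^ 2) * (8 * P' ^ 2) :=
      mul_le_mul D.sub_one_sq_le D₂.sub_one_sq_le (sq_nonneg _) (by positivity)
    _ = (8 * (P * P')) ^ 2 := by ring

include D₂ in
lemma confocalParams
    (hF : ∀ X ∈ F, IsAxisPoint k' (r' * k' - 8 * P') (-1 / 2 - X))
    (hF' : ∀ X ∈ F', IsAxisPoint k (r * k - 8 * P) (-1 / 2 - X)) :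
    ConfocalParams k (r * k - 8 * P) k' (r' * k' - 8 * P') := by
  have sP := hF P D.mem
  have sP' := hF' P' D₂.mem
  rcases D.parabolic_or with hk | ⟨Q, hQF, hPQ, hQ⟩ <;>
    rcases D₂.parabolic_or with hk' | ⟨Q', hQF', hPQ', hQ'⟩
  · exact .of_parabolic hk hk' D.isFocus D₂.isFocus sP sP'
  · exact absurd hk (sP'.sq_ne_eight (hF' Q' hQF') hPQ')
  · exact absurd hk' (sP.sq_ne_eight (hF Q hQF) hPQ)
  · exact .of_central D.isFocus hQ hPQ D₂.isFocus hQ' hPQ' sP (hF Q hQF) sP' (hF' Q' hQF')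

include D₂ in
lemma not_mixed_signs (hkk : k * k' = -8) (hL : r * k - 8 * P = 4 + 2 * k)
    (hL' : r' * k' - 8 * P' = 4 - 2 * k')
    (hbulb : 0 ≤ k' * (-1 / 2 - P) ∨ k * (-1 / 2 - P') ≤ r) : False := by
  have hk0 : k ≠ 0 := by rintro rfl; norm_num at hkk
  have hr' := D₂.pos
  rcases lt_or_gt_of_ne hk0 with hk | hk
  · have hP : 0 ≤ P := nonneg_of_mul_nonpos_right D.mul_nonpos hk
    have hr : r - 2 < 0 := neg_of_mul_pos_right (by linarith : 0 < k * (r - 2)) hk.le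
    have e : k' * (-1 / 2 - P) = r - 2 := by linear_combination (1 / 8) * (k' * hL - (r - 2) * hkk)
    have e' : k * (-1 / 2 - P') = r' + 2 := by
      linear_combination (1 / 8) * (k * hL' - (r' + 2) * hkk)
    rcases hbulb with hb | hb <;> linarith
  · have hk' : k' < 0 := neg_of_mul_neg_right (by linarith) hk.le
    have hP' : 0 ≤ P' := nonneg_of_mul_nonpos_right D₂.mul_nonpos hk'
    have : k' * (r' + 2) < 0 := mul_neg_of_neg_of_pos hk' (by linarith)
    linarith

include D₂ in
/-- The bulb excludes `k * k' = -8`; when `k * k' = 8`, the equation `s` between the axis points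
excludes all signs but the positive ones, since it bounds `(r + r' ∓ 2) ^ 2`. -/
lemma pos_of_confocalParams (C : ConfocalParams k (r * k - 8 * P) k' (r' * k' - 8 * P'))
    (s : IsAxisPoint k' (r' * k' - 8 * P') (-1 / 2 - P))
    (hbulb : (0 ≤ k' * (-1 / 2 - P) ∧ k' * (-1 / 2 - P) ≤ r') ∨
      (0 ≤ k * (-1 / 2 - P') ∧ k * (-1 / 2 - P') ≤ r)) :
    0 < k ∧ 0 < k' ∧ k * k' = 8 ∧ r * k - 8 * P = 4 + 2 * k ∧ r' * k' - 8 * P' = 4 + 2 * k' := by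
  obtain ⟨δ, ε, hδ, hε, hkk, hL, hL'⟩ := C.exists_signs
  rw [D₂.isAxisPoint_iff] at s
  have hr := D.one_le
  have hr' := D₂.one_le
  rcases hδ with rfl | rfl
  · have hkP : k' * (-1 / 2 - P) = -(r - 2 * ε) := by
      linear_combination (1 / 8) * (k' * hL - (r - 2 * ε) * hkk)
    rw [hkP] at s
    rcases hε with rfl | rfl
    · have hk0 : k ≠ 0 := by rintro rfl; norm_num at hkk
      rcases lt_or_gt_of_ne hk0 with hk | hk
      · have hk' : k' < 0 := neg_of_mul_pos_right (by linarith) hk.le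
        have hP : 0 ≤ P := nonneg_of_mul_nonpos_right D.mul_nonpos hk
        have hP' : 0 ≤ P' := nonneg_of_mul_nonpos_right D₂.mul_nonpos hk'
        linarith [D.sub_one_mul_le D₂ hP hP', D.sq_eq, D₂.sq_eq]
      · exact ⟨hk, pos_of_mul_pos_right (by linarith) hk.le, by linarith, by linarith,
          by linarith⟩
    · linarith [D.eight_mul_le D₂, D.two_mul_lt, D₂.two_mul_lt, D.sq_eq, D₂.sq_eq]
  · rcases hε with rfl | rfl
    · exact (D.not_mixed_signs D₂ (by linarith) (by linarith) (by linarith)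
        (hbulb.imp And.left And.right)).elim
    · exact (D₂.not_mixed_signs D (by linarith) (by linarith) (by linarith)
        (hbulb.symm.imp And.left And.right)).elim

lemma onArc_iff (hk : 0 < k) (hL : r * k - 8 * P = 4 + 2 * k) :
    (0 ≤ k * s ∧ k * s ≤ r ∧ ξ ^ 2 + 8 * (s - P) ^ 2 = (r - k * s) ^ 2) ↔ OnArc k ξ s := by
  have hP : P ≤ 0 := nonpos_of_mul_nonpos_right D.mul_nonpos hk
  have hr := D.one_le
  constructor
  · rintro ⟨h1, h2, h3⟩
    have hs : 0 ≤ s := nonneg_of_mul_nonneg_right h1 hk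
    refine ⟨hs, ?_, by linear_combination h3 + D.sq_eq - 2 * s * hL⟩
    by_contra! h4
    have hr2 : (r - k * s) ^ 2 ≤ (r - 2) ^ 2 := pow_le_pow_left₀ (by linarith) (by linarith) 2
    linarith [sq_nonneg ξ, mul_nonneg hs (neg_nonneg.2 hP), sq_nonneg s, D.sq_eq]
  · intro h
    have hks : 0 ≤ k * s := mul_nonneg hk.le h.nonneg
    exact ⟨hks, by linarith [h.eight_mul_le hk, h.nonneg],
      by linear_combination h.eq - D.sq_eq + 2 * s * hL⟩

end FrameParams

end ConfocalParameters

/-! ### Frames in coordinates -/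

section FrameCoordinates

variable {a b n x : E3} {k ξ s P Q t : ℝ}

lemma midpoint_eq_half_smul (a b : E3) : midpoint ℝ a b = (1 / 2 : ℝ) • (a + b) := by
  rw [midpoint_eq_smul_add]; norm_num

/-- The point of the plane of a frame with abscissa `ξ` along the beam `ab` and height `s` along
the axis, whose direction is `n`. The ends of the beam have abscissas `1` and `-1`. -/
def framePt (a b n : E3) (ξ s : ℝ) : E3 := midpoint ℝ a b + ξ • ((1 / 2 : ℝ) • (a - b)) + s • n

@[simp] lemma framePt_one_zero (a b n : E3) : framePt a b n 1 0 = a := by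
  rw [framePt, midpoint_eq_half_smul]; module

@[simp] lemma framePt_zero_zero (a b n : E3) : framePt a b n 0 0 = midpoint ℝ a b := by
  rw [framePt]; module

lemma framePt_sub (ξ s ξ' s' : ℝ) :
    framePt a b n ξ s - framePt a b n ξ' s' =
      (ξ - ξ') • ((1 / 2 : ℝ) • (a - b)) + (s - s') • n := by
  rw [framePt, framePt]; module

lemma lineMap_framePt (ξ s ξ' s' t : ℝ) :
    AffineMap.lineMap (framePt a b n ξ s) (framePt a b n ξ' s') t =
      framePt a b n (ξ + t * (ξ' - ξ)) (s + t * (s' - s)) := by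
  rw [AffineMap.lineMap_apply_module', framePt_sub, framePt, framePt]; module

lemma framePt_zero_eq_lineMap (s : ℝ) :
    framePt a b n 0 s = AffineMap.lineMap (midpoint ℝ a b) (midpoint ℝ a b + n) s := by
  rw [AffineMap.lineMap_apply_module', framePt]; module

lemma mem_line_iff_exists_framePt (n x : E3) :
    x ∈ line[ℝ, a, b] ↔ ∃ ξ, x = framePt a b n ξ 0 := by
  rw [mem_affineSpan_pair_iff_exists_lineMap_eq]
  constructor
  · rintro ⟨t, rfl⟩
    refine ⟨1 - 2 * t, ?_⟩
    rw [framePt, midpoint_eq_half_smul, AffineMap.lineMap_apply_module']; module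
  · rintro ⟨ξ, rfl⟩
    refine ⟨(1 - ξ) / 2, ?_⟩
    rw [framePt, midpoint_eq_half_smul, AffineMap.lineMap_apply_module']; module

lemma sbtw_zero_iff {x y : ℝ} : Sbtw ℝ x 0 y ↔ x * y < 0 := by
  rw [Sbtw, Wbtw, affineSegment_eq_segment, segment_eq_uIcc, mem_uIcc, mul_neg_iff]
  grind

lemma sbtw_framePt_iff (hn : n ≠ 0) :
    Sbtw ℝ (framePt a b n 0 P) (midpoint ℝ a b) (framePt a b n 0 Q) ↔ P * Q < 0 := by
  have hne : midpoint ℝ a b ≠ midpoint ℝ a b + n := by simpa using hn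
  rw [← framePt_zero_zero a b n]
  simp only [framePt_zero_eq_lineMap]
  rw [(AffineMap.lineMap_injective ℝ hne).sbtw_map_iff, sbtw_zero_iff]

/-- The coordinates of `framePt a b n` are orthogonal, and their units are `1` along the beam
and `√8`, twice the distance of opposite edges of a regular tetrahedron of side `2`, along the
axis. -/
structure Adapted (a b n : E3) : Prop where
  dist_eq : dist a b = 2
  sq_norm : ‖n‖ ^ 2 = 8
  perp : inner ℝ n (b - a) = 0

namespace Adapted

variable (h : Adapted a b n)
include h

lemma ne_zero : n ≠ 0 := by
  rintro rfl
  simpa using h.sq_norm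

lemma inner_half : inner ℝ ((1 / 2 : ℝ) • (a - b)) n = 0 := by
  rw [real_inner_smul_left, ← neg_sub b a, inner_neg_left, real_inner_comm, h.perp]
  simp only [neg_zero, mul_zero]

lemma norm_half_sq : ‖(1 / 2 : ℝ) • (a - b)‖ ^ 2 = 1 := by
  rw [norm_smul, ← dist_eq_norm, h.dist_eq]; norm_num

lemma dist_framePt_sq (ξ s ξ' s' : ℝ) :
    dist (framePt a b n ξ s) (framePt a b n ξ' s') ^ 2 = (ξ - ξ') ^ 2 + 8 * (s - s') ^ 2 := by
  rw [dist_eq_norm, framePt_sub, norm_add_sq_real, real_inner_smul_left, real_inner_smul_right,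
    h.inner_half, norm_smul (ξ - ξ'), norm_smul (s - s'), mul_pow, mul_pow, h.norm_half_sq,
    h.sq_norm, Real.norm_eq_abs, Real.norm_eq_abs, sq_abs, sq_abs]
  ring

lemma dist_framePt_left_sq (s : ℝ) : dist (framePt a b n 0 s) a ^ 2 = 1 + 8 * s ^ 2 := by
  have := h.dist_framePt_sq 0 s 1 0
  rw [framePt_one_zero] at this
  rw [this]; ring

lemma dist_framePt_midpoint_sq (s : ℝ) :
    dist (framePt a b n 0 s) (midpoint ℝ a b) ^ 2 = 8 * s ^ 2 := by
  have := h.dist_framePt_sq 0 s 0 0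
  rw [framePt_zero_zero] at this
  rw [this]; ring

lemma framePt_inj {ξ' s' : ℝ} (e : framePt a b n ξ s = framePt a b n ξ' s') : ξ = ξ' ∧ s = s' := by
  have hsq := h.dist_framePt_sq ξ s ξ' s'
  rw [e, dist_self] at hsq
  constructor <;> nlinarith [sq_nonneg (ξ - ξ'), sq_nonneg (s - s')]

lemma framePt_mem_line_iff : framePt a b n ξ s ∈ line[ℝ, a, b] ↔ s = 0 := by
  rw [mem_line_iff_exists_framePt n]
  constructor
  · rintro ⟨ξ', e⟩
    exact (h.framePt_inj e).2
  · rintro rfl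
    exact ⟨ξ, rfl⟩

lemma infDist_framePt (hk : k ^ 2 = 8) (ξ s : ℝ) {T : Set E3}
    (hT : ∀ x, x ∈ T ↔ ∃ ξ', x = framePt a b n ξ' t) :
    infDist (framePt a b n ξ s) T = |k * (s - t)| := by
  have hdist : ∀ ξ', dist (framePt a b n ξ s) (framePt a b n ξ' t) ^ 2
      = (ξ - ξ') ^ 2 + |k * (s - t)| ^ 2 := by
    intro ξ'
    rw [h.dist_framePt_sq, sq_abs, mul_pow, hk]
  apply le_antisymm
  · refine (infDist_le_dist_of_mem ((hT _).2 ⟨ξ, rfl⟩)).trans_eq ?_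
    rw [← sq_eq_sq₀ dist_nonneg (abs_nonneg _), hdist]
    ring
  · rw [le_infDist ⟨_, (hT _).2 ⟨ξ, rfl⟩⟩]
    intro y hy
    obtain ⟨ξ', rfl⟩ := (hT y).1 hy
    rw [← sq_le_sq₀ (abs_nonneg _) dist_nonneg, hdist]
    exact le_add_of_nonneg_left (sq_nonneg _)

lemma wOppSide_framePt_iff (hP : P ≠ 0) :
    (line[ℝ, a, b]).WOppSide (framePt a b n ξ s) (framePt a b n 0 P) ↔ s * P ≤ 0 := by
  constructor
  · rw [AffineSubspace.wOppSide_iff_exists_wbtw]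
    rintro ⟨_, hmem, t, ⟨ht0, ht1⟩, rfl⟩
    rw [lineMap_framePt, h.framePt_mem_line_iff] at hmem
    rcases ht0.eq_or_lt with rfl | ht
    · simp only [zero_mul, add_zero] at hmem
      rw [hmem, zero_mul]
    · have hsP : (1 - t) * (s * P) < 0 := by
        linear_combination P * hmem + mul_pos ht (sq_pos_of_ne_zero hP)
      exact (neg_of_mul_neg_right hsP (sub_nonneg.2 ht1)).le
  · intro hs
    refine AffineSubspace.wOppSide_of_vsub_eq_smul (m := n)
      (h.framePt_mem_line_iff.2 rfl : framePt a b n ξ 0 ∈ _)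
      (h.framePt_mem_line_iff.2 rfl : framePt a b n 0 0 ∈ _) ?_ ?_ hs
    · rw [vsub_eq_sub, framePt_sub]; module
    · rw [vsub_eq_sub, framePt_sub]; module

end Adapted

end FrameCoordinates

namespace PeaPod

variable {a b n x u : E3} {S : PeaPod a b}

variable (S) in
lemma exists_eq_of_mem_plane_direction (hn : n ∈ S.axis.direction) (hn0 : n ≠ 0)
    (hu : u ∈ S.plane.direction) : ∃ α β : ℝ, u = α • (b - a) + β • n := by
  have hperp : inner ℝ n (b - a) = 0 := S.perp n hn
  have hli : LinearIndependent ℝ ![b - a, n] := by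
    apply linearIndependent_of_ne_zero_of_inner_eq_zero (𝕜 := ℝ)
    · simp [Fin.forall_fin_two, sub_ne_zero, S.ne.symm, hn0]
    · simp [Pairwise, Fin.forall_fin_two, hperp, real_inner_comm n]
  have hle : Submodule.span ℝ (range ![b - a, n]) ≤ S.plane.direction := by
    rw [Submodule.span_le, Matrix.range_cons_cons_empty, insert_subset_iff, singleton_subset_iff]
    exact ⟨AffineSubspace.vsub_mem_direction S.right_mem S.left_mem,
      AffineSubspace.direction_le S.axis_le_plane hn⟩
  have hspan := Submodule.eq_of_le_of_finrank_eq hle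
    (by rw [finrank_span_eq_card hli, S.finrank_plane, Fintype.card_fin])
  rw [← hspan, Matrix.range_cons_cons_empty, Submodule.mem_span_pair] at hu
  obtain ⟨α, β, h⟩ := hu
  exact ⟨α, β, h.symm⟩

variable (S) in
lemma midpoint_mem_plane : midpoint ℝ a b ∈ S.plane :=
  AffineMap.lineMap_mem _ S.left_mem S.right_mem

variable (S) in
lemma midpoint_mem_axis : midpoint ℝ a b ∈ S.axis := by
  obtain ⟨⟨n, hn⟩, hn0, -⟩ := finrank_eq_one_iff'.1 S.finrank_axis
  obtain ⟨α, β, h⟩ := S.exists_eq_of_mem_plane_direction hn (by simpa using hn0)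
    (AffineSubspace.vsub_mem_direction (S.axis_le_plane S.center_mem) S.midpoint_mem_plane)
  have hα : α = 0 := by
    have hbis := AffineSubspace.mem_perpBisector_iff_inner_eq_zero.1
      (AffineSubspace.mem_perpBisector_iff_dist_eq.2 S.dist_center)
    rw [vsub_eq_sub b a, h, inner_add_left, real_inner_smul_left, real_inner_smul_left,
      S.perp n hn, mul_zero, add_zero] at hbis
    exact (mul_eq_zero.1 hbis).resolve_right (inner_self_ne_zero.2 (sub_ne_zero.2 S.ne.symm))
  rw [hα, zero_smul, zero_add] at h
  rw [← AffineSubspace.vsub_right_mem_direction_iff_mem S.center_mem, ← neg_vsub_eq_vsub_rev, h]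
  exact neg_mem (Submodule.smul_mem _ _ hn)

lemma mem_plane_iff (hn : n ∈ S.axis.direction) (hn0 : n ≠ 0) :
    x ∈ S.plane ↔ ∃ ξ s, x = framePt a b n ξ s := by
  constructor
  · intro hx
    obtain ⟨α, β, h⟩ := S.exists_eq_of_mem_plane_direction hn hn0
      (AffineSubspace.vsub_mem_direction hx S.midpoint_mem_plane)
    refine ⟨-2 * α, β, ?_⟩
    rw [framePt, add_assoc, ← sub_eq_iff_eq_add', ← vsub_eq_sub, h]; module
  · rintro ⟨ξ, s, rfl⟩
    have : framePt a b n ξ s = ((-ξ / 2) • (b - a) + s • n) +ᵥ midpoint ℝ a b := by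
      rw [framePt, vadd_eq_add]; module
    rw [this]
    exact AffineSubspace.vadd_mem_of_mem_direction (Submodule.add_mem _
      (Submodule.smul_mem _ _ (AffineSubspace.vsub_mem_direction S.right_mem S.left_mem))
      (Submodule.smul_mem _ _ (AffineSubspace.direction_le S.axis_le_plane hn)))
      S.midpoint_mem_plane

lemma exists_eq_framePt_of_mem_axis (hn : n ∈ S.axis.direction) (hn0 : n ≠ 0) (hx : x ∈ S.axis) :
    ∃ s, x = framePt a b n 0 s := by
  obtain ⟨s, hs⟩ := (finrank_eq_one_iff_of_nonzero' (⟨n, hn⟩ : S.axis.direction)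
    (by simpa using hn0)).1 S.finrank_axis
    ⟨_, AffineSubspace.vsub_mem_direction hx S.midpoint_mem_axis⟩
  have hs : s • n = x - midpoint ℝ a b := congrArg Subtype.val hs
  refine ⟨s, ?_⟩
  rw [framePt, hs]; module

end PeaPod

section NormalForm

variable {a b n : E3}

/-- `ρ` is `r` minus the distance of a point at height `s` to the first focus, and the two sides of
the equivalence express its distance to the second focus and its height over the radical axis of
the circles; `σ` is `1` in the elliptic and `-1` in the hyperbolic case. -/
lemma focal_sq_eq_iff {ξ s P Q r R k σ ρ : ℝ} (hr : r ^ 2 = 1 + 8 * P ^ 2)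
    (hR : R ^ 2 = 1 + 8 * Q ^ 2) (hσ : σ ^ 2 = 1) (hne : r + σ * R ≠ 0)
    (hk : k * (r + σ * R) = 8 * (P - Q)) (h : ξ ^ 2 + 8 * (s - P) ^ 2 = (r - ρ) ^ 2) :
    ξ ^ 2 + 8 * (s - Q) ^ 2 = (R + σ * ρ) ^ 2 ↔ ρ = k * s := by
  constructor
  · intro e
    apply mul_right_cancel₀ hne
    linear_combination (1 / 2) * (h - e + hr - hR - ρ ^ 2 * hσ) - s * hk
  · rintro rfl
    linear_combination h + hr - hR - 2 * s * hk - (k * s) ^ 2 * hσ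

namespace PeaPod

variable {S : PeaPod a b} {k P ξ s ρ : ℝ}

/-- The frame `S` in adapted coordinates: the principal centre has height `P`, and the peas and the
pea string are given by the equation `dist x S.center = S.radius - k * s` of a conic with focus
`S.center`, where `s` is the height of `x`. -/
structure NormalForm (S : PeaPod a b) (n : E3) (k P : ℝ) : Prop where
  adapted : Adapted a b n
  params : FrameParams k P S.radius {X | framePt a b n 0 X ∈ S.foci}
  center_eq : S.center = framePt a b n 0 P
  isPea_iff : ∀ ξ s ρ, S.IsPea (framePt a b n ξ s) ρ ↔
    0 ≤ ρ ∧ dist (framePt a b n ξ s) S.center + ρ = S.radius ∧ ρ = k * s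
  dist_sq_of_mem_string : ∀ ξ s, framePt a b n ξ s ∈ S.string →
    dist (framePt a b n ξ s) S.center ^ 2 = (S.radius - k * s) ^ 2

lemma height_center_mem (hP : S.center = framePt a b n 0 P) :
    P ∈ {X | framePt a b n 0 X ∈ S.foci} := by
  rw [mem_ofPred_eq, ← hP]
  unfold foci
  split <;> simp

lemma radius_sq (hA : Adapted a b n) (hP : S.center = framePt a b n 0 P) :
    S.radius ^ 2 = 1 + 8 * P ^ 2 := by
  rw [radius, hP, hA.dist_framePt_left_sq]

lemma radius_pos (S : PeaPod a b) : 0 < S.radius := by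
  refine dist_pos.2 fun h => S.ne ?_
  rw [← h, ← dist_eq_zero, ← S.dist_center, h, dist_self]

/-- A frame with two circles, which are treated alike with the help of the sign `σ`. -/
lemma normalForm_of_circles {Q R σ : ℝ} (hA : Adapted a b n) (hn : n ∈ S.axis.direction)
    (hP : S.center = framePt a b n 0 P) (hR : R = dist (framePt a b n 0 Q) a) (hσ : σ ^ 2 = 1)
    (hne : S.radius + σ * R ≠ 0) (hk : k * (S.radius + σ * R) = 8 * (P - Q)) (hPQ : P ≠ Q)
    (hkP : k * P ≤ 0) (hQ : framePt a b n 0 Q ∈ S.foci)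
    (hpea : ∀ x ρ, S.IsPea x ρ ↔ x ∈ S.plane ∧ 0 ≤ ρ ∧ dist x S.center + ρ = S.radius ∧
      dist x (framePt a b n 0 Q) = R + σ * ρ)
    (hnonneg : ∀ ρ, 0 ≤ ρ → ρ ≤ S.radius → 0 ≤ R + σ * ρ)
    (hstring : ∀ x ∈ S.string, ∃ ρ, dist x S.center ^ 2 = (S.radius - ρ) ^ 2 ∧
      dist x (framePt a b n 0 Q) ^ 2 = (R + σ * ρ) ^ 2) :
    S.NormalForm n k P := by
  have hr2 := radius_sq hA hP
  have hR2 : R ^ 2 = 1 + 8 * Q ^ 2 := by rw [hR, hA.dist_framePt_left_sq]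
  have hfocal : ∀ {ξ s ρ}, dist (framePt a b n ξ s) S.center ^ 2 = (S.radius - ρ) ^ 2 →
      (dist (framePt a b n ξ s) (framePt a b n 0 Q) ^ 2 = (R + σ * ρ) ^ 2 ↔ ρ = k * s) := by
    intro ξ s ρ e
    rw [hP, hA.dist_framePt_sq, sub_zero] at e
    rw [hA.dist_framePt_sq, sub_zero]
    exact focal_sq_eq_iff hr2 hR2 hσ hne hk e
  refine ⟨hA, ⟨S.radius_pos, hr2, hkP, height_center_mem hP, Or.inr ⟨Q, hQ, hPQ, ?_⟩⟩, hP, ?_, ?_⟩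
  · rw [IsFocus, ← hR2, show S.radius * k - 8 * P + 8 * Q = -(k * σ * R) by linarith]
    linear_combination k ^ 2 * R ^ 2 * hσ
  · intro ξ s ρ
    rw [hpea, and_iff_right ((mem_plane_iff hn hA.ne_zero).2 ⟨ξ, s, rfl⟩)]
    refine and_congr_right fun hρ => and_congr_right fun e => ?_
    have hρr : ρ ≤ S.radius := by linarith [dist_nonneg (x := framePt a b n ξ s) (y := S.center)]
    rw [← sq_eq_sq₀ dist_nonneg (hnonneg ρ hρ hρr), hfocal (by rw [eq_sub_of_add_eq e])]
  · intro ξ s hx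
    obtain ⟨ρ, e, e'⟩ := hstring _ hx
    rw [e, (hfocal e).1 e']

lemma exists_normalForm_of_elliptic {c' : E3} (hA : Adapted a b n) (hn : n ∈ S.axis.direction)
    (hS : S.second = .elliptic c') : ∃ k P, S.NormalForm n k P := by
  have hspec := S.second_spec
  obtain ⟨P, hP⟩ := exists_eq_framePt_of_mem_axis hn hA.ne_zero S.center_mem
  simp only [hS] at hspec
  obtain ⟨hc', -, hbtw, hlt⟩ := hspec
  obtain ⟨Q, rfl⟩ := exists_eq_framePt_of_mem_axis hn hA.ne_zero hc'
  rw [hP, sbtw_framePt_iff hA.ne_zero, not_lt] at hbtw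
  have hsq : P ^ 2 < Q ^ 2 := by
    rw [hP, ← sq_lt_sq₀ dist_nonneg dist_nonneg, hA.dist_framePt_midpoint_sq,
      hA.dist_framePt_midpoint_sq] at hlt
    linarith
  have hPQ : P ^ 2 ≤ P * Q := by
    rw [← sq_abs, ← abs_of_nonneg hbtw, abs_mul, sq]
    exact mul_le_mul_of_nonneg_left (sq_lt_sq.1 hsq).le (abs_nonneg _)
  set R := dist (framePt a b n 0 Q) a with hR
  have hR0 : 0 ≤ R := dist_nonneg
  have hrR : 0 < S.radius + 1 * R := by linarith [S.radius_pos]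
  refine ⟨8 * (P - Q) / (S.radius + 1 * R), P, normalForm_of_circles (σ := 1) hA hn hP hR
    (one_pow 2) hrR.ne' (div_mul_cancel₀ _ hrR.ne') ?_ ?_ ?_ ?_ ?_ ?_⟩
  · rintro rfl
    exact lt_irrefl _ hsq
  · rw [div_mul_eq_mul_div]
    exact div_nonpos_of_nonpos_of_nonneg (by linarith) hrR.le
  · simp [foci, hS]
  · intro x ρ
    simp only [IsPea, hS, one_mul, hR]
  · intro ρ hρ _
    linarith
  · rintro x ⟨-, hx⟩
    simp only [hS] at hx
    exact ⟨S.radius - dist x S.center, by ring, by rw [eq_sub_of_add_eq' hx]; ring⟩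

lemma exists_normalForm_of_hyperbolic {c' : E3} (hA : Adapted a b n) (hn : n ∈ S.axis.direction)
    (hS : S.second = .hyperbolic c') : ∃ k P, S.NormalForm n k P := by
  have hspec := S.second_spec
  obtain ⟨P, hP⟩ := exists_eq_framePt_of_mem_axis hn hA.ne_zero S.center_mem
  simp only [hS] at hspec
  obtain ⟨hc', -, hbtw, hlt⟩ := hspec
  obtain ⟨Q, rfl⟩ := exists_eq_framePt_of_mem_axis hn hA.ne_zero hc'
  rw [hP, sbtw_framePt_iff hA.ne_zero] at hbtw
  set R := dist (framePt a b n 0 Q) a with hR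
  have hrR : S.radius + -1 * R < 0 := by rw [radius]; linarith
  refine ⟨8 * (P - Q) / (S.radius + -1 * R), P, normalForm_of_circles (σ := -1) hA hn hP hR
    (by norm_num) hrR.ne (div_mul_cancel₀ _ hrR.ne) ?_ ?_ ?_ ?_ ?_ ?_⟩
  · rintro rfl
    exact (mul_self_nonneg P).not_gt hbtw
  · rw [div_mul_eq_mul_div]
    exact div_nonpos_of_nonneg_of_nonpos (by linarith [sq_nonneg P]) hrR.le
  · simp [foci, hS]
  · intro x ρ
    simp only [IsPea, hS, hR, ← eq_sub_iff_add_eq, neg_one_mul, ← sub_eq_add_neg]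
  · intro ρ _ hρ
    linarith
  · rintro x ⟨-, hx⟩
    simp only [hS] at hx
    -- the two branches of the hyperbola correspond to internal and external tangency
    rcases eq_or_eq_neg_of_abs_eq hx with e | e
    · exact ⟨S.radius - dist x S.center, by ring, by rw [sub_eq_iff_eq_add.1 e]; ring⟩
    · exact ⟨S.radius + dist x S.center, by ring, by rw [sub_eq_iff_eq_add.1 e]; ring⟩

lemma directrix_eq (hA : Adapted a b n) (hP : S.center = framePt a b n 0 P) (hk : k ^ 2 = 8)
    (hkP : k * P < 0) (x : E3) :
    x ∈ (S.directrix : Set E3) ↔ ∃ ξ, x = framePt a b n ξ (S.radius / k) := by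
  have hk0 : k ≠ 0 := left_ne_zero_of_mul hkP.ne
  have hP0 : P ≠ 0 := right_ne_zero_of_mul hkP.ne
  have hdist : dist (midpoint ℝ a b) S.center = -(k * P) := by
    rw [← sq_eq_sq₀ dist_nonneg (by linarith), dist_comm, hP, hA.dist_framePt_midpoint_sq]
    linear_combination (-P ^ 2) * hk
  have hbase : midpoint ℝ a b + (S.radius / dist (midpoint ℝ a b) S.center) •
      (midpoint ℝ a b - S.center) = framePt a b n 0 (S.radius / k) := by
    rw [hdist, hP, framePt, framePt]
    match_scalars
    · ring
    · ring
    · ring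
    · field_simp
  rw [SetLike.mem_coe, directrix, hbase, AffineSubspace.mem_mk', vsub_eq_sub,
    Submodule.mem_span_singleton]
  constructor
  · rintro ⟨t, ht⟩
    refine ⟨-2 * t, ?_⟩
    rw [eq_add_of_sub_eq ht.symm, framePt, framePt]
    module
  · rintro ⟨ξ, rfl⟩
    refine ⟨-ξ / 2, ?_⟩
    rw [framePt_sub]; module

lemma exists_normalForm_of_parabolic (hA : Adapted a b n) (hn : n ∈ S.axis.direction)
    (hS : S.second = .parabolic) : ∃ k P, S.NormalForm n k P := by
  have hspec := S.second_spec
  obtain ⟨P, hP⟩ := exists_eq_framePt_of_mem_axis hn hA.ne_zero S.center_mem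
  simp only [hS] at hspec
  rw [hP, hA.framePt_mem_line_iff] at hspec
  obtain ⟨k, hk, hkP⟩ : ∃ k : ℝ, k ^ 2 = 8 ∧ k * P < 0 := by
    have hsqrt : √8 ^ 2 = (8 : ℝ) := Real.sq_sqrt (by norm_num)
    have hpos : 0 < √(8 : ℝ) := by positivity
    rcases lt_or_gt_of_ne hspec with h | h
    · exact ⟨√8, hsqrt, mul_neg_of_pos_of_neg hpos h⟩
    · exact ⟨-√8, by rw [neg_sq, hsqrt], mul_neg_of_neg_of_pos (by linarith) h⟩
  have hside : ∀ s, s * P ≤ 0 ↔ 0 ≤ k * s := by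
    intro s
    rw [← mul_nonneg_iff_of_pos_right (neg_pos.2 hkP),
      show k * s * -(k * P) = 8 * -(s * P) by linear_combination (-s * P) * hk,
      mul_nonneg_iff_of_pos_left (by norm_num), neg_nonneg]
  refine ⟨k, P, hA, ⟨S.radius_pos, radius_sq hA hP, hkP.le, height_center_mem hP, Or.inl hk⟩,
    hP, ?_, ?_⟩
  · intro ξ s ρ
    have hplane : framePt a b n ξ s ∈ S.plane := (mem_plane_iff hn hA.ne_zero).2 ⟨ξ, s, rfl⟩
    simp only [IsPea, hS, hplane, true_and]
    refine and_congr_right fun hρ => and_congr_right fun _ => ?_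
    rw [hP, hA.wOppSide_framePt_iff hspec, hside,
      hA.infDist_framePt hk ξ s (mem_line_iff_exists_framePt n), sub_zero]
    constructor
    · rintro ⟨e, hs⟩
      rw [← e, abs_of_nonneg hs]
    · rintro rfl
      exact ⟨abs_of_nonneg hρ, hρ⟩
  · rintro ξ s ⟨-, hx⟩
    simp only [hS] at hx
    have hk0 : k ≠ 0 := left_ne_zero_of_mul hkP.ne
    rw [hx, hA.infDist_framePt hk ξ s (directrix_eq hA hP hk hkP), sq_abs]
    field_simp
    ring

lemma exists_normalForm (S : PeaPod a b) (hA : Adapted a b n) (hn : n ∈ S.axis.direction) :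
    ∃ k P, S.NormalForm n k P := by
  cases hS : S.second with
  | elliptic c' => exact exists_normalForm_of_elliptic hA hn hS
  | hyperbolic c' => exact exists_normalForm_of_hyperbolic hA hn hS
  | parabolic => exact exists_normalForm_of_parabolic hA hn hS

end PeaPod

end NormalForm

section ConfocalPairs

variable {a b c d n : E3}

namespace PeaPod

variable {S : PeaPod a b} {k P ξ s : ℝ}

lemma NormalForm.framePt_mem_arc_iff (N : S.NormalForm n k P) :
    framePt a b n ξ s ∈ S.arc ↔
      0 ≤ k * s ∧ k * s ≤ S.radius ∧ ξ ^ 2 + 8 * (s - P) ^ 2 = (S.radius - k * s) ^ 2 := by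
  have hdist : dist (framePt a b n ξ s) S.center ^ 2 = ξ ^ 2 + 8 * (s - P) ^ 2 := by
    rw [N.center_eq, N.adapted.dist_framePt_sq, sub_zero]
  simp only [arc, mem_ofPred_eq, N.isPea_iff, ← eq_sub_iff_add_eq, ← hdist]
  constructor
  · rintro ⟨_, h0, e, rfl⟩
    exact ⟨h0, sub_nonneg.1 (e ▸ dist_nonneg), by rw [e]⟩
  · rintro ⟨h0, h1, e⟩
    exact ⟨_, h0, (sq_eq_sq₀ dist_nonneg (sub_nonneg.2 h1)).1 e, rfl⟩

lemma NormalForm.peaRadius_framePt (N : S.NormalForm n k P) (h : framePt a b n ξ s ∈ S.arc) :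
    S.peaRadius (framePt a b n ξ s) = k * s := by
  obtain ⟨_, hpea⟩ := h
  obtain ⟨-, e, rfl⟩ := (N.isPea_iff _ _ _).1 hpea
  exact sub_eq_of_eq_add' e.symm

lemma NormalForm.isAxisPoint_of_mem_string (N : S.NormalForm n k P)
    (h : framePt a b n 0 s ∈ S.string) : IsAxisPoint k (S.radius * k - 8 * P) s := by
  have e := N.dist_sq_of_mem_string 0 s h
  rw [N.center_eq, N.adapted.dist_framePt_sq] at e
  rw [N.params.isAxisPoint_iff]
  linarith

/-- The centres of the peas of `S` form a normalized arc `OnArc k` in the coordinates of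
`framePt a b n`, and the pea with centre at height `s` has radius `k * s`. -/
structure HasArc (S : PeaPod a b) (n : E3) (k : ℝ) : Prop where
  mem_arc_iff : ∀ x, x ∈ S.arc ↔ ∃ ξ s, OnArc k ξ s ∧ x = framePt a b n ξ s
  peaRadius_eq : ∀ ξ s, OnArc k ξ s → S.peaRadius (framePt a b n ξ s) = k * s

lemma NormalForm.hasArc (N : S.NormalForm n k P) (hn : n ∈ S.axis.direction) (hk : 0 < k)
    (hL : S.radius * k - 8 * P = 4 + 2 * k) : S.HasArc n k := by
  have hmem : ∀ {ξ s}, framePt a b n ξ s ∈ S.arc ↔ OnArc k ξ s := by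
    intro ξ s
    rw [N.framePt_mem_arc_iff, N.params.onArc_iff hk hL]
  refine ⟨fun x => ⟨fun hx => ?_, ?_⟩, fun ξ s h => N.peaRadius_framePt (hmem.2 h)⟩
  · obtain ⟨ρ, hpea⟩ := hx
    obtain ⟨ξ, s, rfl⟩ := (mem_plane_iff hn N.adapted.ne_zero).1 hpea.1
    exact ⟨ξ, s, hmem.1 ⟨ρ, hpea⟩, rfl⟩
  · rintro ⟨ξ, s, h, rfl⟩
    exact hmem.2 h

end PeaPod

lemma framePt_opposite (a b c d : E3) (X : ℝ) :
    framePt a b (a + b - c - d) 0 X = framePt c d (c + d - a - b) 0 (-1 / 2 - X) := by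
  rw [framePt, framePt, midpoint_eq_half_smul, midpoint_eq_half_smul]; module

namespace IsRegularTetrahedron

lemma opposite {t : ℝ} (h : IsRegularTetrahedron t a b c d) : IsRegularTetrahedron t c d a b := by
  obtain ⟨hab, hac, had, hbc, hbd, hcd⟩ := h
  exact ⟨hcd, by rwa [dist_comm], by rwa [dist_comm], by rwa [dist_comm], by rwa [dist_comm], hab⟩

lemma norm_add_sub_sub_sq {t : ℝ} (h : IsRegularTetrahedron t a b c d) :
    ‖a + b - c - d‖ ^ 2 = 2 * t ^ 2 := by
  have hsq : ∀ {x y : E3}, dist x y = t → ‖x‖ ^ 2 - 2 * inner ℝ x y + ‖y‖ ^ 2 = t ^ 2 := by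
    rintro x y rfl
    rw [← norm_sub_sq_real, dist_eq_norm]
  obtain ⟨hab, hac, had, hbc, hbd, hcd⟩ := h
  rw [← real_inner_self_eq_norm_sq]
  simp only [inner_sub_left, inner_sub_right, inner_add_left, inner_add_right]
  rw [real_inner_comm a b, real_inner_comm a c, real_inner_comm a d, real_inner_comm b c,
    real_inner_comm b d, real_inner_comm c d]
  simp only [real_inner_self_eq_norm_sq]
  linear_combination (-1) * hsq hab - hsq hcd + hsq hac + hsq had + hsq hbc + hsq hbd

end IsRegularTetrahedron

namespace PeaPod

variable {S : PeaPod a b} {S' : PeaPod c d} {k P k' P' : ℝ}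

lemma Confocal.symm (h : S.Confocal S') : S'.Confocal S :=
  ⟨h.axis_eq.symm, h.ortho.symm, h.foci_right, h.foci_left⟩

lemma Confocal.mem_axis_direction (h : S.Confocal S') : a + b - c - d ∈ S.axis.direction := by
  have hmid := AffineSubspace.vsub_mem_direction S.midpoint_mem_axis
    (h.axis_eq ▸ S'.midpoint_mem_axis)
  have htwo : a + b - c - d = (2 : ℝ) • (midpoint ℝ a b -ᵥ midpoint ℝ c d) := by
    rw [vsub_eq_sub, midpoint_eq_half_smul, midpoint_eq_half_smul]; module
  rw [htwo]
  exact Submodule.smul_mem _ _ hmid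

lemma Confocal.adapted (h : S.Confocal S') (ht : IsRegularTetrahedron 2 a b c d) :
    Adapted a b (a + b - c - d) :=
  ⟨ht.1, by rw [ht.norm_add_sub_sub_sq]; norm_num, S.perp _ h.mem_axis_direction⟩

lemma Confocal.isAxisPoint (h : S.Confocal S') (N' : S'.NormalForm (c + d - a - b) k' P') :
    ∀ X ∈ {X | framePt a b (a + b - c - d) 0 X ∈ S.foci},
      IsAxisPoint k' (S'.radius * k' - 8 * P') (-1 / 2 - X) := by
  intro X hX
  apply N'.isAxisPoint_of_mem_string
  rw [← framePt_opposite]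
  exact h.foci_left hX

lemma NormalForm.height_bounds_of_center_mem_arc (N : S.NormalForm (a + b - c - d) k P)
    (N' : S'.NormalForm (c + d - a - b) k' P') (h : S.center ∈ S'.arc) :
    0 ≤ k' * (-1 / 2 - P) ∧ k' * (-1 / 2 - P) ≤ S'.radius := by
  rw [N.center_eq, framePt_opposite, N'.framePt_mem_arc_iff] at h
  exact ⟨h.1, h.2.1⟩

theorem ConvexConfocal.exists_hasArc (h : S.ConvexConfocal S')
    (ht : IsRegularTetrahedron 2 a b c d) :
    ∃ k k' : ℝ, 0 < k ∧ 0 < k' ∧ k * k' = 8 ∧ S.HasArc (a + b - c - d) k ∧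
      S'.HasArc (c + d - a - b) k' := by
  have hc := h.toConfocal
  obtain ⟨k, P, N⟩ := S.exists_normalForm (hc.adapted ht) hc.mem_axis_direction
  obtain ⟨k', P', N'⟩ :=
    S'.exists_normalForm (hc.symm.adapted ht.opposite) hc.symm.mem_axis_direction
  have hF := hc.isAxisPoint N'
  have hF' := hc.symm.isAxisPoint N
  obtain ⟨hk, hk', hkk, hL, hL'⟩ := N.params.pos_of_confocalParams N'.params
    (N.params.confocalParams N'.params hF hF') (hF P N.params.mem)
    (h.bulb.imp (fun hb => N.height_bounds_of_center_mem_arc N' hb.1)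
      fun hb => N'.height_bounds_of_center_mem_arc N hb.1)
  exact ⟨k, k', hk, hk', hkk, N.hasArc hc.mem_axis_direction hk hL,
    N'.hasArc hc.symm.mem_axis_direction hk' hL'⟩

end PeaPod

end ConfocalPairs

/-! ### Assembling the surface -/

section Gluing

variable {v : Fin 4 → E3} {κ : Fin 4 → Fin 4 → ℝ} {i j l m j' l' m' : Fin 4} {p : E3}

lemma Quad.induction {f : Fin 4 → Fin 4 → Fin 4 → Fin 4 → Prop} (h : Quad i j l m)
    (swap_left : ∀ i j l m, f i j l m → f j i l m) (swap_right : ∀ i j l m, f i j l m → f i j m l)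
    (h01 : f 0 1 2 3) (h23 : f 2 3 0 1) (h02 : f 0 2 1 3) (h13 : f 1 3 0 2) (h03 : f 0 3 1 2)
    (h12 : f 1 2 0 3) : f i j l m := by
  have hlt : ∀ {i j l m : Fin 4}, Quad i j l m → i < j → l < m → f i j l m := by
    intro i j l m h hij hlm
    have hcases : (i, j, l, m) = (0, 1, 2, 3) ∨ (i, j, l, m) = (2, 3, 0, 1) ∨
        (i, j, l, m) = (0, 2, 1, 3) ∨ (i, j, l, m) = (1, 3, 0, 2) ∨
        (i, j, l, m) = (0, 3, 1, 2) ∨ (i, j, l, m) = (1, 2, 0, 3) := by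
      clear * - h hij hlm
      revert i j l m
      decide
    simp only [Prod.mk.injEq] at hcases
    obtain ⟨rfl, rfl, rfl, rfl⟩ | ⟨rfl, rfl, rfl, rfl⟩ | ⟨rfl, rfl, rfl, rfl⟩ |
      ⟨rfl, rfl, rfl, rfl⟩ | ⟨rfl, rfl, rfl, rfl⟩ | ⟨rfl, rfl, rfl, rfl⟩ := hcases <;> assumption
  have hleft : ∀ {i j l m : Fin 4}, Quad i j l m → i < j → f i j l m := by
    intro i j l m h hij
    rcases lt_or_gt_of_ne h.2.2.2.2.2 with hlm | hlm
    · exact hlt h hij hlm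
    · exact swap_right _ _ _ _ (hlt h.swap_right hij hlm)
  rcases lt_or_gt_of_ne h.1 with hij | hij
  · exact hleft h hij
  · exact swap_left _ _ _ _ (hleft h.swap_left hij)

lemma Quad.eq_or_eq (h : Quad i j l m) (h' : Quad i j l' m') :
    (l' = l ∧ m' = m) ∨ (l' = m ∧ m' = l) := by
  revert i j l m l' m'; decide

/-- The wedge surface of the arc on the edge `i, j` relative to the arc on the edge `l, m`. -/
def wedgeSet (v : Fin 4 → E3) (κ : Fin 4 → Fin 4 → ℝ) (i j l m : Fin 4) : Set E3 :=
  {p | ∃ ξ s ξ' s', OnArc (κ i j) ξ s ∧ OnArc (κ l m) ξ' s' ∧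
    p = tip (arcPt v i j l m ξ s) (arcPt v l m i j ξ' s') (κ i j * s)}

/-- The boundary curve of the wedge surface of the arc on the edge `i, j` coming from the end `l` of
the opposite edge `l, m`. -/
def curveSet (v : Fin 4 → E3) (κ : Fin 4 → Fin 4 → ℝ) (i j l m : Fin 4) : Set E3 :=
  {p | ∃ ξ s, OnArc (κ i j) ξ s ∧ p = tip (arcPt v i j l m ξ s) (v l) (κ i j * s)}

lemma wedgeSet_swap_left (hκ : Weights κ) : wedgeSet v κ i j l m ⊆ wedgeSet v κ j i l m := by
  rintro p ⟨ξ, s, ξ', s', h, h', rfl⟩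
  rw [hκ.symm i j] at h ⊢
  exact ⟨-ξ, s, ξ', s', h.neg, h', by rw [arcPt_comm_left, arcPt_comm_right v l m i j]⟩

lemma wedgeSet_swap_right (hκ : Weights κ) : wedgeSet v κ i j l m ⊆ wedgeSet v κ i j m l := by
  rintro p ⟨ξ, s, ξ', s', h, h', rfl⟩
  rw [hκ.symm l m] at h'
  exact ⟨ξ, s, -ξ', s', h, h'.neg, by
    rw [arcPt_comm_left v l m, neg_neg, arcPt_comm_right v i j]⟩

lemma curveSet_swap_left (hκ : Weights κ) : curveSet v κ j i l m = curveSet v κ i j l m := by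
  have hsub : ∀ i j, curveSet v κ j i l m ⊆ curveSet v κ i j l m := by
    rintro i j p ⟨ξ, s, h, rfl⟩
    rw [hκ.symm j i] at h ⊢
    exact ⟨-ξ, s, h.neg, by rw [arcPt_comm_left v j i, neg_neg]⟩
  exact (hsub i j).antisymm (hsub j i)

lemma curveSet_subset_gammaSet (h : Quad i j l m) : curveSet v κ l m i j ⊆ gammaSet v κ i := by
  rintro p ⟨ξ, s, ha, rfl⟩
  exact ⟨j, l, m, ξ, s, h, ha, rfl⟩

lemma gammaSet_eq (hκ : Weights κ) (h : Quad i j l m) :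
    gammaSet v κ i = curveSet v κ l m i j ∪ curveSet v κ j m i l ∪ curveSet v κ j l i m := by
  have hl : Quad i l j m := h.swap_middle
  have hm : Quad i m j l := h.swap_right.swap_middle
  have hcurve : ∀ {j l m l' m'}, Quad i j l m → Quad i j l' m' →
      curveSet v κ l' m' i j = curveSet v κ l m i j := by
    intro j l m l' m' h h'
    obtain ⟨rfl, rfl⟩ | ⟨rfl, rfl⟩ := h.eq_or_eq h'
    · rfl
    · exact curveSet_swap_left hκ
  apply Subset.antisymm
  · rintro p ⟨j', l', m', ξ, s, h', ha, rfl⟩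
    have hp : tip (arcPt v l' m' i j' ξ s) (v i) (κ l' m' * s) ∈ curveSet v κ l' m' i j' :=
      ⟨ξ, s, ha, rfl⟩
    rcases h.cases j' with rfl | rfl | rfl | rfl
    · exact absurd rfl h'.1
    · exact Or.inl (Or.inl (hcurve h h' ▸ hp))
    · exact Or.inl (Or.inr (hcurve hl h' ▸ hp))
    · exact Or.inr (hcurve hm h' ▸ hp)
  · exact union_subset (union_subset (curveSet_subset_gammaSet h) (curveSet_subset_gammaSet hl))
      (curveSet_subset_gammaSet hm)

lemma framePt_eq_arcPt (ξ s : ℝ) :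
    framePt (v i) (v j) (v i + v j - v l - v m) ξ s = arcPt v i j l m ξ s := by
  rw [framePt, midpoint_eq_half_smul, arcPt]; module

/-- The pea pod `S` on the edge `i, j` has the normalized arc with parameter `κ i j`. -/
def Realizes (κ : Fin 4 → Fin 4 → ℝ) (l m : Fin 4) (S : PeaPod (v i) (v j)) : Prop :=
  S.HasArc (v i + v j - v l - v m) (κ i j)

lemma Realizes.mem_arc_iff {S : PeaPod (v i) (v j)} (h : Realizes κ l m S) (x : E3) :
    x ∈ S.arc ↔ ∃ ξ s, OnArc (κ i j) ξ s ∧ x = arcPt v i j l m ξ s := by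
  rw [PeaPod.HasArc.mem_arc_iff h]
  simp only [framePt_eq_arcPt]

lemma Realizes.phi_arcPt {S : PeaPod (v i) (v j)} (h : Realizes κ l m S) {ξ s : ℝ}
    (ha : OnArc (κ i j) ξ s) (y : E3) :
    S.phi (arcPt v i j l m ξ s) y = tip (arcPt v i j l m ξ s) y (κ i j * s) := by
  rw [PeaPod.phi, tip, ← framePt_eq_arcPt, PeaPod.HasArc.peaRadius_eq h ξ s ha]

lemma Realizes.wedge_eq {S : PeaPod (v i) (v j)} {S' : PeaPod (v l) (v m)}
    (h : Realizes κ l m S) (h' : Realizes κ i j S') : S.wedge S' = wedgeSet v κ i j l m := by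
  ext p
  constructor
  · rintro ⟨x, hx, y, hy, rfl⟩
    obtain ⟨ξ, s, ha, rfl⟩ := (h.mem_arc_iff x).1 hx
    obtain ⟨ξ', s', ha', rfl⟩ := (h'.mem_arc_iff y).1 hy
    exact ⟨ξ, s, ξ', s', ha, ha', h.phi_arcPt ha _⟩
  · rintro ⟨ξ, s, ξ', s', ha, ha', rfl⟩
    exact ⟨_, (h.mem_arc_iff _).2 ⟨ξ, s, ha, rfl⟩, _, (h'.mem_arc_iff _).2 ⟨ξ', s', ha', rfl⟩,
      (h.phi_arcPt ha _).symm⟩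

lemma Realizes.swap_right {S : PeaPod (v i) (v j)} (h : Realizes κ l m S) : Realizes κ m l S := by
  unfold Realizes at h ⊢
  rwa [sub_right_comm]

lemma Realizes.edgeCurve_eq {S : PeaPod (v i) (v j)} (h : Realizes κ l m S) :
    S.edgeCurve (v l) = curveSet v κ i j l m := by
  ext p
  constructor
  · rintro ⟨x, hx, rfl⟩
    obtain ⟨ξ, s, ha, rfl⟩ := (h.mem_arc_iff x).1 hx
    exact ⟨ξ, s, ha, h.phi_arcPt ha _⟩
  · rintro ⟨ξ, s, ha, rfl⟩
    exact ⟨_, (h.mem_arc_iff _).2 ⟨ξ, s, ha, rfl⟩, (h.phi_arcPt ha _).symm⟩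

lemma gammaSet_eq_edgeCurves (hκ : Weights κ) (h : Quad i j l m) {S : PeaPod (v l) (v m)}
    {T : PeaPod (v j) (v m)} {U : PeaPod (v j) (v l)} (hS : Realizes κ i j S)
    (hT : Realizes κ i l T) (hU : Realizes κ i m U) :
    gammaSet v κ i = S.edgeCurve (v i) ∪ T.edgeCurve (v i) ∪ U.edgeCurve (v i) := by
  rw [gammaSet_eq hκ h, hS.edgeCurve_eq, hT.edgeCurve_eq, hU.edgeCurve_eq]

lemma exists_weights {k k' q q' r r' : ℝ} (hk : 0 < k) (hk' : 0 < k') (hq : 0 < q) (hq' : 0 < q')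
    (hr : 0 < r) (hr' : 0 < r') (hkk : k * k' = 8) (hqq : q * q' = 8) (hrr : r * r' = 8) :
    ∃ κ, Weights κ ∧ κ 0 1 = k ∧ κ 2 3 = k' ∧ κ 0 2 = q ∧ κ 1 3 = q' ∧ κ 0 3 = r ∧ κ 1 2 = r' := by
  obtain ⟨κ, hκ, h01, h23, h02, h13, h03, h12⟩ : ∃ κ : Matrix (Fin 4) (Fin 4) ℝ, κ.IsSymm ∧
      κ 0 1 = k ∧ κ 2 3 = k' ∧ κ 0 2 = q ∧ κ 1 3 = q' ∧ κ 0 3 = r ∧ κ 1 2 = r' := by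
    refine ⟨!![0, k, q, r; k, 0, r', q'; q, r', 0, k'; r, q', k', 0], ?_,
      rfl, rfl, rfl, rfl, rfl, rfl⟩
    ext i j
    fin_cases i <;> fin_cases j <;> rfl
  have symm : ∀ i j, κ i j = κ j i := fun i j => hκ.apply j i
  refine ⟨κ, ⟨symm, fun i j hij => ?_, fun i j l m h => ?_⟩, h01, h23, h02, h13, h03, h12⟩
  · obtain ⟨l, m, h⟩ := exists_quad hij
    refine h.induction (f := fun i j _ _ => 0 < κ i j) (fun i j _ _ => (symm j i).trans_gt)
      (fun _ _ _ _ h => h) ?_ ?_ ?_ ?_ ?_ ?_ <;> simpa only [h01, h23, h02, h13, h03, h12]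
  · refine h.induction (f := fun i j l m => κ i j * κ l m = 8) (fun i j _ _ h => symm i j ▸ h)
      (fun _ _ l m h => symm l m ▸ h) ?_ ?_ ?_ ?_ ?_ ?_ <;>
    simpa only [h01, h23, h02, h13, h03, h12, mul_comm k', mul_comm q', mul_comm r']

lemma exists_mem_wedgeSet_iff (hκ : Weights κ) :
    (∃ i j l m, Quad i j l m ∧ p ∈ wedgeSet v κ i j l m) ↔
      p ∈ wedgeSet v κ 0 1 2 3 ∪ wedgeSet v κ 2 3 0 1 ∪ wedgeSet v κ 0 2 1 3 ∪
        wedgeSet v κ 1 3 0 2 ∪ wedgeSet v κ 0 3 1 2 ∪ wedgeSet v κ 1 2 0 3 := by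
  simp only [mem_union]
  constructor
  · rintro ⟨i, j, l, m, h, hp⟩
    refine h.induction (f := fun i j l m => p ∈ wedgeSet v κ i j l m → _)
      (fun _ _ _ _ hf hp => hf (wedgeSet_swap_left hκ hp))
      (fun _ _ _ _ hf hp => hf (wedgeSet_swap_right hκ hp)) ?_ ?_ ?_ ?_ ?_ ?_ hp <;> tauto
  · rintro (((((h | h) | h) | h) | h) | h)
    exacts [⟨0, 1, 2, 3, by decide, h⟩, ⟨2, 3, 0, 1, by decide, h⟩, ⟨0, 2, 1, 3, by decide, h⟩,
      ⟨1, 3, 0, 2, by decide, h⟩, ⟨0, 3, 1, 2, by decide, h⟩, ⟨1, 2, 0, 3, by decide, h⟩]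

lemma IsRegularTetrahedron.regularSimplex (h : IsRegularTetrahedron 2 (v 0) (v 1) (v 2) (v 3)) :
    RegularSimplex v := by
  obtain ⟨hab, hac, had, hbc, hbd, hcd⟩ := h
  intro i j hij
  fin_cases i <;> fin_cases j <;> first | exact absurd rfl hij | assumption |
    (rw [dist_comm]; assumption)

namespace RegularSimplex

lemma reuleaux_eq (hv : RegularSimplex v) :
    reuleaux (v 0) (v 1) (v 2) (v 3) = {z | InReuleaux v z} := by
  ext z
  simp only [reuleaux, InReuleaux, mem_inter_iff, mem_closedBall, hv.dist_vertex_le,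
    Fin.forall_fin_succ, mem_ofPred_eq]
  simp [and_assoc]

theorem frontier_peaBody_eq_surface (hv : RegularSimplex v) (hκ : Weights κ)
    {AB : PeaPod (v 0) (v 1)} {CD : PeaPod (v 2) (v 3)} {AC : PeaPod (v 0) (v 2)}
    {BD : PeaPod (v 1) (v 3)} {AD : PeaPod (v 0) (v 3)} {BC : PeaPod (v 1) (v 2)}
    (hAB : Realizes κ 2 3 AB) (hCD : Realizes κ 0 1 CD) (hAC : Realizes κ 1 3 AC)
    (hBD : Realizes κ 0 2 BD) (hAD : Realizes κ 1 2 AD) (hBC : Realizes κ 0 3 BC) :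
    frontier (peaBody v κ) = surface AB CD AC BD AD BC := by
  have ha : BC.edgeCurve (v 0) ∪ CD.edgeCurve (v 0) ∪ BD.edgeCurve (v 0) = gammaSet v κ 0 := by
    rw [gammaSet_eq_edgeCurves hκ (j := 1) (by decide) hCD hBD hBC]
    ac_rfl
  have hb : CD.edgeCurve (v 1) ∪ AD.edgeCurve (v 1) ∪ AC.edgeCurve (v 1) = gammaSet v κ 1 :=
    (gammaSet_eq_edgeCurves hκ (j := 0) (by decide) hCD.swap_right hAD hAC).symm
  have hc : AB.edgeCurve (v 2) ∪ BD.edgeCurve (v 2) ∪ AD.edgeCurve (v 2) = gammaSet v κ 2 := by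
    rw [gammaSet_eq_edgeCurves hκ (j := 0) (by decide) hBD.swap_right hAD.swap_right hAB]
    ac_rfl
  have hd : AB.edgeCurve (v 3) ∪ BC.edgeCurve (v 3) ∪ AC.edgeCurve (v 3) = gammaSet v κ 3 := by
    rw [gammaSet_eq_edgeCurves hκ (j := 0) (by decide) hBC.swap_right hAC.swap_right
      hAB.swap_right]
    ac_rfl
  have hcaps : ∀ p, (∃ i, p ∈ sphere (v i) 2 ∩ peaBody v κ) ↔
      p ∈ sphere (v 0) 2 ∩ peaBody v κ ∪ sphere (v 1) 2 ∩ peaBody v κ ∪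
        sphere (v 2) 2 ∩ peaBody v κ ∪ sphere (v 3) 2 ∩ peaBody v κ := by
    simp [Fin.exists_fin_succ, or_assoc, or_and_right]
  rw [surface, ha, hb, hc, hd, hv.reuleaux_eq, hv.cap_eq hκ, hv.cap_eq hκ, hv.cap_eq hκ,
    hv.cap_eq hκ, hAB.wedge_eq hCD, hCD.wedge_eq hAB, hAC.wedge_eq hBD, hBD.wedge_eq hAC,
    hAD.wedge_eq hBC, hBC.wedge_eq hAD]
  ext p
  rw [hv.mem_frontier_iff hκ, mem_union, ← hcaps, ← exists_mem_wedgeSet_iff hκ]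
  simp only [wedgeSet, mem_ofPred_eq, exists_and_left]

lemma exists_weights_of_convexConfocal (hv : RegularSimplex v) {AB : PeaPod (v 0) (v 1)}
    {CD : PeaPod (v 2) (v 3)} {AC : PeaPod (v 0) (v 2)} {BD : PeaPod (v 1) (v 3)}
    {AD : PeaPod (v 0) (v 3)} {BC : PeaPod (v 1) (v 2)} (h₁ : AB.ConvexConfocal CD)
    (h₂ : AC.ConvexConfocal BD) (h₃ : AD.ConvexConfocal BC) :
    ∃ κ, Weights κ ∧ Realizes κ 2 3 AB ∧ Realizes κ 0 1 CD ∧ Realizes κ 1 3 AC ∧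
      Realizes κ 0 2 BD ∧ Realizes κ 1 2 AD ∧ Realizes κ 0 3 BC := by
  have ht : ∀ {i j l m}, Quad i j l m → IsRegularTetrahedron 2 (v i) (v j) (v l) (v m) :=
    fun h => ⟨hv h.1, hv h.2.1, hv h.2.2.1, hv h.2.2.2.1, hv h.2.2.2.2.1, hv h.2.2.2.2.2⟩
  obtain ⟨k, k', hk, hk', hkk, hAB, hCD⟩ := h₁.exists_hasArc (ht (by decide))
  obtain ⟨q, q', hq, hq', hqq, hAC, hBD⟩ := h₂.exists_hasArc (ht (by decide))
  obtain ⟨r, r', hr, hr', hrr, hAD, hBC⟩ := h₃.exists_hasArc (ht (by decide))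
  obtain ⟨κ, hκ, rfl, rfl, rfl, rfl, rfl, rfl⟩ := exists_weights hk hk' hq hq' hr hr' hkk hqq hrr
  exact ⟨κ, hκ, hAB, hCD, hAC, hBD, hAD, hBC⟩

end RegularSimplex

end Gluing

end Peabody

end

theorem mainTheorem1 (a b c d : Peabody.E3) (habcd : Peabody.IsRegularTetrahedron 2 a b c d)
    (AB : Peabody.PeaPod a b) (CD : Peabody.PeaPod c d)
    (AC : Peabody.PeaPod a c) (BD : Peabody.PeaPod b d)
    (AD : Peabody.PeaPod a d) (BC : Peabody.PeaPod b c)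
    (h₁ : AB.ConvexConfocal CD) (h₂ : AC.ConvexConfocal BD) (h₃ : AD.ConvexConfocal BC) :
    ∃ K : ConvexBody Peabody.E3,
      (interior (K : Set Peabody.E3)).Nonempty ∧
      Peabody.HasConstantWidth K 2 ∧
      frontier (K : Set Peabody.E3) = Peabody.surface AB CD AC BD AD BC ∧
      (∀ p ∈ Peabody.surface AB CD AC BD AD BC, p ∉ ({a, b, c, d} : Set Peabody.E3) →
        Peabody.HasUniqueSupportPlane K p ∧
        Peabody.IsRegularSurfaceAt (Peabody.surface AB CD AC BD AD BC) p) ∧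
      (∀ p ∈ ({a, b, c, d} : Set Peabody.E3), Peabody.IsVertexSingularity K p) := by
  obtain ⟨v, rfl, rfl, rfl, rfl⟩ :
      ∃ v : Fin 4 → Peabody.E3, v 0 = a ∧ v 1 = b ∧ v 2 = c ∧ v 3 = d :=
    ⟨![a, b, c, d], rfl, rfl, rfl, rfl⟩
  have hv := habcd.regularSimplex
  have hrange : ({v 0, v 1, v 2, v 3} : Set Peabody.E3) = Set.range v := by
    ext x
    simp [Fin.exists_fin_succ, eq_comm]
  obtain ⟨κ, hκ, hAB, hCD, hAC, hBD, hAD, hBC⟩ := hv.exists_weights_of_convexConfocal h₁ h₂ h₃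
  rw [hrange, ← hv.frontier_peaBody_eq_surface hκ hAB hCD hAC hBD hAD hBC]
  have hcompact := hv.isCompact_peaBody (κ := κ)
  have hconv : Convex ℝ (Peabody.peaBody v κ) := Peabody.convex_ballIntersection _ _
  have hint := hv.interior_peaBody_nonempty hκ
  refine ⟨⟨Peabody.peaBody v κ, hconv, hcompact, hint.mono interior_subset⟩, hint,
    hv.hasConstantWidth hκ, rfl, fun p hp hpv => ⟨hv.hasUniqueSupportPlane hκ hp hpv, ?_⟩, ?_⟩
  · exact Peabody.isRegularSurfaceAt_frontier hcompact hconv hint (Set.finite_range v).isClosed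
      (fun _ => hv.hasUniqueSupportPlane hκ) hp hpv
  · rintro _ ⟨t, rfl⟩
    exact hv.isVertexSingularity hκ t
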